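/- Let $M$ be a smooth (finite-dimensional, Hausdorff) manifold and $\mathbb{T}M=TM\oplus T^*M$, with the pairing $\langle X+\xi,Y+\eta\rangle=\frac12(\xi(Y)+\eta(X))$ and the Dorfman bracket $[X+\xi,Y+\eta]_D=[X,Y]+L_X\eta-\iota_Y d\xi$. An almost generalized complex structure is a smooth bundle endomorphism $\mathcal{J}$ of $\mathbb{T}M$, orthogonal for $\langle\cdot,\cdot\rangle$, with $\mathcal{J}^2=-\mathrm{Id}$. It is integrable (a generalized complex structure) if $[\mathcal{J}A,\mathcal{J}B]_D-\mathcal{J}[\mathcal{J}A,B]_D-\mathcal{J}[A,\mathcal{J}B]_D-[A,B]_D=0$ for all smooth sections $A,B$ of $\mathbb{T}M$. A rank-3 generalized Clifford structure on $M$ is a triple of integrable almost generalized complex structures $\mathcal{I}_1,\mathcal{I}_2,\mathcal{I}_3$ with $\mathcal{I}_i\mathcal{I}_j+\mathcal{I}_j\mathcal{I}_i=-2\delta_{ij}\mathrm{Id}$. Let $(\mathcal{I}_1,\mathcal{I}_2,\mathcal{I}_3)$ be a rank-3 generalized Clifford structure on $M$. Let $S^2\subset\mathbb{R}^3$ be the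 unit sphere, with stereographic coordinate $\zeta\in\mathbb{C}\cup\{\infty\}$ given by $$\zeta\mapsto c(\zeta)=\frac{1}{1+|\zeta|^2}\left(1-|\zeta|^2,\,-\mathbf{i}(\zeta-\bar\zeta),\,-(\zeta+\bar\zeta)\right),$$ and let $J_\zeta$ be the complex structure of $S^2\cong\mathbb{CP}^1$ for which $\zeta$ is a holomorphic coordinate (equivalently $v\mapsto n\times v$ on $T_nS^2$). For $\zeta_1,\zeta_2\in S^2$ let $$\mathcal{K}_1(\zeta_1,\zeta_2)=\frac12\sum_{l=1}^3 c_l(\zeta_1)\left(\mathcal{I}_l+\mathcal{I}_{l+1}\mathcal{I}_{l+2}\right)+\frac12\sum_{l=1}^3 c_l(\zeta_2)\left(-\mathcal{I}_l+\mathcal{I}_{l+1}\mathcal{I}_{l+2}\right)\qquad(\text{indices mod }3).$$ On the twistor space $Z=M\times S^2\times S^2$ define the endomorphism of $TZ\oplus T^*Z$ $$\hat{\mathbb{I}}\big|_{(p,\zeta_1,\zeta_2)}=\mathcal{K}_1(\zeta_1,\zeta_2)\big|_{T_pM\oplus T_p^*M}\ \oplus\ \mathcal{J}\big|_{T(S^2\times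 S^2)\oplus T^*(S^2\times S^2)},\qquad \mathcal{J}=\mathrm{diag}\left(J_{\zeta_1},\,J_{\zeta_2},\,-J_{\zeta_1}^T,\,-J_{\zeta_2}^T\right),$$ where $\mathcal{J}$ is the generalized complex structure induced by the standard complex structure of $\mathbb{CP}^1\times\mathbb{CP}^1$. Then $\hat{\mathbb{I}}$ is a generalized complex structure on $Z$: it is smooth, orthogonal, satisfies $\hat{\mathbb{I}}^2=-\mathrm{Id}$, and is integrable with respect to the Dorfman bracket on $TZ\oplus T^*Z$. -/

import Mathlib

open scoped Manifold ContDiff Bundle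
open Bundle

noncomputable section

/-! ### The generalized tangent bundle `TM ⊕ T*M` and the Dorfman bracket -/

section GeneralizedTangent

variable {E : Type*} [NormedAddCommGroup E] [NormedSpace ℝ E]
  {H : Type*} [TopologicalSpace H] (I : ModelWithCorners ℝ E H)
  {M : Type*} [TopologicalSpace M] [ChartedSpace H M]

/-- The fibre `T_x M ⊕ T_x^* M`. -/
abbrev GenTangent (x : M) : Type _ := TangentSpace I x × (TangentSpace I x →L[ℝ] ℝ)

/-- The pairing `⟨X + ξ, Y + η⟩ = (ξ(Y) + η(X)) / 2`. -/
def genPairing {x : M} (a b : GenTangent I x) : ℝ := (1 / 2) * (a.2 b.1 + b.2 a.1)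

/-- Smooth sections of `TM ⊕ T*M`: a smooth vector field together with a smooth 1-form. -/
structure IsSmoothSection [IsManifold I 1 M] (A : ∀ x : M, GenTangent I x) : Prop where
  vec : ContMDiff I (I.prod 𝓘(ℝ, E)) ∞
    (fun x : M => (TotalSpace.mk' E x (A x).1 : TotalSpace E (TangentSpace I : M → Type _)))
  form : ContMDiff I (I.prod 𝓘(ℝ, E →L[ℝ] ℝ)) ∞
    (fun x : M => (TotalSpace.mk' (E →L[ℝ] ℝ) x (A x).2 :
      TotalSpace (E →L[ℝ] ℝ) (fun y : M => TangentSpace I y →L[ℝ] Trivial M ℝ y)))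

/-- The 1-form `ξ` read in the chart at `x₀`, i.e. its pullback under the inverse chart. -/
def formInChart (ξ : ∀ x : M, TangentSpace I x →L[ℝ] ℝ) (x₀ : M) (u : E) : E →L[ℝ] ℝ :=
  (ξ ((extChartAt I x₀).symm u)).comp
    (mfderivWithin 𝓘(ℝ, E) I (extChartAt I x₀).symm (Set.range I) u)

/-- The contraction `ι_X dξ` at `x`, where `dξ(v, w) = D_v ξ(w) - D_w ξ(v)` in the chart at `x`. -/
def contractExtDeriv (ξ : ∀ x : M, TangentSpace I x →L[ℝ] ℝ) (x : M) (v : TangentSpace I x) :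
    TangentSpace I x →L[ℝ] ℝ :=
  let D : E →L[ℝ] E →L[ℝ] ℝ :=
    fderivWithin ℝ (formInChart I ξ x) (Set.range I) (extChartAt I x x)
  let φ : TangentSpace I x →L[ℝ] E := mfderiv I 𝓘(ℝ, E) (extChartAt I x) x
  (D (φ v) - D.flip (φ v)).comp φ

/-- The Lie derivative of a 1-form, by Cartan's formula `L_X η = d(η(X)) + ι_X dη`. -/
def lieDerivForm (X : ∀ x : M, TangentSpace I x) (η : ∀ x : M, TangentSpace I x →L[ℝ] ℝ) (x : M) :
    TangentSpace I x →L[ℝ] ℝ :=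
  mvfderiv I (fun y : M => η y (X y)) x + contractExtDeriv I η x (X x)

/-- The Dorfman bracket `[X + ξ, Y + η]_D = [X, Y] + L_X η - ι_Y dξ`. -/
def dorfmanBracket (A B : ∀ x : M, GenTangent I x) (x : M) : GenTangent I x :=
  (VectorField.mlieBracket I (fun y => (A y).1) (fun y => (B y).1) x,
    lieDerivForm I (fun y => (A y).1) (fun y => (B y).2) x
      - contractExtDeriv I (fun y => (A y).2) x (B x).1)

/-- The Nijenhuis tensor `[JA, JB]_D - J[JA, B]_D - J[A, JB]_D - [A, B]_D`. -/
def genNijenhuis (J : ∀ x : M, Module.End ℝ (GenTangent I x)) (A B : ∀ x : M, GenTangent I x)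
    (x : M) : GenTangent I x :=
  dorfmanBracket I (fun y => J y (A y)) (fun y => J y (B y)) x
    - J x (dorfmanBracket I (fun y => J y (A y)) B x)
    - J x (dorfmanBracket I A (fun y => J y (B y)) x)
    - dorfmanBracket I A B x

/-- An almost generalized complex structure: a smooth bundle endomorphism of `TM ⊕ T*M`
(fibrewise linear, mapping smooth sections to smooth sections), orthogonal for the pairing, with
square `-Id`. -/
structure IsAlmostGenComplex [IsManifold I 1 M]
    (J : ∀ x : M, Module.End ℝ (GenTangent I x)) : Prop where
  smooth : ∀ A : ∀ x : M, GenTangent I x,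
    IsSmoothSection I A → IsSmoothSection I (fun x => J x (A x))
  orthogonal : ∀ (x : M) (a b : GenTangent I x),
    genPairing I (J x a) (J x b) = genPairing I a b
  sq : ∀ x : M, J x * J x = -1

/-- Integrability with respect to the Dorfman bracket: the Nijenhuis tensor vanishes. -/
def IsDorfmanIntegrable [IsManifold I 1 M] (J : ∀ x : M, Module.End ℝ (GenTangent I x)) : Prop :=
  ∀ A B : ∀ x : M, GenTangent I x, IsSmoothSection I A → IsSmoothSection I B →
    ∀ x : M, genNijenhuis I J A B x = 0

/-- A generalized complex structure. -/
structure IsGenComplex [IsManifold I 1 M]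
    (J : ∀ x : M, Module.End ℝ (GenTangent I x)) : Prop where
  almost : IsAlmostGenComplex I J
  integrable : IsDorfmanIntegrable I J

/-- A rank-`r` generalized Clifford structure: `r` almost generalized complex structures with
`I_i I_j + I_j I_i = -2 δ_{ij} Id`, each of them integrable. -/
structure IsGenClifford [IsManifold I 1 M] {r : ℕ}
    (J : Fin r → ∀ x : M, Module.End ℝ (GenTangent I x)) : Prop where
  almost : ∀ i, IsAlmostGenComplex I (J i)
  clifford : ∀ (i j : Fin r) (x : M),
    J i x * J j x + J j x * J i x = (if i = j then (-2 : ℝ) else 0) • 1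
  integrable : ∀ i, IsDorfmanIntegrable I (J i)

/-- For `a, b ∈ ℝ³` the endomorphism
`½ ∑_l a_l (I_l + I_{l+1} I_{l+2}) + ½ ∑_l b_l (-I_l + I_{l+1} I_{l+2})`, indices mod 3. -/
def cliffordComb (J : Fin 3 → ∀ x : M, Module.End ℝ (GenTangent I x)) (a b : Fin 3 → ℝ) (x : M) :
    Module.End ℝ (GenTangent I x) :=
  (1 / 2 : ℝ) • ∑ l : Fin 3, a l • (J l x + J (l + 1) x * J (l + 2) x)
    + (1 / 2 : ℝ) • ∑ l : Fin 3, b l • (-J l x + J (l + 1) x * J (l + 2) x)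

/-- The matrix `T(ζ)` (and `S(ζ)`), whose entries are written with real and imaginary parts:
`-i(ζ - ζ̄) = 2 Im ζ`, `ζ + ζ̄ = 2 Re ζ`, `(ζ² + ζ̄²)/2 = Re ζ²`, `-(i/2)(ζ² - ζ̄²) = Im ζ²`. -/
def twistorRotation (ζ : ℂ) : Matrix (Fin 3) (Fin 3) ℝ :=
  (1 / (1 + ‖ζ‖ ^ 2)) •
    !![1 - ‖ζ‖ ^ 2, 2 * ζ.im, -(2 * ζ.re);
       -(2 * ζ.im), 1 + (ζ ^ 2).re, (ζ ^ 2).im;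
       2 * ζ.re, (ζ ^ 2).im, 1 - (ζ ^ 2).re]

/-- The Clifford rotations `K_i(ζ₁, ζ₂)`: the `i`-th entry of
`½ T(ζ₁) (I_l + I_{l+1} I_{l+2})_l + ½ S(ζ₂) (-I_l + I_{l+1} I_{l+2})_l`. -/
def cliffordRotation (J : Fin 3 → ∀ x : M, Module.End ℝ (GenTangent I x)) (i : Fin 3) (ζ₁ ζ₂ : ℂ) :
    ∀ x : M, Module.End ℝ (GenTangent I x) :=
  cliffordComb I J (twistorRotation ζ₁ i) (twistorRotation ζ₂ i)

/-- The endomorphism `(v, ξ) ↦ (j v, -ξ ∘ j)` of `T_x M ⊕ T_x^* M` induced by an endomorphism `j`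
of `T_x M`. -/
def genOfTangentEnd {x : M} (j : TangentSpace I x →L[ℝ] TangentSpace I x) :
    Module.End ℝ (GenTangent I x) where
  toFun a := (j a.1, -(a.2.comp j))
  map_add' a b := by
    ext1
    · simp
    · ext v; simp; ring
  map_smul' c a := by
    ext1
    · simp
    · ext v; simp

end GeneralizedTangent

/-! ### Direct sums over a product manifold -/

section Product

variable {E : Type*} [NormedAddCommGroup E] [NormedSpace ℝ E]
  {H : Type*} [TopologicalSpace H] (I : ModelWithCorners ℝ E H)
  {M : Type*} [TopologicalSpace M] [ChartedSpace H M]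
  {E' : Type*} [NormedAddCommGroup E'] [NormedSpace ℝ E']
  {H' : Type*} [TopologicalSpace H'] (I' : ModelWithCorners ℝ E' H')
  {N : Type*} [TopologicalSpace N] [ChartedSpace H' N]

/-- `T_{(x, y)}(M × N) = T_x M × T_y N`. -/
def prodTangentEquiv (z : M × N) :
    TangentSpace (I.prod I') z ≃L[ℝ] TangentSpace I z.1 × TangentSpace I' z.2 :=
  ContinuousLinearEquiv.refl ℝ (E × E')

/-- The direct sum `P ⊕ Q` acting on
`T_z(M × N) ⊕ T_z^*(M × N) = (T_x M ⊕ T_x^* M) ⊕ (T_y N ⊕ T_y^* N)` at `z = (x, y)`. -/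
def genDirectSum (z : M × N) (P : Module.End ℝ (GenTangent I z.1))
    (Q : Module.End ℝ (GenTangent I' z.2)) : Module.End ℝ (GenTangent (I.prod I') z) :=
  let e := prodTangentEquiv I I' z
  let inM : TangentSpace I z.1 →L[ℝ] TangentSpace (I.prod I') z :=
    e.symm.toContinuousLinearMap.comp (ContinuousLinearMap.inl ℝ _ _)
  let inN : TangentSpace I' z.2 →L[ℝ] TangentSpace (I.prod I') z :=
    e.symm.toContinuousLinearMap.comp (ContinuousLinearMap.inr ℝ _ _)
  let prM : TangentSpace (I.prod I') z →L[ℝ] TangentSpace I z.1 :=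
    (ContinuousLinearMap.fst ℝ _ _).comp e.toContinuousLinearMap
  let prN : TangentSpace (I.prod I') z →L[ℝ] TangentSpace I' z.2 :=
    (ContinuousLinearMap.snd ℝ _ _).comp e.toContinuousLinearMap
  { toFun := fun a =>
      let p := P (prM a.1, a.2.comp inM)
      let q := Q (prN a.1, a.2.comp inN)
      (inM p.1 + inN q.1, p.2.comp prM + q.2.comp prN)
    map_add' := by
      intro a b
      have hP : P (prM (a + b).1, (a + b).2.comp inM)
          = P (prM a.1, a.2.comp inM) + P (prM b.1, b.2.comp inM) := by
        rw [← map_add]; simp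
      have hQ : Q (prN (a + b).1, (a + b).2.comp inN)
          = Q (prN a.1, a.2.comp inN) + Q (prN b.1, b.2.comp inN) := by
        rw [← map_add]; simp
      simp only [hP, hQ]
      ext1
      · simp only [Prod.fst_add, map_add]; abel
      · simp only [Prod.snd_add, ContinuousLinearMap.add_comp]; abel
    map_smul' := by
      intro c a
      have hP : P (prM (c • a).1, (c • a).2.comp inM) = c • P (prM a.1, a.2.comp inM) := by
        rw [← map_smul]; simp
      have hQ : Q (prN (c • a).1, (c • a).2.comp inN) = c • Q (prN a.1, a.2.comp inN) := by
        rw [← map_smul]; simp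
      simp only [hP, hQ]
      ext1
      · simp only [Prod.smul_fst, map_smul, smul_add, RingHom.id_apply]
      · simp only [Prod.smul_snd, ContinuousLinearMap.smul_comp, smul_add, RingHom.id_apply] }

end Product

/-! ### The sphere `S² ≅ ℂP¹` -/

/-- The unit sphere in `ℝ³`. -/
abbrev S2 : Type := Metric.sphere (0 : EuclideanSpace ℝ (Fin 3)) 1

/-- The cross product `v ↦ n × v` of `ℝ³`. -/
def crossLeft (n : EuclideanSpace ℝ (Fin 3)) :
    EuclideanSpace ℝ (Fin 3) →L[ℝ] EuclideanSpace ℝ (Fin 3) :=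
  LinearMap.toContinuousLinearMap
    ((WithLp.linearEquiv 2 ℝ (Fin 3 → ℝ)).symm.toLinearMap ∘ₗ
      crossProduct (WithLp.ofLp n) ∘ₗ (WithLp.linearEquiv 2 ℝ (Fin 3 → ℝ)).toLinearMap)

/-- The differential `T_n S² → ℝ³` of the inclusion. -/
def sphereIncl (n : S2) : TangentSpace (𝓡 2) n →L[ℝ] EuclideanSpace ℝ (Fin 3) :=
  mvfderiv (𝓡 2) (fun m : S2 => (m : EuclideanSpace ℝ (Fin 3))) n

theorem sphereIncl_injective (n : S2) : Function.Injective (sphereIncl n) :=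
  haveI := Fact.mk (@finrank_euclideanSpace_fin ℝ _ (2 + 1))
  injective_mvfderiv_subtypeVal_sphere n

theorem range_sphereIncl (n : S2) :
    (sphereIncl n).range = (Submodule.span ℝ {(n : EuclideanSpace ℝ (Fin 3))})ᗮ :=
  haveI := Fact.mk (@finrank_euclideanSpace_fin ℝ _ (2 + 1))
  range_mvfderiv_subtypeVal n

theorem exists_sphereComplexStructure (n : S2) :
    ∃ j : TangentSpace (𝓡 2) n →L[ℝ] TangentSpace (𝓡 2) n,
      ∀ v, sphereIncl n (j v) = crossLeft n (sphereIncl n v) := by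
  obtain ⟨g, hg⟩ := LinearMap.exists_leftInverse_of_injective
    (sphereIncl n : TangentSpace (𝓡 2) n →ₗ[ℝ] EuclideanSpace ℝ (Fin 3))
    (LinearMap.ker_eq_bot.2 (sphereIncl_injective n))
  refine ⟨g.toContinuousLinearMap ∘L crossLeft n ∘L sphereIncl n, fun v => ?_⟩
  have hmem : crossLeft n (sphereIncl n v) ∈ (sphereIncl n).range := by
    rw [range_sphereIncl, Submodule.mem_orthogonal_singleton_iff_inner_right]
    simp [crossLeft, PiLp.inner_apply, Fin.sum_univ_three, cross_apply]
    ring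
  obtain ⟨w, hw⟩ := hmem
  have h2 : g (sphereIncl n w) = w := LinearMap.congr_fun hg w
  have hw' : sphereIncl n w = crossLeft n (sphereIncl n v) := hw
  change sphereIncl n (g (crossLeft n (sphereIncl n v))) = crossLeft n (sphereIncl n v)
  rw [← hw', h2]

/-- The standard complex structure of `S² ≅ ℂP¹`: rotation by a right angle, `v ↦ n × v` on
`T_n S² = n^⊥`. -/
def sphereComplexStructure (n : S2) : TangentSpace (𝓡 2) n →L[ℝ] TangentSpace (𝓡 2) n :=
  Classical.choose (exists_sphereComplexStructure n)

theorem sphereComplexStructure_spec (n : S2) (v : TangentSpace (𝓡 2) n) :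
    sphereIncl n (sphereComplexStructure n v) = crossLeft n (sphereIncl n v) :=
  Classical.choose_spec (exists_sphereComplexStructure n) v

/-- The vector `(1 - |ζ|², -i(ζ - ζ̄), -(ζ + ζ̄)) / (1 + |ζ|²)`. -/
def stereoVec (ζ : ℂ) : EuclideanSpace ℝ (Fin 3) :=
  (1 + (ζ.re ^ 2 + ζ.im ^ 2))⁻¹ • !₂[1 - (ζ.re ^ 2 + ζ.im ^ 2), 2 * ζ.im, -(2 * ζ.re)]

theorem stereoVec_mem (ζ : ℂ) : stereoVec ζ ∈ Metric.sphere (0 : EuclideanSpace ℝ (Fin 3)) 1 := by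
  have h : 0 < 1 + (ζ.re ^ 2 + ζ.im ^ 2) := by positivity
  rw [mem_sphere_zero_iff_norm, EuclideanSpace.norm_eq, Real.sqrt_eq_one]
  simp [stereoVec, Fin.sum_univ_three, mul_pow, sq_abs]
  field_simp
  ring

/-- The stereographic coordinate `ζ` of the Riemann sphere `S²`. -/
def stereo (ζ : ℂ) : S2 := ⟨stereoVec ζ, stereoVec_mem ζ⟩

/-- Every point of the sphere except `(-1, 0, 0)` (the point `ζ = ∞`) has a coordinate `ζ`. -/
theorem exists_stereo_eq (n : S2) (hn : (n : EuclideanSpace ℝ (Fin 3)) 0 ≠ -1) :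
    ∃ ζ : ℂ, stereo ζ = n := by
  obtain ⟨n, hs⟩ := n
  have hs' : n 0 ^ 2 + n 1 ^ 2 + n 2 ^ 2 = 1 := by
    rw [mem_sphere_zero_iff_norm, EuclideanSpace.norm_eq, Real.sqrt_eq_one] at hs
    simpa [Fin.sum_univ_three] using hs
  have h0 : 1 + n 0 ≠ 0 := fun h => hn (by simp; linarith)
  refine ⟨⟨-n 2 / (1 + n 0), n 1 / (1 + n 0)⟩, Subtype.ext ?_⟩
  have key : (-n 2 / (1 + n 0)) ^ 2 + (n 1 / (1 + n 0)) ^ 2 = (1 - n 0) / (1 + n 0) := by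
    field_simp
    linear_combination hs'
  have key2 : (1 + (1 - n 0) / (1 + n 0))⁻¹ = (1 + n 0) / 2 := by
    rw [show 1 + (1 - n 0) / (1 + n 0) = 2 / (1 + n 0) by field_simp; ring, inv_div]
  ext i
  fin_cases i <;> simp [stereo, stereoVec, key, key2] <;> field_simp
  ring

theorem contDiff_stereoVec : ContDiff ℝ ∞ stereoVec := by
  have h : ∀ ζ : ℂ, 1 + (ζ.re ^ 2 + ζ.im ^ 2) ≠ 0 := fun ζ => by positivity
  have hre : ContDiff ℝ ∞ Complex.re := Complex.reCLM.contDiff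
  have him : ContDiff ℝ ∞ Complex.im := Complex.imCLM.contDiff
  rw [contDiff_euclidean]
  intro i
  fin_cases i <;> simp [stereoVec] <;> fun_prop (disch := exact h _)

theorem contMDiff_stereo : ContMDiff 𝓘(ℝ, ℂ) (𝓡 2) ∞ stereo :=
  haveI := Fact.mk (@finrank_euclideanSpace_fin ℝ _ (2 + 1))
  ContMDiff.codRestrict_sphere contDiff_stereoVec.contMDiff stereoVec_mem

theorem fderiv_stereoVec (ζ w : ℂ) :
    fderiv ℝ stereoVec ζ w = (2 * ((1 + (ζ.re ^ 2 + ζ.im ^ 2))⁻¹) ^ 2) •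
      !₂[-(2 * (ζ.re * w.re + ζ.im * w.im)),
        w.im * (1 + (ζ.re ^ 2 + ζ.im ^ 2)) - 2 * (ζ.re * w.re + ζ.im * w.im) * ζ.im,
        2 * (ζ.re * w.re + ζ.im * w.im) * ζ.re - w.re * (1 + (ζ.re ^ 2 + ζ.im ^ 2))] := by
  have hpos : 1 + (ζ.re ^ 2 + ζ.im ^ 2) ≠ 0 := by positivity
  have hre : HasFDerivAt (fun z : ℂ => z.re) Complex.reCLM ζ := Complex.reCLM.hasFDerivAt
  have him : HasFDerivAt (fun z : ℂ => z.im) Complex.imCLM ζ := Complex.imCLM.hasFDerivAt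
  have hr := (hre.pow 2).add (him.pow 2)
  have hinv := (hasFDerivAt_inv hpos).comp ζ (hr.const_add 1)
  have hd : HasFDerivAt stereoVec (fderiv ℝ stereoVec ζ) ζ :=
    ((contDiff_stereoVec.differentiable (by simp)) ζ).hasFDerivAt
  rw [← hasFDerivWithinAt_univ, hasFDerivWithinAt_euclidean] at hd
  simp only [hasFDerivWithinAt_univ] at hd
  ext i
  fin_cases i
  · have h := hinv.mul (hr.const_sub 1)
    have e := congrArg (fun L : ℂ →L[ℝ] ℝ => L w) ((hd 0).unique (by simpa [stereoVec] using! h))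
    simp at e ⊢
    rw [e]
    field_simp
    ring
  · have h := hinv.mul (him.const_mul 2)
    have e := congrArg (fun L : ℂ →L[ℝ] ℝ => L w) ((hd 1).unique (by simpa [stereoVec] using! h))
    simp at e ⊢
    rw [e]
    field_simp
    ring
  · have h := hinv.mul (hre.const_mul 2).neg
    have e := congrArg (fun L : ℂ →L[ℝ] ℝ => L w) ((hd 2).unique (by simpa [stereoVec] using! h))
    simp at e ⊢
    rw [e]
    field_simp
    ring

/-- Orientation check: `ζ` is a holomorphic coordinate for the standard complex structure. -/
theorem stereo_holomorphic (ζ w : ℂ) :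
    mfderiv 𝓘(ℝ, ℂ) (𝓡 2) stereo ζ (Complex.I * w : ℂ) =
      sphereComplexStructure (stereo ζ) (mfderiv 𝓘(ℝ, ℂ) (𝓡 2) stereo ζ w) := by
  have := Fact.mk (@finrank_euclideanSpace_fin ℝ _ (2 + 1))
  have hc : ∀ u : ℂ, sphereIncl (stereo ζ) (mfderiv 𝓘(ℝ, ℂ) (𝓡 2) stereo ζ u)
      = fderiv ℝ stereoVec ζ u := by
    intro u
    have h1 : MDifferentiableAt (𝓡 2) 𝓘(ℝ, EuclideanSpace ℝ (Fin 3))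
        (fun m : S2 => (m : EuclideanSpace ℝ (Fin 3))) (stereo ζ) :=
      (contMDiff_coe_sphere (m := 1) (stereo ζ)).mdifferentiableAt one_ne_zero
    have h2 : MDifferentiableAt 𝓘(ℝ, ℂ) (𝓡 2) stereo ζ :=
      (contMDiff_stereo ζ).mdifferentiableAt (by simp)
    have h3 := mfderiv_comp ζ h1 h2
    have h4 : mfderiv 𝓘(ℝ, ℂ) 𝓘(ℝ, EuclideanSpace ℝ (Fin 3)) stereoVec ζ
      = fderiv ℝ stereoVec ζ := mfderiv_eq_fderiv
    exact (congrArg (fun L : ℂ →L[ℝ] EuclideanSpace ℝ (Fin 3) => L u) (h3.symm.trans h4))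
  apply sphereIncl_injective
  rw [sphereComplexStructure_spec, hc w]
  refine (hc _).trans ?_
  have hpos : 1 + (ζ.re ^ 2 + ζ.im ^ 2) ≠ 0 := by positivity
  rw [fderiv_stereoVec, fderiv_stereoVec]
  ext i
  fin_cases i <;> simp [crossLeft, stereo, stereoVec, cross_apply] <;> field_simp <;>
    first | ring1 | exact Or.inl (by ring)

/-! ### The twistor space -/

section Twistor

variable {E : Type*} [NormedAddCommGroup E] [NormedSpace ℝ E]
  {H : Type*} [TopologicalSpace H] (I : ModelWithCorners ℝ E H)
  {M : Type*} [TopologicalSpace M] [ChartedSpace H M]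

/-- The generalized complex structure of `S² × S²` induced by the complex structure of
`ℂP¹ × ℂP¹`. -/
def sphereProdStructure (s : S2 × S2) : Module.End ℝ (GenTangent ((𝓡 2).prod (𝓡 2)) s) :=
  genDirectSum (𝓡 2) (𝓡 2) s
    (genOfTangentEnd (𝓡 2) (sphereComplexStructure s.1))
    (genOfTangentEnd (𝓡 2) (sphereComplexStructure s.2))

/-- The endomorphism `K_1 ⊕ 𝒥` over the twistor space `Z = M × (S² × S²)`. Its first summand at
`(p, n₁, n₂)` is `½ ∑_l n₁_l (I_l + I_{l+1} I_{l+2}) + ½ ∑_l n₂_l (-I_l + I_{l+1} I_{l+2})`, which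
is `K_1(ζ₁, ζ₂)` when `n₁, n₂` have stereographic coordinates `ζ₁, ζ₂`, and the continuous
extension of it when one of them is the point at infinity. -/
def twistorStructure (J : Fin 3 → ∀ x : M, Module.End ℝ (GenTangent I x)) (z : M × (S2 × S2)) :
    Module.End ℝ (GenTangent (I.prod ((𝓡 2).prod (𝓡 2))) z) :=
  genDirectSum I ((𝓡 2).prod (𝓡 2)) z
    (cliffordComb I J (fun l => (z.2.1 : EuclideanSpace ℝ (Fin 3)) l)
      (fun l => (z.2.2 : EuclideanSpace ℝ (Fin 3)) l) z.1)
    (sphereProdStructure z.2)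

theorem twistorRotation_zero_row (ζ : ℂ) :
    twistorRotation ζ 0 = fun l => (stereo ζ : EuclideanSpace ℝ (Fin 3)) l := by
  have h : ‖ζ‖ ^ 2 = ζ.re ^ 2 + ζ.im ^ 2 := by
    rw [Complex.sq_norm, Complex.normSq_apply]; ring
  ext l
  fin_cases l <;> simp [twistorRotation, stereo, stereoVec, h]

/-- At a point with stereographic coordinates `ζ₁, ζ₂`, the twistor structure is
`K_1(ζ₁, ζ₂) ⊕ 𝒥`. -/
theorem twistorStructure_stereo (J : Fin 3 → ∀ x : M, Module.End ℝ (GenTangent I x)) (p : M)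
    (ζ₁ ζ₂ : ℂ) :
    twistorStructure I J (p, stereo ζ₁, stereo ζ₂) =
      genDirectSum I ((𝓡 2).prod (𝓡 2)) (p, stereo ζ₁, stereo ζ₂)
        (cliffordRotation I J 0 ζ₁ ζ₂ p) (sphereProdStructure (stereo ζ₁, stereo ζ₂)) := by
  simp only [twistorStructure, cliffordRotation, twistorRotation_zero_row]

end Twistor

end

/-! Everything reduces to algebra on 1-jets in a chart. Over a vector space `V` with fibre `W = V ⊕
V*` and anchor ρ, the Dorfman bracket at a point is D_{ρA}B − D_{ρB}A + ρ*⟨DA, B⟩, a bilinear map on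
1-jets of sections (`jetBracket`, `dorfmanBracket_model`). Endomorphism fields act on 1-jets by the
Leibniz rule, and this action is additive and multiplicative (`jetPair_add`, `jetPair_mul`), so
Clifford relations near a point pass to jets.

Direction M. The Nijenhuis expression polarises to a symmetric bilinear concomitant [X, Y]. For
anticommuting integrable complex structures I, J, formal manipulation with an arbitrary bilinear
bracket gives [I, J] = 0 and [IJ, IJ] = 0. In the span of the I_l and the I_{l+1}I_{l+2}, two
distinct basis elements anticommute, except for the three commuting pairs I_l, I_{l+1}I_{l+2}; a
polarisation argument (`concomitant_mul_eq`) shows that these three have one common concomitant D.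
Hence [K, K] = ½(|n|² − |m|²) D for the combination K with coefficients n, m, and this vanishes on
S² × S² (`concomitant_cliffordComb`, `nijenhuis_quatComb`).

Sphere directions. With ω = I_1 I_2 I_3, which is central with ω² = 1, the Clifford algebra splits
into two quaternion algebras, cut out by (1 − ω)/2 and (1 + ω)/2, and K(n, m) is a pair of imaginary
quaternions. So K² = −1 for unit n, m, and K(n, m) K(n', m') = K(n × n', m × m') for tangent n', m'
(`quatComb_mul`). Since v ↦ n × v is the complex structure of the sphere, the family K is
holomorphic: D_{jv}K = K D_vK.

Assembly. Paired with a third section, the Nijenhuis tensor of an almost generalized complex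
structure is a cyclic sum (`pair_nijenhuis`). For K ⊕ Q over a product, this sum splits into the
sums of the two factors plus mixed terms in the derivatives of K along the second factor; holomorphy
cancels these (`nijenhuis_dsum`). The spherical factor is integrable because every almost complex
structure on a surface is (`nijenhuis_surface`). -/

noncomputable section

/-! ### Nijenhuis concomitants of a bilinear bracket -/

section Concomitant

variable {Γ F : Type*} [AddCommGroup Γ] [Module ℝ Γ] [AddCommGroup F] [Module ℝ F]

/-- The polarized Nijenhuis concomitant of two pairs of endomorphisms, acting on the arguments and
on the values of a bilinear map `b`. -/
def concomitant (b : Γ →ₗ[ℝ] Γ →ₗ[ℝ] F) (X Y : Module.End ℝ Γ × Module.End ℝ F) (A B : Γ) : F :=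
  b (X.1 A) (Y.1 B) + b (Y.1 A) (X.1 B) - X.2 (b (Y.1 A) B) - X.2 (b A (Y.1 B))
    - Y.2 (b (X.1 A) B) - Y.2 (b A (X.1 B)) + (X.2 (Y.2 (b A B)) + Y.2 (X.2 (b A B)))

variable (b : Γ →ₗ[ℝ] Γ →ₗ[ℝ] F)

theorem concomitant_comm (X Y : Module.End ℝ Γ × Module.End ℝ F) :
    concomitant b X Y = concomitant b Y X := by
  ext A B; simp only [concomitant]; abel

theorem concomitant_add_left (X X' Y : Module.End ℝ Γ × Module.End ℝ F) :
    concomitant b (X + X') Y = concomitant b X Y + concomitant b X' Y := by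
  ext A B
  simp only [concomitant, Prod.fst_add, Prod.snd_add, LinearMap.add_apply, map_add, Pi.add_apply]
  abel

theorem concomitant_smul_left (c : ℝ) (X Y : Module.End ℝ Γ × Module.End ℝ F) :
    concomitant b (c • X) Y = c • concomitant b X Y := by
  ext A B
  simp only [concomitant, Prod.smul_fst, Prod.smul_snd, LinearMap.smul_apply, map_smul,
    Pi.smul_apply, smul_sub, smul_add]

theorem concomitant_add_right (X Y Y' : Module.End ℝ Γ × Module.End ℝ F) :
    concomitant b X (Y + Y') = concomitant b X Y + concomitant b X Y' := by
  rw [concomitant_comm, concomitant_add_left, concomitant_comm b Y, concomitant_comm b Y']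

theorem concomitant_smul_right (c : ℝ) (X Y : Module.End ℝ Γ × Module.End ℝ F) :
    concomitant b X (c • Y) = c • concomitant b X Y := by
  rw [concomitant_comm, concomitant_smul_left, concomitant_comm]

variable {b}

/-- Action of the squares and products of two anticommuting complex structures on vectors. -/
theorem anticomm_apply {I J : Module.End ℝ Γ × Module.End ℝ F} (hI : I * I = -1) (hJ : J * J = -1)
    (hIJ : J * I = -(I * J)) :
    (∀ A, I.1 (I.1 A) = -A) ∧ (∀ A, I.2 (I.2 A) = -A) ∧
    (∀ A, J.1 (J.1 A) = -A) ∧ (∀ A, J.2 (J.2 A) = -A) ∧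
    (∀ A, J.1 (I.1 A) = -(I.1 (J.1 A))) ∧ (∀ A, J.2 (I.2 A) = -(I.2 (J.2 A))) := by
  refine ⟨fun A => ?_, fun A => ?_, fun A => ?_, fun A => ?_, fun A => ?_, fun A => ?_⟩
  · exact LinearMap.congr_fun (congrArg Prod.fst hI) A
  · exact LinearMap.congr_fun (congrArg Prod.snd hI) A
  · exact LinearMap.congr_fun (congrArg Prod.fst hJ) A
  · exact LinearMap.congr_fun (congrArg Prod.snd hJ) A
  · exact LinearMap.congr_fun (congrArg Prod.fst hIJ) A
  · exact LinearMap.congr_fun (congrArg Prod.snd hIJ) A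

/-- Two anticommuting integrable complex structures have vanishing mixed concomitant. -/
theorem concomitant_anticomm {I J : Module.End ℝ Γ × Module.End ℝ F}
    (hI : I * I = -1) (hJ : J * J = -1) (hIJ : J * I = -(I * J))
    (nI : concomitant b I I = 0) (nJ : concomitant b J J = 0) : concomitant b I J = 0 := by
  obtain ⟨i1, i2, j1, j2, c1, c2⟩ := anticomm_apply hI hJ hIJ
  ext A B
  have n1 := fun A B => congrFun (congrFun nI A) B
  have n2 := fun A B => congrFun (congrFun nJ A) B
  -- No symmetry, Jacobi identity or tensoriality of `b` enters: once words are normalised to have I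
  -- before J, [I, J](A, B) is a formal combination of [I, I] and [J, J] at arguments moved by I, J
  -- and IJ.
  have e1 := n1 A (I.1 (J.1 B))
  have e2 := n1 (J.1 A) (I.1 B)
  have e3 := congrArg J.2 (n1 A (I.1 B))
  have e4 := congrArg J.2 (n1 (J.1 A) (I.1 (J.1 B)))
  have e5 := n2 A (I.1 (J.1 B))
  have e6 := n2 (I.1 A) (J.1 B)
  have e7 := congrArg I.2 (n2 A (J.1 B))
  have e8 := congrArg I.2 (n2 (I.1 A) (I.1 (J.1 B)))
  simp only [concomitant, Pi.zero_apply, i1, i2, j1, j2, c1, c2, map_add, map_sub, map_neg,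
    map_zero, LinearMap.neg_apply, neg_neg] at e1 e2 e3 e4 e5 e6 e7 e8 ⊢
  linear_combination (norm := module) (1 / 4 : ℝ) • (-e1 - e2 + e3 - e4 + e5 - e6 + e7 + e8)

/-- The product of two anticommuting integrable complex structures is integrable. -/
theorem concomitant_mul_self {I J : Module.End ℝ Γ × Module.End ℝ F}
    (hI : I * I = -1) (hJ : J * J = -1) (hIJ : J * I = -(I * J))
    (nI : concomitant b I I = 0) (nJ : concomitant b J J = 0) :
    concomitant b (I * J) (I * J) = 0 := by
  obtain ⟨i1, i2, j1, j2, c1, c2⟩ := anticomm_apply hI hJ hIJ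
  ext A B
  have n1 := fun A B => congrFun (congrFun nI A) B
  have n2 := fun A B => congrFun (congrFun nJ A) B
  -- The combination is N_I(A, B) + N_I(JA, JB) − J N_I(A, JB) − J N_I(JA, B), plus the same
  -- expression with I and J exchanged; the terms not belonging to IJ cancel in pairs.
  have e1 := n1 A B
  have e2 := n1 (J.1 A) (J.1 B)
  have e3 := congrArg J.2 (n1 A (J.1 B))
  have e4 := congrArg J.2 (n1 (J.1 A) B)
  have e5 := n2 A B
  have e6 := n2 (I.1 A) (I.1 B)
  have e7 := congrArg I.2 (n2 A (I.1 B))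
  have e8 := congrArg I.2 (n2 (I.1 A) B)
  simp only [concomitant, Pi.zero_apply, i2, j2, c1, c2, map_add, map_sub, map_neg,
    map_zero, LinearMap.neg_apply, neg_neg, Prod.fst_mul, Prod.snd_mul, Module.End.mul_apply]
    at e1 e2 e3 e4 e5 e6 e7 e8 ⊢
  linear_combination (norm := module) (1 / 2 : ℝ) • (e1 + e2 - e3 - e4 + e5 + e6 - e7 - e8)

/-- In a rank 3 Clifford family of integrable complex structures, the concomitants of `I_l` with
the complementary product do not depend on `l`. -/
theorem concomitant_mul_eq {I J L : Module.End ℝ Γ × Module.End ℝ F}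
    (hI : I * I = -1) (hJ : J * J = -1) (hL : L * L = -1) (hJI : J * I = -(I * J))
    (hLI : L * I = -(I * L)) (hLJ : L * J = -(J * L)) (nI : concomitant b I I = 0)
    (nJ : concomitant b J J = 0) (nL : concomitant b L L = 0) :
    concomitant b I (J * L) = concomitant b J (L * I) := by
  -- Since [I, J] = 0, S = (I + J)/√2 is again an integrable complex structure, and it anticommutes
  -- with L. So SL is integrable, anticommutes with S, and [S, SL] = 0. As [I, IL] = [J, JL] = 0,
  -- expanding leaves [I, JL] + [J, IL] = 0.
  set r : ℝ := (Real.sqrt 2)⁻¹ with hr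
  have hr2 : r * r = 1 / 2 := by
    rw [hr, ← mul_inv, Real.mul_self_sqrt (by norm_num)]; norm_num
  have hr0 : r ≠ 0 := by rintro h; rw [h] at hr2; norm_num at hr2
  have hIJ := concomitant_anticomm hI hJ hJI nI nJ
  have hS : (r • (I + J)) * (r • (I + J)) = -1 := by
    rw [smul_mul_smul_comm, hr2, add_mul, mul_add, mul_add, hI, hJ, hJI]; module
  have hLS : L * (r • (I + J)) = -((r • (I + J)) * L) := by
    rw [mul_smul_comm, mul_add, hLI, hLJ, smul_mul_assoc, add_mul]; module
  have nS : concomitant b (r • (I + J)) (r • (I + J)) = 0 := by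
    simp only [concomitant_smul_left, concomitant_smul_right, concomitant_add_left,
      concomitant_add_right, nI, nJ, hIJ, concomitant_comm b J I, add_zero, smul_zero]
  have hSL := concomitant_mul_self hS hL hLS nS nL
  have hSLsq : ((r • (I + J)) * L) * ((r • (I + J)) * L) = -1 := by
    rw [mul_assoc, ← mul_assoc L, hLS, neg_mul, mul_neg, mul_assoc _ L L, hL, mul_neg, mul_one,
      mul_neg, hS, neg_neg]
  have h1 := concomitant_anticomm hS hSLsq (by
    rw [mul_assoc, hLS, mul_neg]) nS hSL
  have aux : ∀ {X Y : Module.End ℝ Γ × Module.End ℝ F}, X * X = -1 → Y * Y = -1 →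
      Y * X = -(X * Y) → concomitant b X X = 0 → concomitant b Y Y = 0 →
      concomitant b X (X * Y) = 0 := by
    intro X Y hX hY hYX nX nY
    refine concomitant_anticomm hX ?_ (by rw [mul_assoc, hYX, mul_neg]) nX
      (concomitant_mul_self hX hY hYX nX nY)
    rw [mul_assoc, ← mul_assoc Y, hYX, neg_mul, mul_neg, mul_assoc X Y Y, hY, mul_neg, mul_one,
      mul_neg, hX, neg_neg]
  have h2 := aux hI hL hLI nI nL
  have h3 := aux hJ hL hLJ nJ nL
  simp only [smul_mul_assoc, add_mul, concomitant_smul_left, concomitant_smul_right,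
    concomitant_add_left, concomitant_add_right, h2, h3, zero_add, add_zero] at h1
  have h4 : concomitant b I (J * L) + concomitant b J (I * L) = 0 := by
    simpa [hr0, ← smul_add, add_comm] using h1
  have h5 : L * I = (-1 : ℝ) • (I * L) := by rw [hLI]; module
  rw [h5, concomitant_smul_right, eq_neg_of_add_eq_zero_left h4]
  module

/-- A rank 3 Clifford family of integrable complex structures generates an
`S² × S²` of integrable complex structures. -/
theorem concomitant_cliffordComb {I J L : Module.End ℝ Γ × Module.End ℝ F}
    (hI : I * I = -1) (hJ : J * J = -1) (hL : L * L = -1) (hJI : J * I = -(I * J))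
    (hLI : L * I = -(I * L)) (hLJ : L * J = -(J * L)) (nI : concomitant b I I = 0)
    (nJ : concomitant b J J = 0) (nL : concomitant b L L = 0)
    {n m : Fin 3 → ℝ} (hn : n 0 ^ 2 + n 1 ^ 2 + n 2 ^ 2 = 1) (hm : m 0 ^ 2 + m 1 ^ 2 + m 2 ^ 2 = 1)
    {K : Module.End ℝ Γ × Module.End ℝ F}
    (hK : K = (1 / 2 : ℝ) • (n 0 • (I + J * L) + n 1 • (J + L * I) + n 2 • (L + I * J))
      + (1 / 2 : ℝ) • (m 0 • (-I + J * L) + m 1 • (-J + L * I) + m 2 • (-L + I * J))) :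
    concomitant b K K = 0 := by
  have hIL : I * L = -(L * I) := by rw [hLI, neg_neg]
  have sqm : ∀ {X Y : Module.End ℝ Γ × Module.End ℝ F}, X * X = -1 → Y * Y = -1 →
      Y * X = -(X * Y) → (X * Y) * (X * Y) = -1 := by
    intro X Y hX hY hYX
    rw [mul_assoc, ← mul_assoc Y, hYX, neg_mul, mul_neg, mul_assoc X Y Y, hY, mul_neg, mul_one,
      mul_neg, hX, neg_neg]
  have left : ∀ {X Y : Module.End ℝ Γ × Module.End ℝ F}, X * X = -1 → Y * Y = -1 →
      Y * X = -(X * Y) → concomitant b X X = 0 → concomitant b Y Y = 0 →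
      concomitant b X (X * Y) = 0 := fun hX hY hYX nX nY =>
    concomitant_anticomm hX (sqm hX hY hYX) (by rw [mul_assoc, hYX, mul_neg]) nX
      (concomitant_mul_self hX hY hYX nX nY)
  have right : ∀ {X Y : Module.End ℝ Γ × Module.End ℝ F}, X * X = -1 → Y * Y = -1 →
      Y * X = -(X * Y) → concomitant b X X = 0 → concomitant b Y Y = 0 →
      concomitant b Y (X * Y) = 0 := fun {X Y} hX hY hYX nX nY =>
    concomitant_anticomm hY (sqm hX hY hYX)
      (by rw [mul_assoc, hY, ← mul_assoc, hYX, neg_mul, mul_assoc, hY, neg_neg]) nY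
      (concomitant_mul_self hX hY hYX nX nY)
  have prod : ∀ {X Y W : Module.End ℝ Γ × Module.End ℝ F}, X * X = -1 → Y * Y = -1 → W * W = -1 →
      Y * X = -(X * Y) → W * X = -(X * W) → W * Y = -(Y * W) → concomitant b X X = 0 →
      concomitant b Y Y = 0 → concomitant b W W = 0 →
      concomitant b (X * Y) (Y * W) = 0 := by
    intro X Y W hX hY hW hYX hWX hWY nX nY nW
    refine concomitant_anticomm (sqm hX hY hYX) (sqm hY hW hWY) ?_
      (concomitant_mul_self hX hY hYX nX nY) (concomitant_mul_self hY hW hWY nY nW)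
    have e1 : (X * Y) * (Y * W) = -(X * W) := by
      rw [mul_assoc, ← mul_assoc Y, hY, neg_mul, one_mul, mul_neg]
    have e2 : (Y * W) * (X * Y) = X * W := by
      rw [mul_assoc, ← mul_assoc W, hWX, neg_mul, mul_neg, mul_assoc X, hWY, mul_neg, mul_neg,
        neg_neg, ← mul_assoc X, ← mul_assoc Y, ← mul_assoc Y, hYX, neg_mul, neg_mul,
        mul_assoc X Y Y, hY, mul_neg, mul_one, neg_mul, neg_neg]
    rw [e1, e2, neg_neg]
  have d1 := concomitant_mul_eq hI hJ hL hJI hLI hLJ nI nJ nL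
  have hJL : J * L = -(L * J) := by rw [hLJ, neg_neg]
  have hIJ : I * J = -(J * I) := by rw [hJI, neg_neg]
  have d2 := concomitant_mul_eq hJ hL hI hLJ hIJ hIL nJ nL nI
  have q1 := concomitant_mul_self hJ hL hLJ nJ nL
  have q2 := concomitant_mul_self hL hI hIL nL nI
  have q3 := concomitant_mul_self hI hJ hJI nI nJ
  have a1 := concomitant_anticomm hI hJ hJI nI nJ
  have a2 := concomitant_anticomm hJ hL hLJ nJ nL
  have a3 := concomitant_anticomm hI hL hLI nI nL
  have b1 := left hI hJ hJI nI nJ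
  have b2 := right hI hJ hJI nI nJ
  have b3 := left hJ hL hLJ nJ nL
  have b4 := right hJ hL hLJ nJ nL
  have b5 := left hL hI hIL nL nI
  have b6 := right hL hI hIL nL nI
  have c1 := prod hI hJ hL hJI hLI hLJ nI nJ nL
  have c2 := prod hJ hL hI hLJ hIJ hIL nJ nL nI
  have c3 := prod hL hI hJ hIL hJL hJI nL nI nJ
  -- In this basis only the concomitants of the commuting pairs (I, JL), (J, LI), (L, IJ) survive.
  -- By `d1` and `d2` they coincide, and their total coefficient is 2 ∑ (n_l − m_l)(n_l + m_l)/4 =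
  -- (|n|² − |m|²)/2.
  have hK' : K = ((n 0 - m 0) / 2) • I + ((n 1 - m 1) / 2) • J + ((n 2 - m 2) / 2) • L
      + ((n 0 + m 0) / 2) • (J * L) + ((n 1 + m 1) / 2) • (L * I)
      + ((n 2 + m 2) / 2) • (I * J) := by
    rw [hK]; module
  rw [hK']
  simp only [concomitant_smul_left, concomitant_smul_right, concomitant_add_left,
    concomitant_add_right, nI, nJ, nL, a1, a2, a3, q1, q2, q3, b1, b2, b3, b4, b5, b6, c1, c2, c3,
    concomitant_comm b J I, concomitant_comm b L I, concomitant_comm b L J,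
    concomitant_comm b (J * L) I, concomitant_comm b (J * L) J, concomitant_comm b (J * L) L,
    concomitant_comm b (L * I) I, concomitant_comm b (L * I) J, concomitant_comm b (L * I) L,
    concomitant_comm b (I * J) I, concomitant_comm b (I * J) J, concomitant_comm b (I * J) L,
    concomitant_comm b (J * L) (I * J), concomitant_comm b (L * I) (J * L),
    concomitant_comm b (I * J) (L * I), smul_zero, add_zero, zero_add, d1, ← d2]
  match_scalars
  linear_combination (hn - hm) / 2

end Concomitant

/-! ### The Dorfman bracket on a vector space -/

/-- The linear data on the fibre `W = V ⊕ V^*` of the generalized tangent bundle of a vector space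
`V`: the anchor `W → V`, the inclusion `V^* → W` and (twice) the pairing of `W`. -/
structure CourantFibre (V W : Type*) [NormedAddCommGroup V] [NormedSpace ℝ V]
    [NormedAddCommGroup W] [NormedSpace ℝ W] where
  anchor : W →L[ℝ] V
  coanchor : (V →L[ℝ] ℝ) →L[ℝ] W
  pair : W →L[ℝ] W →L[ℝ] ℝ
  pair_comm : ∀ a b, pair a b = pair b a
  pair_coanchor : ∀ a α, pair a (coanchor α) = α (anchor a)
  eq_zero_of_pair : ∀ x, (∀ c, pair c x = 0) → x = 0

section Flat

variable {V W : Type*} [NormedAddCommGroup V] [NormedSpace ℝ V]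
  [NormedAddCommGroup W] [NormedSpace ℝ W] (c : CourantFibre V W)

namespace CourantFibre

/-- The Dorfman bracket of two sections with given 1-jets. -/
def jetBracket : (W × (V →L[ℝ] W)) →ₗ[ℝ] (W × (V →L[ℝ] W)) →ₗ[ℝ] W :=
  LinearMap.mk₂ ℝ (fun A B => B.2 (c.anchor A.1) - A.2 (c.anchor B.1)
      + c.coanchor ((c.pair B.1).comp A.2))
    (fun A A' B => by simp; abel)
    (fun r A B => by simp [smul_add, smul_sub])
    (fun A B B' => by simp [ContinuousLinearMap.add_comp]; abel)
    (fun r A B => by simp [smul_add, smul_sub])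

theorem jetBracket_apply (A B : W × (V →L[ℝ] W)) :
    c.jetBracket A B = B.2 (c.anchor A.1) - A.2 (c.anchor B.1)
      + c.coanchor ((c.pair B.1).comp A.2) := rfl

/-- The Nijenhuis tensor of an almost generalized complex structure with given 1-jet. -/
def nijenhuis (J : W →L[ℝ] W) (J' : V →L[ℝ] W →L[ℝ] W) (a b : W) : W :=
  J' (c.anchor (J a)) b - J' (c.anchor (J b)) a + c.coanchor ((c.pair (J b)).comp (J'.flip a))
    - J (-(J' (c.anchor b) a) + c.coanchor ((c.pair b).comp (J'.flip a))) - J (J' (c.anchor a) b)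

end CourantFibre

/-- The action on 1-jets of sections of a bundle endomorphism with given 1-jet. -/
def jetEnd (P : W →L[ℝ] W) (P' : V →L[ℝ] W →L[ℝ] W) : Module.End ℝ (W × (V →L[ℝ] W)) where
  toFun A := (P A.1, P'.flip A.1 + P.comp A.2)
  map_add' A B := by
    ext1
    · simp
    · ext1 v
      simp only [Prod.fst_add, Prod.snd_add, map_add, add_apply, ContinuousLinearMap.comp_apply]
      abel
  map_smul' r A := by
    ext1
    · simp
    · ext1 v
      simp [smul_add]

namespace CourantFibre

variable {c}

theorem pair_skew {J : W →L[ℝ] W} (sq : ∀ x, J (J x) = -x)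
    (orth : ∀ x y, c.pair (J y) (J x) = c.pair y x) (x y : W) :
    c.pair (J y) x = -c.pair y (J x) := by
  rw [← orth (J x) y, sq, map_neg, neg_neg]

/-- Tensoriality: the right side sees only the values of `A` and `B`. Derivatives of the sections in
the first two terms of the bracket cancel by J² = −1; those in the coanchor term cancel because J is
orthogonal, hence skew. -/
theorem nijenhuis_jet {J : W →L[ℝ] W} {J' : V →L[ℝ] W →L[ℝ] W}
    (sq : ∀ x, J (J x) = -x) (orth : ∀ x y, c.pair (J y) (J x) = c.pair y x)
    (A B : W × (V →L[ℝ] W)) :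
    c.jetBracket (jetEnd J J' A) (jetEnd J J' B) - J (c.jetBracket (jetEnd J J' A) B)
      - J (c.jetBracket A (jetEnd J J' B)) - c.jetBracket A B = c.nijenhuis J J' A.1 B.1 := by
  obtain ⟨a, a'⟩ := A
  obtain ⟨b, b'⟩ := B
  have e1 : (c.pair (J b)).comp (J'.flip a + J.comp a')
      = (c.pair (J b)).comp (J'.flip a) + (c.pair b).comp a' := by
    ext v
    have := orth (a' v) b
    simp only [ContinuousLinearMap.comp_apply, add_apply, map_add, this]
  have e2 : (c.pair b).comp (J'.flip a + J.comp a')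
      = (c.pair b).comp (J'.flip a) - (c.pair (J b)).comp a' := by
    ext v
    have := pair_skew sq orth (a' v) b
    simp only [ContinuousLinearMap.comp_apply, add_apply, sub_apply, map_add, this]
    ring
  simp only [jetBracket_apply, jetEnd, LinearMap.coe_mk, AddHom.coe_mk, nijenhuis, e1, e2]
  simp only [add_apply, ContinuousLinearMap.comp_apply, map_add, map_sub,
    map_neg, sq, ContinuousLinearMap.flip_apply]
  abel

variable (c) in
/-- The cyclic summand of the Nijenhuis 3-form. -/
def nijTerm (J : W →L[ℝ] W) (J' : V →L[ℝ] W →L[ℝ] W) (x y z : W) : ℝ :=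
  c.pair z (J' (c.anchor (J x)) y) + c.pair (J z) (J' (c.anchor x) y)

/-- `anti` and `skew` are the derivatives of J² = −1 and of the skewness of J. They bring the six
derivative terms into a cyclically symmetric form, in which a direct sum can be separated into its
two factors. -/
theorem pair_nijenhuis {J : W →L[ℝ] W} {J' : V →L[ℝ] W →L[ℝ] W}
    (sq : ∀ x, J (J x) = -x) (orth : ∀ x y, c.pair (J y) (J x) = c.pair y x)
    (anti : ∀ v x, J (J' v x) = -J' v (J x))
    (skew : ∀ v x y, c.pair y (J' v x) = -c.pair x (J' v y)) (x y z : W) :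
    c.pair z (c.nijenhuis J J' x y)
      = c.nijTerm J J' x y z + c.nijTerm J J' y z x + c.nijTerm J J' z x y := by
  have sk := pair_skew sq orth
  have e1 : ∀ w, c.pair z (J w) = -c.pair (J z) w := fun w => by rw [sk, neg_neg]
  have e2 : c.pair (J z) (J' (c.anchor y) x) = -c.pair (J x) (J' (c.anchor y) z) := by
    rw [skew, sk, anti, map_neg]; ring
  simp only [nijenhuis, nijTerm, map_add, map_sub, map_neg, pair_coanchor, e1,
    ContinuousLinearMap.comp_apply, ContinuousLinearMap.flip_apply, skew (c.anchor (J y)) x z, e2]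
  ring

end CourantFibre

/-! ### 1-jets of families of endomorphisms -/

/-- The actions of a family of endomorphisms on 1-jets and on values at `u`. -/
def jetPair (P : V → W →L[ℝ] W) (u : V) :
    Module.End ℝ (W × (V →L[ℝ] W)) × Module.End ℝ W :=
  (jetEnd (P u) (fderiv ℝ P u), (P u : W →ₗ[ℝ] W))

variable {P Q : V → W →L[ℝ] W} {u : V}

theorem jetPair_congr (h : P =ᶠ[nhds u] Q) : jetPair P u = jetPair Q u := by
  rw [jetPair, jetPair, h.fderiv_eq, h.eq_of_nhds]

theorem jetPair_add (hP : DifferentiableAt ℝ P u) (hQ : DifferentiableAt ℝ Q u) :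
    jetPair (fun w => P w + Q w) u = jetPair P u + jetPair Q u := by
  refine Prod.ext (LinearMap.ext fun A => Prod.ext rfl ?_) rfl
  ext1 v
  simp only [jetPair, jetEnd, fderiv_fun_add hP hQ, LinearMap.coe_mk, AddHom.coe_mk,
    add_apply, ContinuousLinearMap.flip_apply, ContinuousLinearMap.comp_apply,
    Prod.fst_add, LinearMap.add_apply, Prod.snd_add]
  abel

theorem jetPair_smul (r : ℝ) (hP : DifferentiableAt ℝ P u) :
    jetPair (fun w => r • P w) u = r • jetPair P u := by
  refine Prod.ext (LinearMap.ext fun A => Prod.ext rfl ?_) rfl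
  ext1 v
  simp [jetPair, jetEnd, fderiv_fun_const_smul hP, smul_add]

theorem fderiv_mul_apply (hP : DifferentiableAt ℝ P u) (hQ : DifferentiableAt ℝ Q u) (v : V)
    (a : W) : fderiv ℝ (fun w => P w * Q w) u v a
      = P u (fderiv ℝ Q u v a) + fderiv ℝ P u v (Q u a) := by
  have := (hP.hasFDerivAt.clm_comp hQ.hasFDerivAt).fderiv
  have h2 : (fun w => P w * Q w) = fun w => (P w).comp (Q w) := rfl
  rw [h2, this]
  simp

/-- The Leibniz rule for P(QA) is associativity of the action. This is what lets algebraic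
identities between endomorphism fields be used on jets. -/
theorem jetPair_mul (hP : DifferentiableAt ℝ P u) (hQ : DifferentiableAt ℝ Q u) :
    jetPair (fun w => P w * Q w) u = jetPair P u * jetPair Q u := by
  refine Prod.ext (LinearMap.ext fun A => Prod.ext rfl ?_) rfl
  ext1 v
  simp only [jetPair, jetEnd, LinearMap.coe_mk, AddHom.coe_mk, Prod.fst_mul, Module.End.mul_apply,
    add_apply, ContinuousLinearMap.flip_apply, ContinuousLinearMap.comp_apply,
    fderiv_mul_apply hP hQ, map_add]
  simp only [ContinuousLinearMap.mul_def, ContinuousLinearMap.comp_apply]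
  abel

theorem jetPair_const_smul_one (r : ℝ) : jetPair (fun _ : V => r • (1 : W →L[ℝ] W)) u
    = r • 1 := by
  refine Prod.ext (LinearMap.ext fun A => Prod.ext rfl ?_) rfl
  ext1 v
  simp [jetPair, jetEnd]

variable {c}

theorem concomitant_jetPair_self (sq : ∀ x, P u (P u x) = -x)
    (orth : ∀ x y, c.pair (P u y) (P u x) = c.pair y x) (A B : W × (V →L[ℝ] W)) :
    concomitant c.jetBracket (jetPair P u) (jetPair P u) A B
      = (2 : ℝ) • c.nijenhuis (P u) (fderiv ℝ P u) A.1 B.1 := by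
  rw [← CourantFibre.nijenhuis_jet sq orth]
  simp only [concomitant, jetPair, ContinuousLinearMap.coe_coe, sq]
  module

/-- The bridge between the pointwise Nijenhuis tensor and the formal concomitant calculus on jets.
-/
theorem concomitant_jetPair_eq_zero_iff (sq : ∀ x, P u (P u x) = -x)
    (orth : ∀ x y, c.pair (P u y) (P u x) = c.pair y x) :
    concomitant c.jetBracket (jetPair P u) (jetPair P u) = 0
      ↔ ∀ a b, c.nijenhuis (P u) (fderiv ℝ P u) a b = 0 := by
  constructor
  · intro h a b
    -- By tensoriality the derivative part of the test jets is irrelevant, so zero is chosen.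
    have := concomitant_jetPair_self sq orth (a, 0) (b, 0)
    rw [h] at this
    simpa using this.symm
  · intro h
    ext1 A; ext1 B
    rw [concomitant_jetPair_self sq orth, h, smul_zero]; rfl

end Flat

/-! ### The `S² × S²` of square roots of `-1` in a rank 3 Clifford algebra -/

section CliffordAlgebra

variable {A : Type*} [Ring A] [Algebra ℝ A]

/-- `½ ∑_l a_l (P_l + P_{l+1} P_{l+2}) + ½ ∑_l b_l (-P_l + P_{l+1} P_{l+2})` in an algebra. -/
def quatComb (P : Fin 3 → A) (a b : Fin 3 → ℝ) : A :=
  (1 / 2 : ℝ) • ∑ l : Fin 3, a l • (P l + P (l + 1) * P (l + 2))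
    + (1 / 2 : ℝ) • ∑ l : Fin 3, b l • (-P l + P (l + 1) * P (l + 2))

/-- The Clifford relations `P_i P_j + P_j P_i = -2 δ_{ij}`. -/
def IsCliffordTriple (P : Fin 3 → A) : Prop :=
  ∀ i j, P i * P j + P j * P i = (if i = j then (-2 : ℝ) else 0) • 1

theorem quatComb_eq (P : Fin 3 → A) (a b : Fin 3 → ℝ) :
    quatComb P a b = (1 / 2 : ℝ) • (a 0 • (P 0 + P 1 * P 2) + a 1 • (P 1 + P 2 * P 0)
        + a 2 • (P 2 + P 0 * P 1))
      + (1 / 2 : ℝ) • (b 0 • (-P 0 + P 1 * P 2) + b 1 • (-P 1 + P 2 * P 0)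
        + b 2 • (-P 2 + P 0 * P 1)) := by
  simp only [quatComb, Fin.sum_univ_three]; rfl

theorem IsCliffordTriple.sq {P : Fin 3 → A} (h : IsCliffordTriple P) (i : Fin 3) :
    P i * P i = -1 := by
  have e := h i i
  rw [if_pos rfl] at e
  have : (2 : ℝ) • (P i * P i) = (2 : ℝ) • (-1 : A) := by
    rw [two_smul, e]; module
  exact smul_right_injective A (two_ne_zero' ℝ) this

theorem IsCliffordTriple.anticomm {P : Fin 3 → A} (h : IsCliffordTriple P) {i j : Fin 3}
    (hij : i ≠ j) : P j * P i = -(P i * P j) := by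
  have e := h i j
  rw [if_neg hij, zero_smul] at e
  exact eq_neg_of_add_eq_zero_right e

/-- The quaternionic multiplication rule. -/
theorem IsCliffordTriple.quatComb_mul {P : Fin 3 → A} (h : IsCliffordTriple P)
    (a b a' b' : Fin 3 → ℝ) :
    quatComb P a b * quatComb P a' b' = quatComb P (crossProduct a a') (crossProduct b b')
      - ((a 0 * a' 0 + a 1 * a' 1 + a 2 * a' 2) / 2) • (1 - P 0 * (P 1 * P 2))
      - ((b 0 * b' 0 + b 1 * b' 1 + b 2 * b' 2) / 2) • (1 + P 0 * (P 1 * P 2)) := by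
  rw [quatComb_eq, quatComb_eq, quatComb_eq]
  have s0 := h.sq 0
  have s1 := h.sq 1
  have s2 := h.sq 2
  have c10 := h.anticomm (i := 0) (j := 1) (by decide)
  have c20 := h.anticomm (i := 0) (j := 2) (by decide)
  have c21 := h.anticomm (i := 1) (j := 2) (by decide)
  -- What remains is a computation in the free algebra: words are sorted into the order X, Y, Z. The
  -- rules `t` and `d` repeat the relations with a tail `x`, as right-associated words require.
  generalize P 0 = X at *
  generalize P 1 = Y at *
  generalize P 2 = Z at *
  have t0 : ∀ x, X * (X * x) = -x := fun x => by rw [← mul_assoc, s0, neg_one_mul]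
  have t1 : ∀ x, Y * (Y * x) = -x := fun x => by rw [← mul_assoc, s1, neg_one_mul]
  have d10 : ∀ x, Y * (X * x) = -(X * (Y * x)) := fun x => by
    rw [← mul_assoc, c10, neg_mul, mul_assoc]
  have d20 : ∀ x, Z * (X * x) = -(X * (Z * x)) := fun x => by
    rw [← mul_assoc, c20, neg_mul, mul_assoc]
  have d21 : ∀ x, Z * (Y * x) = -(Y * (Z * x)) := fun x => by
    rw [← mul_assoc, c21, neg_mul, mul_assoc]
  simp only [cross_apply, Matrix.cons_val_zero, Matrix.cons_val_one, Matrix.cons_val,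
    mul_add, add_mul, smul_add, mul_neg, neg_mul, mul_assoc,
    s0, s1, s2, t0, t1, c10, c20, c21, d10, d20, d21, neg_neg, mul_one, smul_smul, smul_neg,
    smul_mul_assoc, mul_smul_comm]
  module

theorem IsCliffordTriple.quatComb_sq {P : Fin 3 → A} (h : IsCliffordTriple P) {a b : Fin 3 → ℝ}
    (ha : a 0 ^ 2 + a 1 ^ 2 + a 2 ^ 2 = 1) (hb : b 0 ^ 2 + b 1 ^ 2 + b 2 ^ 2 = 1) :
    quatComb P a b * quatComb P a b = -1 := by
  rw [h.quatComb_mul, ← pow_two (a 0), ← pow_two (a 1), ← pow_two (a 2), ← pow_two (b 0),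
    ← pow_two (b 1), ← pow_two (b 2), ha, hb, cross_self, cross_self, quatComb_eq]
  simp only [Pi.zero_apply]
  module

/-- Orthogonal imaginary quaternions multiply by the cross product. Applied to a point and a tangent
vector in each sphere, this is the holomorphy of the family K. -/
theorem IsCliffordTriple.quatComb_mul_of_orth {P : Fin 3 → A} (h : IsCliffordTriple P)
    {a b a' b' : Fin 3 → ℝ} (ha : a 0 * a' 0 + a 1 * a' 1 + a 2 * a' 2 = 0)
    (hb : b 0 * b' 0 + b 1 * b' 1 + b 2 * b' 2 = 0) :
    quatComb P a b * quatComb P a' b' = quatComb P (crossProduct a a') (crossProduct b b') := by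
  rw [h.quatComb_mul, ha, hb]
  module

/-- A combination of elements which are skew for an anti-involution is skew; here the
anti-involution is given by a bilinear form. -/
theorem quatComb_skew {P : Fin 3 → A} (h : IsCliffordTriple P) {W : Type*} [AddCommGroup W]
    [Module ℝ W] (ρ : A →ₐ[ℝ] Module.End ℝ W) (B : W →ₗ[ℝ] W →ₗ[ℝ] ℝ)
    (skew : ∀ i x y, B (ρ (P i) x) y = -B x (ρ (P i) y)) (a b : Fin 3 → ℝ) (x y : W) :
    B (ρ (quatComb P a b) x) y = -B x (ρ (quatComb P a b) y) := by
  -- A product of two skew operators has the reversed product as adjoint; anticommutation turns that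
  -- into minus the product, so the products are skew too.
  have hm : ∀ {i j}, i ≠ j → ∀ x, ρ (P j) (ρ (P i) x) = -ρ (P i) (ρ (P j) x) := fun hij x => by
    simpa only [map_mul, map_neg, Module.End.mul_apply, LinearMap.neg_apply]
      using congrArg (fun f => ρ f x) (h.anticomm hij)
  rw [quatComb_eq]
  simp only [map_add, map_smul, map_neg, LinearMap.add_apply, LinearMap.smul_apply,
    LinearMap.neg_apply, map_mul, Module.End.mul_apply, skew, hm (show (0 : Fin 3) ≠ 1 by decide),
    hm (show (1 : Fin 3) ≠ 2 by decide), hm (show (2 : Fin 3) ≠ 0 by decide), smul_eq_mul]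
  ring

end CliffordAlgebra

/-! ### Integrability of the Clifford combinations over a vector space -/

section FlatIntegrability

variable {V W : Type*} [NormedAddCommGroup V] [NormedSpace ℝ V]
  [NormedAddCommGroup W] [NormedSpace ℝ W] {c : CourantFibre V W}

theorem orth_of_skew {K : W →L[ℝ] W} (sq : K * K = -1)
    (skew : ∀ x y, c.pair (K x) y = -c.pair x (K y)) (x y : W) :
    c.pair (K y) (K x) = c.pair y x := by
  have : K (K x) = -x := congrArg (fun f => f x) sq
  rw [skew, this, map_neg, neg_neg]

theorem quatComb_pair_skew {P : Fin 3 → W →L[ℝ] W} (h : IsCliffordTriple P)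
    (orth : ∀ i x y, c.pair (P i y) (P i x) = c.pair y x) (a b : Fin 3 → ℝ) (x y : W) :
    c.pair (quatComb P a b x) y = -c.pair x (quatComb P a b y) := by
  have hsq : ∀ i x, P i (P i x) = -x := fun i x => congrArg (fun f => f x) (h.sq i)
  exact quatComb_skew h (AlgHom.ofLinearMap (ContinuousLinearMap.coeLM ℝ) rfl fun _ _ => rfl)
    ((ContinuousLinearMap.coeLM ℝ).comp (c.pair : W →ₗ[ℝ] W →L[ℝ] ℝ))
    (fun i x y => CourantFibre.pair_skew (hsq i) (orth i) y x) a b x y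

variable {P : Fin 3 → V → W →L[ℝ] W} {u : V}

theorem jetPair_sum {ι : Type*} (s : Finset ι) {f : ι → V → W →L[ℝ] W}
    (hf : ∀ i, DifferentiableAt ℝ (f i) u) :
    jetPair (fun w => ∑ i ∈ s, f i w) u = ∑ i ∈ s, jetPair (f i) u := by
  classical
  induction s using Finset.induction_on with
  | empty =>
    simp only [Finset.sum_empty]
    simpa using jetPair_const_smul_one (W := W) (u := u) 0
  | insert i s hi ih =>
    simp only [Finset.sum_insert hi]
    rw [jetPair_add (hf i) (DifferentiableAt.fun_sum fun l _ => hf l), ih]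

theorem jetPair_quatComb (hP : ∀ i, DifferentiableAt ℝ (P i) u) (a b : Fin 3 → ℝ) :
    jetPair (fun w => quatComb (fun i => P i w) a b) u
      = quatComb (fun i => jetPair (P i) u) a b := by
  have hm : ∀ i j, DifferentiableAt ℝ (fun w => P i w * P j w) u :=
    fun i j => (hP i).clm_comp (hP j)
  have hn : ∀ i, (fun w => -P i w) = fun w => (-1 : ℝ) • P i w := fun i => by ext1 w; simp
  have hn' : ∀ i, jetPair (fun w => -P i w) u = -jetPair (P i) u := fun i => by
    rw [hn, jetPair_smul _ (hP i)]; module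
  have d1 : ∀ l, DifferentiableAt ℝ (fun w => P l w + P (l + 1) w * P (l + 2) w) u :=
    fun l => (hP l).fun_add (hm _ _)
  have d2 : ∀ l, DifferentiableAt ℝ (fun w => -P l w + P (l + 1) w * P (l + 2) w) u :=
    fun l => (hP l).fun_neg.fun_add (hm _ _)
  have s1 : ∀ l, DifferentiableAt ℝ (fun w => a l • (P l w + P (l + 1) w * P (l + 2) w)) u :=
    fun l => (d1 l).fun_const_smul _
  have s2 : ∀ l, DifferentiableAt ℝ (fun w => b l • (-P l w + P (l + 1) w * P (l + 2) w)) u :=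
    fun l => (d2 l).fun_const_smul _
  have t1 := DifferentiableAt.fun_sum (u := Finset.univ) fun l _ => s1 l
  have t2 := DifferentiableAt.fun_sum (u := Finset.univ) fun l _ => s2 l
  simp only [quatComb]
  rw [jetPair_add (t1.fun_const_smul _) (t2.fun_const_smul _), jetPair_smul _ t1, jetPair_smul _ t2,
    jetPair_sum _ s1, jetPair_sum _ s2]
  simp only [jetPair_smul _ (d1 _), jetPair_smul _ (d2 _), jetPair_add (hP _) (hm _ _),
    jetPair_add (hP _).fun_neg (hm _ _), jetPair_mul (hP _) (hP _), hn']

/-- Integrability, at a point, of the `S² × S²` of almost generalized complex structures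
generated by a rank 3 generalized Clifford structure. -/
theorem nijenhuis_quatComb (hP : ∀ i, DifferentiableAt ℝ (P i) u)
    (hc : ∀ᶠ w in nhds u, IsCliffordTriple fun i => P i w)
    (orth : ∀ i x y, c.pair (P i u y) (P i u x) = c.pair y x)
    (int : ∀ i x y, c.nijenhuis (P i u) (fderiv ℝ (P i) u) x y = 0) {n m : Fin 3 → ℝ}
    (hn : n 0 ^ 2 + n 1 ^ 2 + n 2 ^ 2 = 1) (hm : m 0 ^ 2 + m 1 ^ 2 + m 2 ^ 2 = 1) (x y : W) :
    c.nijenhuis (quatComb (fun i => P i u) n m)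
      (fderiv ℝ (fun w => quatComb (fun i => P i w) n m) u) x y = 0 := by
  have hu := hc.self_of_nhds
  -- The relations are needed on a neighbourhood of `u`, not only at `u`, because jets involve
  -- derivatives.
  have hj : IsCliffordTriple fun i => jetPair (P i) u := by
    intro i j
    have hm : ∀ i j, DifferentiableAt ℝ (fun w => P i w * P j w) u :=
      fun i j => (hP i).clm_comp (hP j)
    dsimp only
    rw [← jetPair_mul (hP i) (hP j), ← jetPair_mul (hP j) (hP i), ← jetPair_add (hm i j) (hm j i),
      ← jetPair_const_smul_one]
    exact jetPair_congr (hc.mono fun w hw => hw i j)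
  have hsq : ∀ i x, P i u (P i u x) = -x := fun i x => congrArg (fun f => f x) (hu.sq i)
  have hint : ∀ i, concomitant c.jetBracket (jetPair (P i) u) (jetPair (P i) u) = 0 := fun i =>
    (concomitant_jetPair_eq_zero_iff (hsq i) (orth i)).2 (int i)
  have hK := concomitant_cliffordComb (hj.sq 0) (hj.sq 1) (hj.sq 2)
    (hj.anticomm (by decide)) (hj.anticomm (by decide)) (hj.anticomm (by decide))
    (hint 0) (hint 1) (hint 2) hn hm
    ((jetPair_quatComb hP n m).trans (quatComb_eq _ _ _))
  have sqK := hu.quatComb_sq hn hm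
  exact (concomitant_jetPair_eq_zero_iff (P := fun w => quatComb (fun i => P i w) n m)
    (fun x => congrArg (fun f => f x) sqK)
    (orth_of_skew sqK (quatComb_pair_skew hu orth n m))).1 hK x y

end FlatIntegrability

/-! ### Families of generalized complex structures, surfaces and direct sums -/

section Families

variable {V W : Type*} [NormedAddCommGroup V] [NormedSpace ℝ V]
  [NormedAddCommGroup W] [NormedSpace ℝ W] {c : CourantFibre V W}

theorem fderiv_clm_apply_const {U W' : Type*} [NormedAddCommGroup U] [NormedSpace ℝ U]
    [NormedAddCommGroup W'] [NormedSpace ℝ W']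
    {J : U → W →L[ℝ] W'} {u : U} (hJ : DifferentiableAt ℝ J u) (x : W) (v : U) :
    fderiv ℝ (fun w => J w x) u v = fderiv ℝ J u v x := by
  simp [fderiv_clm_apply hJ (differentiableAt_const x)]

theorem fderiv_clm_comp_apply {U W' : Type*} [NormedAddCommGroup U] [NormedSpace ℝ U]
    [NormedAddCommGroup W'] [NormedSpace ℝ W'] (L : W →L[ℝ] W') {f : U → W} {u : U}
    (hf : DifferentiableAt ℝ f u) (v : U) :
    fderiv ℝ (fun w => L (f w)) u v = L (fderiv ℝ f u v) :=
  DFunLike.congr_fun (L.hasFDerivAt.comp u hf.hasFDerivAt).fderiv v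

/-- Differentiation of J² = −1. -/
theorem fderiv_anticomm {U : Type*} [NormedAddCommGroup U] [NormedSpace ℝ U] {J : U → W →L[ℝ] W}
    {u : U} (hJ : DifferentiableAt ℝ J u) (sq : ∀ᶠ w in nhds u, ∀ x, J w (J w x) = -x)
    (v : U) (x : W) : J u (fderiv ℝ J u v x) = -fderiv ℝ J u v (J u x) := by
  have h1 : (fun w => J w (J w x)) =ᶠ[nhds u] fun _ => -x := sq.mono fun w hw => hw x
  have h2 := DFunLike.congr_fun (h1.fderiv_eq (𝕜 := ℝ)) v
  have h3 : DifferentiableAt ℝ (fun w => J w x) u := hJ.clm_apply (differentiableAt_const x)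
  rw [fderiv_clm_apply hJ h3] at h2
  simp only [add_apply, ContinuousLinearMap.comp_apply, ContinuousLinearMap.flip_apply,
    fderiv_clm_apply_const hJ, fderiv_fun_const, Pi.zero_apply, zero_apply] at h2
  exact eq_neg_of_add_eq_zero_left h2

/-- Differentiation of ⟨y, Jx⟩ + ⟨x, Jy⟩ = 0. -/
theorem fderiv_skew {U : Type*} [NormedAddCommGroup U] [NormedSpace ℝ U] {J : U → W →L[ℝ] W}
    {u : U} (hJ : DifferentiableAt ℝ J u) (sq : ∀ᶠ w in nhds u, ∀ x, J w (J w x) = -x)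
    (orth : ∀ᶠ w in nhds u, ∀ x y, c.pair (J w y) (J w x) = c.pair y x) (v : U) (x y : W) :
    c.pair y (fderiv ℝ J u v x) = -c.pair x (fderiv ℝ J u v y) := by
  have h0 : ∀ x y, DifferentiableAt ℝ (fun w => c.pair x (J w y)) u := fun x y =>
    (c.pair x).differentiableAt.comp u (hJ.clm_apply (differentiableAt_const y))
  have h1 : (fun w => c.pair y (J w x) + c.pair x (J w y)) =ᶠ[nhds u] fun _ => 0 := by
    filter_upwards [sq, orth] with w h1 h2
    rw [c.pair_comm x, CourantFibre.pair_skew h1 h2]; ring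
  have h2 := DFunLike.congr_fun (h1.fderiv_eq (𝕜 := ℝ)) v
  have h3 : ∀ x y, fderiv ℝ (fun w => c.pair x (J w y)) u v = c.pair x (fderiv ℝ J u v y) := by
    intro x y
    rw [← fderiv_clm_apply_const hJ]
    exact fderiv_clm_comp_apply _ (hJ.clm_apply (differentiableAt_const y)) v
  rw [fderiv_fun_add (h0 _ _) (h0 _ _)] at h2
  simp only [add_apply, h3, fderiv_fun_const, Pi.zero_apply, zero_apply] at h2
  exact eq_neg_of_add_eq_zero_left h2

/-- Nondegeneracy of the pairing makes the cyclic 3-form equivalent to the Nijenhuis tensor. -/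
theorem nijenhuis_eq_zero_iff {J : V → W →L[ℝ] W} {u : V} (hJ : DifferentiableAt ℝ J u)
    (sq : ∀ᶠ w in nhds u, ∀ x, J w (J w x) = -x)
    (orth : ∀ᶠ w in nhds u, ∀ x y, c.pair (J w y) (J w x) = c.pair y x) :
    (∀ x y, c.nijenhuis (J u) (fderiv ℝ J u) x y = 0) ↔
      ∀ x y z, c.nijTerm (J u) (fderiv ℝ J u) x y z + c.nijTerm (J u) (fderiv ℝ J u) y z x
        + c.nijTerm (J u) (fderiv ℝ J u) z x y = 0 := by
  have key := CourantFibre.pair_nijenhuis (c := c) sq.self_of_nhds orth.self_of_nhds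
    (fderiv_anticomm hJ sq) (fderiv_skew hJ sq orth)
  constructor
  · intro h x y z
    rw [← key, h, map_zero]
  · intro h x y
    exact c.eq_zero_of_pair _ fun z => by rw [key, h]

/-- The generalized almost complex structure induced by an almost complex structure on a surface is
integrable. -/
theorem nijenhuis_surface (hV : Module.finrank ℝ V = 2) (φ : W →L[ℝ] V →L[ℝ] ℝ)
    (hφ : ∀ a b, c.pair a b = φ a (c.anchor b) + φ b (c.anchor a))
    {j : V → V →L[ℝ] V} {J : V → W →L[ℝ] W} {u : V} (hj : DifferentiableAt ℝ j u)
    (hJ : DifferentiableAt ℝ J u) (jsq : ∀ᶠ w in nhds u, ∀ x, j w (j w x) = -x)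
    (sq : ∀ᶠ w in nhds u, ∀ x, J w (J w x) = -x)
    (orth : ∀ᶠ w in nhds u, ∀ x y, c.pair (J w y) (J w x) = c.pair y x)
    (ha : ∀ w x, c.anchor (J w x) = j w (c.anchor x))
    (hf : ∀ w x v, φ (J w x) v = -φ x (j w v)) (x y : W) :
    c.nijenhuis (J u) (fderiv ℝ J u) x y = 0 := by
  have ha' : ∀ v x, c.anchor (fderiv ℝ J u v x) = fderiv ℝ j u v (c.anchor x) := by
    intro v x
    rw [← fderiv_clm_apply_const hJ, ← fderiv_clm_apply_const hj]
    simp only [← ha]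
    exact (fderiv_clm_comp_apply _ (hJ.clm_apply (differentiableAt_const x)) v).symm
  have hf' : ∀ v x w, φ (fderiv ℝ J u v x) w = -φ x (fderiv ℝ j u v w) := by
    intro v x w
    rw [← fderiv_clm_apply_const hJ, ← fderiv_clm_apply_const hj]
    have e1 := fderiv_clm_comp_apply (φ.flip w) (hJ.clm_apply (differentiableAt_const x)) v
    have e2 := fderiv_clm_comp_apply (φ x) (hj.clm_apply (differentiableAt_const w)) v
    simp only [ContinuousLinearMap.flip_apply, hf, fderiv_fun_neg, neg_apply] at e1
    rw [← e1, e2]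
  have : FiniteDimensional ℝ V := Module.finite_of_finrank_pos (by omega)
  have sqj := jsq.self_of_nhds
  have anti := fderiv_anticomm hj jsq
  -- This is the vanishing of the classical Nijenhuis tensor of `j`. Its defect is skew in `a`, `b`,
  -- and it vanishes on (a, ja) because j' anticommutes with j. In dimension two, a and ja span.
  have key : ∀ a b, fderiv ℝ j u (j u a) b - j u (fderiv ℝ j u a b)
      = fderiv ℝ j u (j u b) a - j u (fderiv ℝ j u b a) := by
    intro a b
    by_cases ha0 : a = 0
    · simp [ha0]
    have hli : LinearIndependent ℝ ![a, j u a] := by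
      rw [LinearIndependent.pair_iff]
      intro s t hst
      -- Apply j to sa + t ja = 0 and eliminate ja.
      have h1 : (s * s + t * t) • a = 0 := by
        have h2 := congrArg (j u) hst
        simp only [map_add, map_smul, sqj, map_zero] at h2
        linear_combination (norm := module) s • hst - t • h2
      rcases smul_eq_zero.1 h1 with h | h
      · exact ⟨by nlinarith, by nlinarith⟩
      · exact absurd h ha0
    have hspan := hli.span_eq_top_of_card_eq_finrank' (by simp [hV])
    have hb : b ∈ Submodule.span ℝ (Set.range ![a, j u a]) := hspan ▸ Submodule.mem_top
    rw [Matrix.range_cons_cons_empty, Submodule.mem_span_pair] at hb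
    obtain ⟨s, t, rfl⟩ := hb
    have e1 : fderiv ℝ j u (j u a) (j u a) = -j u (fderiv ℝ j u (j u a) a) := by
      rw [anti, neg_neg]
    have e2 : fderiv ℝ j u a (j u a) = -j u (fderiv ℝ j u a a) := by rw [anti, neg_neg]
    simp only [map_add, map_smul, add_apply, smul_apply, sqj, e1, e2, map_neg, neg_apply]
    module
  refine (nijenhuis_eq_zero_iff hJ sq orth).2 ?_ x y
  intro x y z
  -- Each term of the 3-form involves the 1-form part of one argument and the vector parts of the
  -- other two; sorting by the former gives one instance of `key` for each of x, y, z.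
  have k1 := congrArg (φ z) (key (c.anchor x) (c.anchor y))
  have k2 := congrArg (φ x) (key (c.anchor y) (c.anchor z))
  have k3 := congrArg (φ y) (key (c.anchor z) (c.anchor x))
  simp only [map_sub] at k1 k2 k3
  simp only [CourantFibre.nijTerm, hφ, ha, ha', hf, hf']
  have anti' : ∀ v x, fderiv ℝ j u v (j u x) = -j u (fderiv ℝ j u v x) := fun v x => by
    rw [anti, neg_neg]
  simp only [anti', map_neg]
  linear_combination k1 + k2 + k3

end Families

/-! ### Direct sums over a product of vector spaces -/

section DirectSum

variable {V₁ V₂ W W₁ W₂ : Type*} [NormedAddCommGroup V₁] [NormedSpace ℝ V₁]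
  [NormedAddCommGroup V₂] [NormedSpace ℝ V₂] [NormedAddCommGroup W] [NormedSpace ℝ W]
  [NormedAddCommGroup W₁] [NormedSpace ℝ W₁] [NormedAddCommGroup W₂] [NormedSpace ℝ W₂]

/-- The decomposition of the fibre of the generalized tangent bundle of a product. -/
structure CourantSum (c : CourantFibre (V₁ × V₂) W) (c₁ : CourantFibre V₁ W₁)
    (c₂ : CourantFibre V₂ W₂) where
  inl : W₁ →L[ℝ] W
  inr : W₂ →L[ℝ] W
  fst : W →L[ℝ] W₁
  snd : W →L[ℝ] W₂
  pair_inl : ∀ a x, c.pair a (inl x) = c₁.pair (fst a) x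
  pair_inr : ∀ a x, c.pair a (inr x) = c₂.pair (snd a) x
  anchor_fst : ∀ a, c₁.anchor (fst a) = (c.anchor a).1
  anchor_snd : ∀ a, c₂.anchor (snd a) = (c.anchor a).2
  fst_inl : ∀ x, fst (inl x) = x
  snd_inr : ∀ x, snd (inr x) = x
  fst_inr : ∀ x, fst (inr x) = 0
  snd_inl : ∀ x, snd (inl x) = 0
  inl_fst_add : ∀ a, inl (fst a) + inr (snd a) = a

namespace CourantSum

variable {c : CourantFibre (V₁ × V₂) W} {c₁ : CourantFibre V₁ W₁} {c₂ : CourantFibre V₂ W₂}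
  (d : CourantSum c c₁ c₂)

/-- The direct sum of two endomorphisms. -/
def dsum (P : W₁ →L[ℝ] W₁) (Q : W₂ →L[ℝ] W₂) : W →L[ℝ] W :=
  d.inl.comp (P.comp d.fst) + d.inr.comp (Q.comp d.snd)

theorem fst_inl_add (x : W₁) (y : W₂) : d.fst (d.inl x + d.inr y) = x := by
  simp [d.fst_inl, d.fst_inr]

theorem snd_inl_add (x : W₁) (y : W₂) : d.snd (d.inl x + d.inr y) = y := by
  simp [d.snd_inl, d.snd_inr]

theorem dsum_apply (P : W₁ →L[ℝ] W₁) (Q : W₂ →L[ℝ] W₂) (x : W) :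
    d.dsum P Q x = d.inl (P (d.fst x)) + d.inr (Q (d.snd x)) := rfl

theorem fst_dsum (P : W₁ →L[ℝ] W₁) (Q : W₂ →L[ℝ] W₂) (x : W) :
    d.fst (d.dsum P Q x) = P (d.fst x) :=
  d.fst_inl_add _ _

theorem snd_dsum (P : W₁ →L[ℝ] W₁) (Q : W₂ →L[ℝ] W₂) (x : W) :
    d.snd (d.dsum P Q x) = Q (d.snd x) :=
  d.snd_inl_add _ _

theorem pair_dsum (P : W₁ →L[ℝ] W₁) (Q : W₂ →L[ℝ] W₂) (x y : W) :
    c.pair y (d.dsum P Q x)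
      = c₁.pair (d.fst y) (P (d.fst x)) + c₂.pair (d.snd y) (Q (d.snd x)) := by
  simp [dsum_apply, d.pair_inl, d.pair_inr]

theorem pair_eq (x y : W) :
    c.pair y x = c₁.pair (d.fst y) (d.fst x) + c₂.pair (d.snd y) (d.snd x) := by
  conv_lhs => rw [← d.inl_fst_add x]
  rw [map_add, d.pair_inl, d.pair_inr]

/-- Formulated for bare functions so that it serves both the continuous operators in a chart and the
merely linear fibre endomorphisms in `genDirectSum`. -/
theorem sum_sq {P : W₁ → W₁} {Q : W₂ → W₂} (hP : ∀ x, P (P x) = -x) (hQ : ∀ x, Q (Q x) = -x)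
    (x : W) : d.inl (P (d.fst (d.inl (P (d.fst x)) + d.inr (Q (d.snd x)))))
      + d.inr (Q (d.snd (d.inl (P (d.fst x)) + d.inr (Q (d.snd x))))) = -x := by
  rw [fst_inl_add, snd_inl_add, hP, hQ, map_neg, map_neg, ← neg_add, d.inl_fst_add]

theorem dsum_sq {P : W₁ →L[ℝ] W₁} {Q : W₂ →L[ℝ] W₂} (hP : ∀ x, P (P x) = -x)
    (hQ : ∀ x, Q (Q x) = -x) (x : W) : d.dsum P Q (d.dsum P Q x) = -x :=
  d.sum_sq hP hQ x

theorem sum_orth {P : W₁ → W₁} {Q : W₂ → W₂}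
    (hP : ∀ x y, c₁.pair (P y) (P x) = c₁.pair y x) (hQ : ∀ x y, c₂.pair (Q y) (Q x) = c₂.pair y x)
    (x y : W) : c.pair (d.inl (P (d.fst y)) + d.inr (Q (d.snd y)))
      (d.inl (P (d.fst x)) + d.inr (Q (d.snd x))) = c.pair y x := by
  rw [d.pair_eq, fst_inl_add, snd_inl_add, fst_inl_add, snd_inl_add, hP, hQ, ← d.pair_eq]

theorem dsum_orth {P : W₁ →L[ℝ] W₁} {Q : W₂ →L[ℝ] W₂}
    (hP : ∀ x y, c₁.pair (P y) (P x) = c₁.pair y x) (hQ : ∀ x y, c₂.pair (Q y) (Q x) = c₂.pair y x)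
    (x y : W) : c.pair (d.dsum P Q y) (d.dsum P Q x) = c.pair y x :=
  d.sum_orth hP hQ x y

theorem contDiffAt_dsum {U : Type*} [NormedAddCommGroup U] [NormedSpace ℝ U]
    {P : U → W₁ →L[ℝ] W₁} {Q : U → W₂ →L[ℝ] W₂} {u : U} {n : ℕ∞ω} (hP : ContDiffAt ℝ n P u)
    (hQ : ContDiffAt ℝ n Q u) : ContDiffAt ℝ n (fun w => d.dsum (P w) (Q w)) u :=
  (contDiffAt_const.clm_comp (hP.clm_comp contDiffAt_const)).add
    (contDiffAt_const.clm_comp (hQ.clm_comp contDiffAt_const))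

theorem fderiv_dsum {U : Type*} [NormedAddCommGroup U] [NormedSpace ℝ U]
    {P : U → W₁ →L[ℝ] W₁} {Q : U → W₂ →L[ℝ] W₂} {u : U} (hP : DifferentiableAt ℝ P u)
    (hQ : DifferentiableAt ℝ Q u) :
    DifferentiableAt ℝ (fun w => d.dsum (P w) (Q w)) u ∧
      ∀ v, fderiv ℝ (fun w => d.dsum (P w) (Q w)) u v
        = d.dsum (fderiv ℝ P u v) (fderiv ℝ Q u v) := by
  have h := ((hasFDerivAt_const d.inl u).clm_comp
      (hP.hasFDerivAt.clm_comp (hasFDerivAt_const d.fst u))).add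
    ((hasFDerivAt_const d.inr u).clm_comp
      (hQ.hasFDerivAt.clm_comp (hasFDerivAt_const d.snd u)))
  refine ⟨h.differentiableAt, fun v => ?_⟩
  have h' := congrArg (fun f => f v) h.fderiv
  refine Eq.trans h' ?_
  ext x
  simp [dsum]

/-- Integrability of a direct sum in which the first summand depends holomorphically on the
parameters of the second factor. -/
theorem nijenhuis_dsum {K : V₁ × V₂ → W₁ →L[ℝ] W₁} {Q : V₂ → W₂ →L[ℝ] W₂} {u : V₁ × V₂}
    (hK : DifferentiableAt ℝ K u) (hQ : DifferentiableAt ℝ Q u.2)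
    (Ksq : ∀ᶠ w in nhds u, ∀ x, K w (K w x) = -x)
    (Korth : ∀ᶠ w in nhds u, ∀ x y, c₁.pair (K w y) (K w x) = c₁.pair y x)
    (Qsq : ∀ᶠ w in nhds u.2, ∀ x, Q w (Q w x) = -x)
    (Qorth : ∀ᶠ w in nhds u.2, ∀ x y, c₂.pair (Q w y) (Q w x) = c₂.pair y x)
    (Kint : ∀ x y, c₁.nijenhuis (K u) (fderiv ℝ (fun v => K (v, u.2)) u.1) x y = 0)
    (Qint : ∀ x y, c₂.nijenhuis (Q u.2) (fderiv ℝ Q u.2) x y = 0)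
    (twist : ∀ x y, fderiv ℝ K u (0, c₂.anchor (Q u.2 x)) y
      = K u (fderiv ℝ K u (0, c₂.anchor x) y)) (x y : W) :
    c.nijenhuis (d.dsum (K u) (Q u.2)) (fderiv ℝ (fun w => d.dsum (K w) (Q w.2)) u) x y = 0 := by
  have t2 : Filter.Tendsto (Prod.snd : V₁ × V₂ → V₂) (nhds u) (nhds u.2) :=
    continuous_snd.continuousAt
  have t1 : Filter.Tendsto (fun v : V₁ => (v, u.2)) (nhds u.1) (nhds u) :=
    (Continuous.prodMk_left u.2).continuousAt
  have hQ2 : DifferentiableAt ℝ (fun w : V₁ × V₂ => Q w.2) u := hQ.comp u differentiableAt_snd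
  have hQ2' : ∀ v, fderiv ℝ (fun w : V₁ × V₂ => Q w.2) u v = fderiv ℝ Q u.2 v.2 := fun v => by
    have h := (hQ.hasFDerivAt.comp u (hasFDerivAt_snd (𝕜 := ℝ) (p := u))).fderiv
    exact congrArg (fun f => f v) h
  have hK1 : DifferentiableAt ℝ (fun v => K (v, u.2)) u.1 :=
    DifferentiableAt.comp (g := K) u.1 hK
      (differentiableAt_id.prodMk (differentiableAt_const u.2))
  have hK1' : ∀ v, fderiv ℝ (fun v => K (v, u.2)) u.1 v = fderiv ℝ K u (v, 0) := fun v => by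
    have h := (HasFDerivAt.comp (g := K) (f := fun v => (v, u.2)) u.1 hK.hasFDerivAt
      ((hasFDerivAt_id u.1).prodMk (hasFDerivAt_const u.2 u.1))).fderiv
    exact DFunLike.congr_fun h v
  obtain ⟨hd, hd'⟩ := d.fderiv_dsum hK hQ2
  have sq : ∀ᶠ w in nhds u, ∀ x, d.dsum (K w) (Q w.2) (d.dsum (K w) (Q w.2) x) = -x := by
    filter_upwards [Ksq, t2.eventually Qsq] with w h1 h2 using d.dsum_sq h1 h2
  have orth : ∀ᶠ w in nhds u, ∀ x y, c.pair (d.dsum (K w) (Q w.2) y) (d.dsum (K w) (Q w.2) x)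
      = c.pair y x := by
    filter_upwards [Korth, t2.eventually Qorth] with w h1 h2 using d.dsum_orth h1 h2
  refine (nijenhuis_eq_zero_iff (J := fun w => d.dsum (K w) (Q w.2)) hd sq orth).2 ?_ x y
  intro x y z
  have i1 := (nijenhuis_eq_zero_iff (c := c₁) hK1 (t1.eventually Ksq)
    (t1.eventually Korth)).1 Kint (d.fst x) (d.fst y) (d.fst z)
  have i2 := (nijenhuis_eq_zero_iff hQ Qsq Qorth).1 Qint (d.snd x) (d.snd y) (d.snd z)
  have sk := CourantFibre.pair_skew (c := c₁) Ksq.self_of_nhds Korth.self_of_nhds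
  have split : ∀ v : V₁ × V₂, fderiv ℝ K u v = fderiv ℝ K u (v.1, 0) + fderiv ℝ K u (0, v.2) := by
    intro v
    rw [← map_add]; simp
  -- The mixed contribution is ⟨z₁, D_{Qx₂}K y₁⟩ + ⟨K z₁, D_{x₂}K y₁⟩. By `twist` the first summand
  -- is ⟨z₁, K D_{x₂}K y₁⟩, which by skewness of K is minus the second.
  have term : ∀ x y z, c.nijTerm (d.dsum (K u) (Q u.2))
      (fderiv ℝ (fun w => d.dsum (K w) (Q w.2)) u) x y z
      = c₁.nijTerm (K u) (fderiv ℝ (fun v => K (v, u.2)) u.1) (d.fst x) (d.fst y) (d.fst z)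
        + c₂.nijTerm (Q u.2) (fderiv ℝ Q u.2) (d.snd x) (d.snd y) (d.snd z) := by
    intro x y z
    have e1 := twist (d.snd x) (d.fst y)
    have e2 := sk (fderiv ℝ K u (0, c₂.anchor (d.snd x)) (d.fst y)) (d.fst z)
    simp only [CourantFibre.nijTerm, hd', hQ2', pair_dsum, fst_dsum, snd_dsum, hK1']
    rw [split, split (c.anchor x)]
    simp only [← d.anchor_fst, ← d.anchor_snd, fst_dsum, snd_dsum, add_apply, map_add, e1, e2]
    ring
  rw [term, term, term]
  linear_combination i1 + i2

end CourantSum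

end DirectSum

/-! ### The generalized tangent bundle in a chart -/

section ModelFibre

variable (V : Type*) [NormedAddCommGroup V] [NormedSpace ℝ V]

variable {V} in
/-- The symmetric pairing on `V × D` induced by a pairing of `V` and `D`. -/
def dualPair {D : Type*} [NormedAddCommGroup D] [NormedSpace ℝ D] (ev : D →L[ℝ] V →L[ℝ] ℝ) :
    V × D →L[ℝ] V × D →L[ℝ] ℝ :=
  ev.bilinearComp (ContinuousLinearMap.snd ℝ V D) (ContinuousLinearMap.fst ℝ V D)
    + ev.flip.bilinearComp (ContinuousLinearMap.fst ℝ V D) (ContinuousLinearMap.snd ℝ V D)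

variable {V} in
@[simp] theorem dualPair_apply {D : Type*} [NormedAddCommGroup D] [NormedSpace ℝ D]
    (ev : D →L[ℝ] V →L[ℝ] ℝ) (a b : V × D) : dualPair ev a b = ev a.2 b.1 + ev b.2 a.1 := by
  simp [dualPair]

/-- The standard structure of `V ⊕ V^*`. -/
def genFibre : CourantFibre V (V × (V →L[ℝ] ℝ)) where
  anchor := ContinuousLinearMap.fst ℝ V (V →L[ℝ] ℝ)
  coanchor := ContinuousLinearMap.inr ℝ V (V →L[ℝ] ℝ)
  pair := dualPair (ContinuousLinearMap.id ℝ (V →L[ℝ] ℝ))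
  pair_comm a b := by simp [add_comm]
  pair_coanchor a α := by simp
  eq_zero_of_pair x h := by
    ext1
    · by_contra hx
      -- Hahn–Banach: covectors separate vectors, giving nondegeneracy without any dimension
      -- assumption.
      obtain ⟨f, hf⟩ := SeparatingDual.exists_ne_zero (R := ℝ) hx
      exact hf (by simpa using h (0, f))
    · ext v
      simpa using h (v, 0)

variable {V}

@[simp] theorem genFibre_anchor (a : V × (V →L[ℝ] ℝ)) : (genFibre V).anchor a = a.1 := rfl

@[simp] theorem genFibre_coanchor (α : V →L[ℝ] ℝ) : (genFibre V).coanchor α = (0, α) := rfl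

@[simp] theorem genFibre_pair (a b : V × (V →L[ℝ] ℝ)) :
    (genFibre V).pair a b = a.2 b.1 + b.2 a.1 :=
  dualPair_apply _ a b

end ModelFibre

/-! ### Coordinates on the generalized tangent bundle and smoothness of sections -/

section Chart

variable {E : Type*} [NormedAddCommGroup E] [NormedSpace ℝ E]
  {H : Type*} [TopologicalSpace H] (I : ModelWithCorners ℝ E H)
  {M : Type*} [TopologicalSpace M] [ChartedSpace H M]

variable {I}

theorem symm_mem_source {x₀ : M} {u : E} (hu : u ∈ (extChartAt I x₀).target) :
    (extChartAt I x₀).symm u ∈ (chartAt H x₀).source := by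
  have := (extChartAt I x₀).map_target hu
  rwa [extChartAt_source] at this

theorem contMDiffAt_iff_model [I.Boundaryless] {F : Type*} [NormedAddCommGroup F] [NormedSpace ℝ F]
    {f : M → F} {n : ℕ∞ω} {x₀ : M} : ContMDiffAt I 𝓘(ℝ, F) n f x₀
      ↔ ContDiffAt ℝ n (f ∘ (extChartAt I x₀).symm) (extChartAt I x₀ x₀) := by
  rw [contMDiffAt_iff_source, I.range_eq_univ, contMDiffWithinAt_iff_contDiffWithinAt,
    contDiffWithinAt_univ]

variable [IsManifold I 1 M]

variable (I)

/-- The tangent coordinates at `y` of the chart at `x₀`. -/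
def tangentTo (x₀ y : M) : TangentSpace I y →L[ℝ] E :=
  (trivializationAt E (TangentSpace I) x₀).continuousLinearMapAt ℝ y

/-- The inverse of `tangentTo`. -/
def tangentFrom (x₀ y : M) : E →L[ℝ] TangentSpace I y :=
  (trivializationAt E (TangentSpace I) x₀).symmL ℝ y

variable {I}

theorem tangentTo_from {x₀ y : M} (hy : y ∈ (chartAt H x₀).source) (v : E) :
    tangentTo I x₀ y (tangentFrom I x₀ y v) = v :=
  (trivializationAt E (TangentSpace I) x₀).continuousLinearMapAt_symmL (by simpa using hy) v

theorem tangentFrom_to {x₀ y : M} (hy : y ∈ (chartAt H x₀).source) (v : TangentSpace I y) :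
    tangentFrom I x₀ y (tangentTo I x₀ y v) = v :=
  (trivializationAt E (TangentSpace I) x₀).symmL_continuousLinearMapAt (by simpa using hy) v

theorem tangentTo_eq {x₀ y : M} (hy : y ∈ (chartAt H x₀).source) :
    tangentTo I x₀ y = mfderiv I 𝓘(ℝ, E) (extChartAt I x₀) y :=
  TangentBundle.continuousLinearMapAt_trivializationAt hy

theorem tangentFrom_eq {x₀ y : M} (hy : y ∈ (chartAt H x₀).source) :
    tangentFrom I x₀ y
      = mfderivWithin 𝓘(ℝ, E) I (extChartAt I x₀).symm (Set.range I) (extChartAt I x₀ y) :=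
  TangentBundle.symmL_trivializationAt hy

/-- The tangent space at `x₀` is the model space through the preferred chart there, so at the centre
of a chart the coordinates change nothing. Hence identities proved in the chart at `x₀` are
identities at `x₀`. -/
theorem tangentTo_self (x₀ : M) (v : TangentSpace I x₀) : tangentTo I x₀ x₀ v = v := by
  rw [tangentTo_eq (mem_chart_source H x₀), mfderiv_extChartAt_self]
  rfl

theorem tangentFrom_self (x₀ : M) (v : E) : tangentFrom I x₀ x₀ v = v := by
  have h := tangentTo_from (I := I) (mem_chart_source H x₀) v
  rwa [tangentTo_self] at h

variable (I)

/-- Coordinates on the fibre at `y` of the generalized tangent bundle, in the chart at `x₀`. -/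
def genTo (x₀ y : M) : GenTangent I y →ₗ[ℝ] E × (E →L[ℝ] ℝ) where
  toFun a := (tangentTo I x₀ y a.1, a.2.comp (tangentFrom I x₀ y))
  map_add' a b := by
    ext1
    · exact map_add _ _ _
    · rfl
  map_smul' r a := by
    ext1
    · exact map_smul _ _ _
    · rfl

/-- The inverse of `genTo`. -/
def genFrom (x₀ y : M) : E × (E →L[ℝ] ℝ) →ₗ[ℝ] GenTangent I y where
  toFun a := (tangentFrom I x₀ y a.1, a.2.comp (tangentTo I x₀ y))
  map_add' a b := by
    ext1
    · exact map_add _ _ _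
    · rfl
  map_smul' r a := by
    ext1
    · exact map_smul _ _ _
    · rfl

variable {I}

theorem genTo_from {x₀ y : M} (hy : y ∈ (chartAt H x₀).source) (a : E × (E →L[ℝ] ℝ)) :
    genTo I x₀ y (genFrom I x₀ y a) = a := by
  refine Prod.ext (tangentTo_from hy _) ?_
  ext v
  exact congrArg a.2 (tangentTo_from hy v)

theorem genFrom_to {x₀ y : M} (hy : y ∈ (chartAt H x₀).source) (a : GenTangent I y) :
    genFrom I x₀ y (genTo I x₀ y a) = a := by
  refine Prod.ext (tangentFrom_to hy _) ?_
  ext v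
  exact congrArg a.2 (tangentFrom_to hy v)

theorem pair_genTo {x₀ y : M} (hy : y ∈ (chartAt H x₀).source) (a b : GenTangent I y) :
    (genFibre E).pair (genTo I x₀ y a) (genTo I x₀ y b) = 2 * genPairing I a b := by
  have h1 : (genTo I x₀ y a).2 (genTo I x₀ y b).1 = a.2 b.1 := congrArg a.2 (tangentFrom_to hy b.1)
  have h2 : (genTo I x₀ y b).2 (genTo I x₀ y a).1 = b.2 a.1 := congrArg b.2 (tangentFrom_to hy a.1)
  rw [genFibre_pair, h1, h2, genPairing]
  ring

theorem genTo_self (x₀ : M) (a : GenTangent I x₀) : genTo I x₀ x₀ a = a := by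
  refine Prod.ext (tangentTo_self x₀ _) ?_
  ext v
  exact congrArg a.2 (tangentFrom_self x₀ v)

variable (I) in
/-- A section of the generalized tangent bundle read in the chart at `x₀`. -/
def secModel (A : ∀ x : M, GenTangent I x) (x₀ : M) (u : E) : E × (E →L[ℝ] ℝ) :=
  genTo I x₀ ((extChartAt I x₀).symm u) (A ((extChartAt I x₀).symm u))

variable [I.Boundaryless]

/-- Near `x₀` the trivialization of TM is `tangentTo` and that of T*M is precomposition with
`tangentFrom`, so the two bundle conditions are the two components of one coordinate map. -/
theorem contMDiffAt_section_iff_model {A : ∀ x : M, GenTangent I x} {x₀ : M} :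
    (ContMDiffAt I (I.prod 𝓘(ℝ, E)) ∞
      (fun x : M => (TotalSpace.mk' E x (A x).1 : TotalSpace E (TangentSpace I : M → Type _))) x₀ ∧
    ContMDiffAt I (I.prod 𝓘(ℝ, E →L[ℝ] ℝ)) ∞
      (fun x : M => (TotalSpace.mk' (E →L[ℝ] ℝ) x (A x).2 :
        TotalSpace (E →L[ℝ] ℝ) (fun y : M => TangentSpace I y →L[ℝ] Trivial M ℝ y))) x₀)
      ↔ ContDiffAt ℝ ∞ (secModel I A x₀) (extChartAt I x₀ x₀) := by
  have hs : ∀ᶠ y in nhds x₀, y ∈ (chartAt H x₀).source := chart_source_mem_nhds H x₀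
  rw [contMDiffAt_section, contMDiffAt_section]
  have h1 : (fun x => (trivializationAt E (TangentSpace I) x₀ ⟨x, (A x).1⟩).2)
      =ᶠ[nhds x₀] fun x => (genTo I x₀ x (A x)).1 := by
    filter_upwards [hs] with y hy
    exact ((trivializationAt E (TangentSpace I) x₀).continuousLinearMapAt_apply_of_mem ℝ
      (by simpa using hy) _).symm
  have h2 : (fun x => (trivializationAt (E →L[ℝ] ℝ)
        (fun y : M => TangentSpace I y →L[ℝ] Trivial M ℝ y) x₀ ⟨x, (A x).2⟩).2)
      =ᶠ[nhds x₀] fun x => (genTo I x₀ x (A x)).2 := by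
    filter_upwards [hs] with y hy
    rw [hom_trivializationAt_apply]
    ext v
    simp [ContinuousLinearMap.inCoordinates]
    rfl
  rw [h1.contMDiffAt_iff, h2.contMDiffAt_iff, contMDiffAt_iff_model, contMDiffAt_iff_model]
  constructor
  · rintro ⟨a, b⟩
    exact a.prodMk b
  · intro h
    exact ⟨h.fst, h.snd⟩

theorem isSmoothSection_iff {A : ∀ x : M, GenTangent I x} :
    IsSmoothSection I A ↔ ∀ x₀, ContDiffAt ℝ ∞ (secModel I A x₀) (extChartAt I x₀ x₀) := by
  constructor
  · intro h x₀
    exact contMDiffAt_section_iff_model.1 ⟨h.vec x₀, h.form x₀⟩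
  · intro h
    exact ⟨fun x => (contMDiffAt_section_iff_model.2 (h x)).1,
      fun x => (contMDiffAt_section_iff_model.2 (h x)).2⟩

end Chart

/-! ### The Dorfman bracket in a chart -/

section DorfmanChart

variable {E : Type*} [NormedAddCommGroup E] [NormedSpace ℝ E]
  {H : Type*} [TopologicalSpace H] {I : ModelWithCorners ℝ E H}
  {M : Type*} [TopologicalSpace M] [ChartedSpace H M] [IsManifold I 1 M] [I.Boundaryless]

/-- The manifold bracket is by definition the bracket of the pullbacks under the inverse chart, and
near the base point those pullbacks are the coordinate expressions of the fields. -/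
theorem mlieBracket_model (X Y : ∀ x : M, TangentSpace I x) (x₀ : M) :
    tangentTo I x₀ x₀ (VectorField.mlieBracket I X Y x₀) =
      VectorField.lieBracket ℝ
        (fun u => tangentTo I x₀ ((extChartAt I x₀).symm u) (X ((extChartAt I x₀).symm u)))
        (fun u => tangentTo I x₀ ((extChartAt I x₀).symm u) (Y ((extChartAt I x₀).symm u)))
        (extChartAt I x₀ x₀) := by
  have key : ∀ Z : ∀ x : M, TangentSpace I x,
      VectorField.mpullbackWithin 𝓘(ℝ, E) I (extChartAt I x₀).symm Z (Set.range I)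
        =ᶠ[nhds (extChartAt I x₀ x₀)]
      (fun u => tangentTo I x₀ ((extChartAt I x₀).symm u) (Z ((extChartAt I x₀).symm u))) := by
    intro Z
    filter_upwards [extChartAt_target_mem_nhds (I := I) x₀] with u hu
    rw [VectorField.mpullbackWithin_apply, tangentTo_eq (symm_mem_source hu)]
    congr 1
    exact ContinuousLinearMap.inverse_eq
      (mfderivWithin_extChartAt_symm_comp_mfderiv_extChartAt hu)
      (mfderiv_extChartAt_comp_mfderivWithin_extChartAt_symm hu)
  rw [tangentTo_self, VectorField.mlieBracket, VectorField.mlieBracketWithin_apply,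
    mfderiv_extChartAt_self]
  have hs : (extChartAt I x₀).symm ⁻¹' Set.univ ∩ Set.range I = Set.univ := by
    rw [I.range_eq_univ, Set.preimage_univ, Set.univ_inter]
  have e := (key X).lieBracket_vectorField_eq (𝕜 := ℝ) (key Y)
  rw [hs]
  exact (DFunLike.congr_fun (ContinuousLinearMap.inverse_id (R := ℝ) (M := E)) _).trans
    ((congrFun VectorField.lieBracketWithin_univ _).trans e)

theorem formInChart_model (ξ : ∀ x : M, TangentSpace I x →L[ℝ] ℝ) (x₀ : M) :
    formInChart I ξ x₀ =ᶠ[nhds (extChartAt I x₀ x₀)] fun u =>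
      (ξ ((extChartAt I x₀).symm u)).comp (tangentFrom I x₀ ((extChartAt I x₀).symm u)) := by
  filter_upwards [extChartAt_target_mem_nhds (I := I) x₀] with u hu
  rw [formInChart, tangentFrom_eq (symm_mem_source hu), (extChartAt I x₀).right_inv hu]

theorem contractExtDeriv_model (ξ : ∀ x : M, TangentSpace I x →L[ℝ] ℝ) (x₀ : M)
    (v : TangentSpace I x₀) (w : E) {Ξ : E → E →L[ℝ] ℝ}
    (hΞ : Ξ = fun u =>
      (ξ ((extChartAt I x₀).symm u)).comp (tangentFrom I x₀ ((extChartAt I x₀).symm u))) :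
    contractExtDeriv I ξ x₀ v (tangentFrom I x₀ x₀ w)
      = fderiv ℝ Ξ (extChartAt I x₀ x₀) (tangentTo I x₀ x₀ v) w
        - fderiv ℝ Ξ (extChartAt I x₀ x₀) w (tangentTo I x₀ x₀ v) := by
  have e : fderivWithin ℝ (formInChart I ξ x₀) (Set.range I) (extChartAt I x₀ x₀)
      = fderiv ℝ Ξ (extChartAt I x₀ x₀) := by
    rw [I.range_eq_univ, fderivWithin_univ, hΞ]
    exact (formInChart_model ξ x₀).fderiv_eq
  rw [tangentTo_self, tangentFrom_self]
  simp only [contractExtDeriv, e, mfderiv_extChartAt_self]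
  rfl

omit [I.Boundaryless] in
theorem mvfderiv_model {g : M → ℝ} {x₀ : M} {h : E → ℝ}
    (hg : ∀ᶠ u in nhds (extChartAt I x₀ x₀), g ((extChartAt I x₀).symm u) = h u)
    (hh : DifferentiableAt ℝ h (extChartAt I x₀ x₀)) (w : E) :
    mvfderiv I g x₀ (tangentFrom I x₀ x₀ w) = fderiv ℝ h (extChartAt I x₀ x₀) w := by
  have e : g =ᶠ[nhds x₀] h ∘ extChartAt I x₀ := by
    filter_upwards [(continuousAt_extChartAt (I := I) x₀).eventually hg,
      extChartAt_source_mem_nhds (I := I) x₀] with y h1 h2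
    rw [Function.comp_apply, ← h1, (extChartAt I x₀).left_inv h2]
  have h1 : mfderiv I 𝓘(ℝ, ℝ) g x₀ = mfderiv I 𝓘(ℝ, ℝ) (h ∘ extChartAt I x₀) x₀ := e.mfderiv_eq
  have h2 := mfderiv_comp x₀ hh.mdifferentiableAt
    (mdifferentiableAt_extChartAt (I := I) (mem_chart_source H x₀))
  rw [mfderiv_extChartAt_self, mfderiv_eq_fderiv] at h2
  rw [tangentFrom_self]
  change mfderiv I 𝓘(ℝ, ℝ) g x₀ w = _
  rw [h1, h2]
  rfl

/-- The Dorfman bracket in a chart. -/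
theorem dorfmanBracket_model {A B : ∀ x : M, GenTangent I x} {x₀ : M}
    (hA : DifferentiableAt ℝ (secModel I A x₀) (extChartAt I x₀ x₀))
    (hB : DifferentiableAt ℝ (secModel I B x₀) (extChartAt I x₀ x₀)) :
    genTo I x₀ x₀ (dorfmanBracket I A B x₀) = (genFibre E).jetBracket
      (secModel I A x₀ (extChartAt I x₀ x₀), fderiv ℝ (secModel I A x₀) (extChartAt I x₀ x₀))
      (secModel I B x₀ (extChartAt I x₀ x₀), fderiv ℝ (secModel I B x₀) (extChartAt I x₀ x₀)) := by
  set u₀ := extChartAt I x₀ x₀ with hu₀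
  have fst' : ∀ {C : ∀ x : M, GenTangent I x}, DifferentiableAt ℝ (secModel I C x₀) u₀ → ∀ v,
      fderiv ℝ (fun u => (secModel I C x₀ u).1) u₀ v = (fderiv ℝ (secModel I C x₀) u₀ v).1 :=
    fun hC v => DFunLike.congr_fun hC.hasFDerivAt.fst.fderiv v
  have snd' : ∀ {C : ∀ x : M, GenTangent I x}, DifferentiableAt ℝ (secModel I C x₀) u₀ → ∀ v,
      fderiv ℝ (fun u => (secModel I C x₀ u).2) u₀ v = (fderiv ℝ (secModel I C x₀) u₀ v).2 :=
    fun hC v => DFunLike.congr_fun hC.hasFDerivAt.snd.fderiv v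
  have val : ∀ C : ∀ x : M, GenTangent I x, secModel I C x₀ u₀ = genTo I x₀ x₀ (C x₀) := by
    intro C
    have h2 : (extChartAt I x₀).symm u₀ = x₀ := extChartAt_to_inv x₀
    rw [secModel, h2]
  have ev : ∀ᶠ u in nhds u₀, (fun y => (B y).2 (A y).1) ((extChartAt I x₀).symm u)
      = (secModel I B x₀ u).2 (secModel I A x₀ u).1 := by
    filter_upwards [extChartAt_target_mem_nhds (I := I) x₀] with u hu
    exact congrArg (B _).2 (tangentFrom_to (symm_mem_source hu) _).symm
  have hd : HasFDerivAt (fun u => (secModel I B x₀ u).2 (secModel I A x₀ u).1) _ u₀ :=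
    hB.hasFDerivAt.snd.clm_apply hA.hasFDerivAt.fst
  have val1 : ∀ C : ∀ x : M, GenTangent I x, tangentTo I x₀ x₀ (C x₀).1
      = (secModel I C x₀ u₀).1 := fun C => by rw [val]; rfl
  rw [CourantFibre.jetBracket_apply]
  refine Prod.ext ?_ ?_
  · refine (mlieBracket_model _ _ x₀).trans ?_
    simp only [genFibre_anchor, genFibre_coanchor, Prod.fst_add, Prod.fst_sub, add_zero]
    rw [← fst' hA, ← fst' hB]
    rfl
  · ext w
    have m1 := mvfderiv_model (g := fun y => (B y).2 (A y).1) (x₀ := x₀) ev hd.differentiableAt w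
    rw [← hu₀, hd.fderiv] at m1
    have m2 := contractExtDeriv_model (Ξ := fun u => (secModel I B x₀ u).2)
      (fun y => (B y).2) x₀ (A x₀).1 w rfl
    have m3 := contractExtDeriv_model (Ξ := fun u => (secModel I A x₀ u).2)
      (fun y => (A y).2) x₀ (B x₀).1 w rfl
    rw [← hu₀, val1 A, snd' hB, snd' hB] at m2
    rw [← hu₀, val1 B, snd' hA, snd' hA] at m3
    have lhs : (genTo I x₀ x₀ (dorfmanBracket I A B x₀)).2 w
        = mvfderiv I (fun y => (B y).2 (A y).1) x₀ (tangentFrom I x₀ x₀ w)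
        + contractExtDeriv I (fun y => (B y).2) x₀ (A x₀).1 (tangentFrom I x₀ x₀ w)
        - contractExtDeriv I (fun y => (A y).2) x₀ (B x₀).1 (tangentFrom I x₀ x₀ w) := rfl
    -- The derivative of η(X) along w is (D_wη)(X) + η(D_wX). The first part cancels against ι_X dη;
    -- the second joins (D_wξ)(Y), from −ι_Y dξ, to form twice the pairing ⟨B, D_wA⟩.
    rw [lhs, m1, m2, m3]
    simp only [genFibre_anchor, genFibre_coanchor, Prod.snd_add, Prod.snd_sub, add_apply,
      sub_apply, ContinuousLinearMap.comp_apply, genFibre_pair,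
      ContinuousLinearMap.flip_apply, ContinuousLinearMap.coe_fst', ContinuousLinearMap.coe_snd']
    ring

end DorfmanChart

/-! ### Endomorphisms of the generalized tangent bundle in a chart -/

/-- In finite dimension an operator is determined, through a continuous linear isomorphism, by its
values on a basis. -/
theorem contDiffAt_clm_of_apply {U W W' : Type*} [NormedAddCommGroup U] [NormedSpace ℝ U]
    [NormedAddCommGroup W] [NormedSpace ℝ W] [FiniteDimensional ℝ W] [NormedAddCommGroup W']
    [NormedSpace ℝ W'] {f : U → W →L[ℝ] W'} {u : U} {n : ℕ∞ω}
    (h : ∀ x, ContDiffAt ℝ n (fun w => f w x) u) : ContDiffAt ℝ n f u := by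
  let d := Module.finrank ℝ W
  have hd : d = Module.finrank ℝ (Fin d → ℝ) := (Module.finrank_fin_fun ℝ).symm
  let e₁ := ContinuousLinearEquiv.ofFinrankEq hd
  let e₂ := (e₁.arrowCongr (1 : W' ≃L[ℝ] W')).trans (ContinuousLinearEquiv.piRing (Fin d))
  rw [← Function.id_comp f, ← e₂.symm_comp_self]
  exact e₂.symm.contDiff.contDiffAt.comp u (contDiffAt_pi.mpr fun i => h _)

section EndChart

variable {E : Type*} [NormedAddCommGroup E] [NormedSpace ℝ E] [FiniteDimensional ℝ E]
  {H : Type*} [TopologicalSpace H] {I : ModelWithCorners ℝ E H}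
  {M : Type*} [TopologicalSpace M] [ChartedSpace H M] [IsManifold I 1 M]

variable (I) in
/-- An endomorphism of the generalized tangent bundle read in the chart at `x₀`. -/
def endModel (J : ∀ x : M, Module.End ℝ (GenTangent I x)) (x₀ : M) (u : E) :
    E × (E →L[ℝ] ℝ) →L[ℝ] E × (E →L[ℝ] ℝ) :=
  LinearMap.toContinuousLinearMap (genTo I x₀ ((extChartAt I x₀).symm u) ∘ₗ
    J ((extChartAt I x₀).symm u) ∘ₗ genFrom I x₀ ((extChartAt I x₀).symm u))

variable {J : ∀ x : M, Module.End ℝ (GenTangent I x)} {x₀ : M} {u : E}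

theorem endModel_apply (a : E × (E →L[ℝ] ℝ)) :
    endModel I J x₀ u a = genTo I x₀ ((extChartAt I x₀).symm u)
      (J ((extChartAt I x₀).symm u) (genFrom I x₀ ((extChartAt I x₀).symm u) a)) := rfl

theorem endModel_secModel (A : ∀ x : M, GenTangent I x) (hu : u ∈ (extChartAt I x₀).target) :
    endModel I J x₀ u (secModel I A x₀ u) = secModel I (fun y => J y (A y)) x₀ u := by
  rw [endModel_apply, secModel, genFrom_to (symm_mem_source hu)]
  rfl

theorem endModel_sq (sq : ∀ x, J x * J x = -1) (hu : u ∈ (extChartAt I x₀).target)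
    (a : E × (E →L[ℝ] ℝ)) : endModel I J x₀ u (endModel I J x₀ u a) = -a := by
  rw [endModel_apply, endModel_apply, genFrom_to (symm_mem_source hu)]
  have h := LinearMap.congr_fun (sq ((extChartAt I x₀).symm u))
    (genFrom I x₀ ((extChartAt I x₀).symm u) a)
  refine (congrArg (genTo I x₀ _) h).trans ?_
  rw [LinearMap.neg_apply, map_neg, Module.End.one_apply, genTo_from (symm_mem_source hu)]

theorem endModel_orth
    (orth : ∀ (x : M) (a b : GenTangent I x), genPairing I (J x a) (J x b) = genPairing I a b)
    (hu : u ∈ (extChartAt I x₀).target) (a b : E × (E →L[ℝ] ℝ)) :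
    (genFibre E).pair (endModel I J x₀ u b) (endModel I J x₀ u a) = (genFibre E).pair b a := by
  have hs := symm_mem_source hu
  rw [endModel_apply, endModel_apply, pair_genTo hs, orth, ← pair_genTo hs, genTo_from hs,
    genTo_from hs]

variable [I.Boundaryless]

/-- The Nijenhuis tensor in a chart. -/
theorem genNijenhuis_model {A B : ∀ x : M, GenTangent I x} (sq : ∀ x, J x * J x = -1)
    (orth : ∀ (x : M) (a b : GenTangent I x), genPairing I (J x a) (J x b) = genPairing I a b)
    (hJ : DifferentiableAt ℝ (endModel I J x₀) (extChartAt I x₀ x₀))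
    (hA : DifferentiableAt ℝ (secModel I A x₀) (extChartAt I x₀ x₀))
    (hB : DifferentiableAt ℝ (secModel I B x₀) (extChartAt I x₀ x₀)) :
    genTo I x₀ x₀ (genNijenhuis I J A B x₀) = (genFibre E).nijenhuis
      (endModel I J x₀ (extChartAt I x₀ x₀)) (fderiv ℝ (endModel I J x₀) (extChartAt I x₀ x₀))
      (secModel I A x₀ (extChartAt I x₀ x₀)) (secModel I B x₀ (extChartAt I x₀ x₀)) := by
  set u₀ := extChartAt I x₀ x₀ with hu₀
  have ht : u₀ ∈ (extChartAt I x₀).target := mem_extChartAt_target x₀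
  have hx : (extChartAt I x₀).symm u₀ = x₀ := extChartAt_to_inv x₀
  -- The 1-jet of JC is `jetEnd` applied to the 1-jet of C, by the product rule.
  have jet : ∀ {C : ∀ x : M, GenTangent I x}, DifferentiableAt ℝ (secModel I C x₀) u₀ →
      DifferentiableAt ℝ (secModel I (fun y => J y (C y)) x₀) u₀ ∧
      (secModel I (fun y => J y (C y)) x₀ u₀, fderiv ℝ (secModel I (fun y => J y (C y)) x₀) u₀)
        = jetEnd (endModel I J x₀ u₀) (fderiv ℝ (endModel I J x₀) u₀)
          (secModel I C x₀ u₀, fderiv ℝ (secModel I C x₀) u₀) := by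
    intro C hC
    have e : secModel I (fun y => J y (C y)) x₀ =ᶠ[nhds u₀]
        fun u => endModel I J x₀ u (secModel I C x₀ u) := by
      filter_upwards [extChartAt_target_mem_nhds (I := I) x₀] with u hu
      exact (endModel_secModel C hu).symm
    have hd := hJ.hasFDerivAt.clm_apply hC.hasFDerivAt
    refine ⟨(hd.congr_of_eventuallyEq e).differentiableAt, Prod.ext e.self_of_nhds ?_⟩
    rw [e.fderiv_eq, hd.fderiv]
    simp only [jetEnd, LinearMap.coe_mk, AddHom.coe_mk]
    exact add_comm _ _
  have hJx : ∀ a : GenTangent I x₀, genTo I x₀ x₀ (J x₀ a)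
      = endModel I J x₀ u₀ (genTo I x₀ x₀ a) := by
    intro a
    rw [endModel_apply, hx, genFrom_to (mem_chart_source H x₀)]
  obtain ⟨dA, jA⟩ := jet hA
  obtain ⟨dB, jB⟩ := jet hB
  have key := CourantFibre.nijenhuis_jet (c := genFibre E)
    (J' := fderiv ℝ (endModel I J x₀) u₀) (endModel_sq sq ht) (endModel_orth orth ht)
    (secModel I A x₀ u₀, fderiv ℝ (secModel I A x₀) u₀)
    (secModel I B x₀ u₀, fderiv ℝ (secModel I B x₀) u₀)
  rw [← jA, ← jB] at key
  rw [← key, genNijenhuis, map_sub, map_sub, map_sub, hJx, hJx, dorfmanBracket_model dA dB,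
    dorfmanBracket_model dA hB, dorfmanBracket_model hA dB, dorfmanBracket_model hA hB]

/-- Smoothness of an endomorphism from smoothness in charts. -/
theorem smooth_of_endModel
    (hJ : ∀ x₀, ContDiffAt ℝ ∞ (endModel I J x₀) (extChartAt I x₀ x₀))
    {A : ∀ x : M, GenTangent I x} (hA : IsSmoothSection I A) :
    IsSmoothSection I (fun x => J x (A x)) := by
  rw [isSmoothSection_iff] at hA ⊢
  intro x₀
  refine ((hJ x₀).clm_apply (hA x₀)).congr_of_eventuallyEq ?_
  filter_upwards [extChartAt_target_mem_nhds (I := I) x₀] with u hu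
  exact (endModel_secModel A hu).symm

/-- Integrability from vanishing of the Nijenhuis tensor in charts. -/
theorem integrable_of_endModel (sq : ∀ x, J x * J x = -1)
    (orth : ∀ (x : M) (a b : GenTangent I x), genPairing I (J x a) (J x b) = genPairing I a b)
    (hJ : ∀ x₀, DifferentiableAt ℝ (endModel I J x₀) (extChartAt I x₀ x₀))
    (hN : ∀ x₀ a b, (genFibre E).nijenhuis (endModel I J x₀ (extChartAt I x₀ x₀))
      (fderiv ℝ (endModel I J x₀) (extChartAt I x₀ x₀)) a b = 0) :
    IsDorfmanIntegrable I J := by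
  intro A B hA hB x
  rw [isSmoothSection_iff] at hA hB
  have h := genNijenhuis_model sq orth (hJ x) ((hA x).differentiableAt (by simp))
    ((hB x).differentiableAt (by simp))
  rw [hN, genTo_self] at h
  exact h

/-! ### Local extension of fibre elements, and passage from global conditions to charts -/

section Bump

variable [T2Space M] [IsManifold I ∞ M]

/-- Every element of the model fibre extends to a smooth section that is constant near `x₀` in the
chart at `x₀`. -/
theorem exists_isSmoothSection (x₀ : M) (a : E × (E →L[ℝ] ℝ)) :
    ∃ A : ∀ x : M, GenTangent I x, IsSmoothSection I A ∧
      ∀ᶠ u in nhds (extChartAt I x₀ x₀), secModel I A x₀ u = a := by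
  obtain ⟨f⟩ : Nonempty (SmoothBumpFunction I x₀) := inferInstance
  have hf : ContMDiffOn I 𝓘(ℝ, ℝ) ∞ f (chartAt H x₀).source := f.contMDiff.contMDiffOn
  have ho : IsOpen (chartAt H x₀).source := (chartAt H x₀).open_source
  have hs : tsupport f ⊆ (chartAt H x₀).source := f.tsupport_subset_chartAt_source
  -- The section with constant coordinates `a` exists only over the chart domain; a bump function
  -- with closed support there extends it by zero.
  refine ⟨fun y => f y • genFrom I x₀ y a, ⟨?_, ?_⟩, ?_⟩
  · refine ContMDiffOn.smul_section_of_tsupport (V := (TangentSpace I : M → Type _))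
      (s := fun y => tangentFrom I x₀ y a.1) hf ho hs ?_
    rw [(trivializationAt E (TangentSpace I) x₀).contMDiffOn_section_iff ho (by simp)]
    refine (contMDiffOn_const (c := a.1)).congr fun y hy => ?_
    refine Eq.trans ?_ (tangentTo_from (I := I) (x₀ := x₀) (y := y) hy a.1)
    exact ((trivializationAt E (TangentSpace I) x₀).continuousLinearMapAt_apply_of_mem ℝ
      (by simpa using hy) _).symm
  · refine ContMDiffOn.smul_section_of_tsupport
      (V := fun y : M => TangentSpace I y →L[ℝ] Trivial M ℝ y)
      (s := fun y => a.2.comp (tangentTo I x₀ y)) hf ho hs ?_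
    rw [(trivializationAt (E →L[ℝ] ℝ)
      (fun y : M => TangentSpace I y →L[ℝ] Trivial M ℝ y) x₀).contMDiffOn_section_iff ho (by simp)]
    refine (contMDiffOn_const (c := a.2)).congr fun y hy => ?_
    rw [hom_trivializationAt_apply]
    ext v
    have h := congrArg a.2 (tangentTo_from (I := I) hy v)
    simp only [ContinuousLinearMap.inCoordinates]
    rw [← h]
    simp
    rfl
  · have h1 : ∀ᶠ u in nhds (extChartAt I x₀ x₀), f ((extChartAt I x₀).symm u) = 1 := by
      have hc := (continuousAt_extChartAt_symm (I := I) x₀).tendsto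
      rw [extChartAt_to_inv] at hc
      exact hc.eventually f.eventuallyEq_one
    filter_upwards [h1, extChartAt_target_mem_nhds (I := I) x₀] with u h1 h2
    rw [secModel, map_smul, h1, one_smul, genTo_from (symm_mem_source h2)]

/-- An endomorphism preserving smooth sections is smooth in charts. -/
theorem contDiffAt_endModel
    (hJ : ∀ A : ∀ x : M, GenTangent I x, IsSmoothSection I A →
      IsSmoothSection I (fun x => J x (A x))) (x₀ : M) :
    ContDiffAt ℝ ∞ (endModel I J x₀) (extChartAt I x₀ x₀) := by
  have hcol : ∀ a, ContDiffAt ℝ ∞ (fun u => endModel I J x₀ u a) (extChartAt I x₀ x₀) := by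
    intro a
    obtain ⟨A, hA, hAa⟩ := exists_isSmoothSection (I := I) x₀ a
    refine (isSmoothSection_iff.1 (hJ A hA) x₀).congr_of_eventuallyEq ?_
    filter_upwards [hAa, extChartAt_target_mem_nhds (I := I) x₀] with u h1 h2
    rw [← h1, endModel_secModel A h2]
  exact contDiffAt_clm_of_apply hcol

/-- The Nijenhuis tensor of an integrable structure vanishes in charts. -/
theorem nijenhuis_endModel (hJ : IsAlmostGenComplex I J) (hi : IsDorfmanIntegrable I J) (x₀ : M)
    (a b : E × (E →L[ℝ] ℝ)) :
    (genFibre E).nijenhuis (endModel I J x₀ (extChartAt I x₀ x₀))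
      (fderiv ℝ (endModel I J x₀) (extChartAt I x₀ x₀)) a b = 0 := by
  obtain ⟨A, hA, hAa⟩ := exists_isSmoothSection (I := I) x₀ a
  obtain ⟨B, hB, hBb⟩ := exists_isSmoothSection (I := I) x₀ b
  have h := genNijenhuis_model (x₀ := x₀) hJ.sq hJ.orthogonal
    ((contDiffAt_endModel hJ.smooth x₀).differentiableAt (by simp))
    ((isSmoothSection_iff.1 hA x₀).differentiableAt (by simp))
    ((isSmoothSection_iff.1 hB x₀).differentiableAt (by simp))
  rw [hi A B hA hB, map_zero, hAa.self_of_nhds, hBb.self_of_nhds] at h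
  exact h.symm

end Bump

end EndChart

/-! ### Complex structures on tangent spaces in a chart -/

/-- Near `u` the factor f stays invertible, so h = f⁻¹g, and inversion is smooth at 1. -/
theorem contDiffAt_of_mul_eq {U A : Type*} [NormedAddCommGroup U] [NormedSpace ℝ U] [NormedRing A]
    [NormedAlgebra ℝ A] [HasSummableGeomSeries A] {f g h : U → A} {u : U} {n : ℕ∞ω}
    (hf : ContDiffAt ℝ n f u) (hf1 : f u = 1) (hg : ContDiffAt ℝ n g u)
    (e : ∀ᶠ w in nhds u, f w * h w = g w) : ContDiffAt ℝ n h u := by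
  have hi : ContDiffAt ℝ n (fun w => Ring.inverse (f w)) u := by
    refine ContDiffAt.comp (g := Ring.inverse) u ?_ hf
    rw [hf1]
    exact contDiffAt_ringInverse ℝ (1 : Aˣ)
  have hunit : ∀ᶠ w in nhds u, IsUnit (f w) := by
    refine hf.continuousAt.tendsto.eventually (p := fun x => IsUnit x) ?_
    rw [hf1]
    exact Units.isOpen.mem_nhds isUnit_one
  refine (hi.mul hg).congr_of_eventuallyEq ?_
  filter_upwards [e, hunit] with w h1 h2
  rw [← h1, ← mul_assoc, Ring.inverse_mul_cancel _ h2, one_mul]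

section TangentEnd

variable {E : Type*} [NormedAddCommGroup E] [NormedSpace ℝ E]
  {H : Type*} [TopologicalSpace H] {I : ModelWithCorners ℝ E H}
  {M : Type*} [TopologicalSpace M] [ChartedSpace H M] [IsManifold I 1 M]

variable (I) in
/-- An endomorphism of the tangent bundle read in the chart at `x₀`. -/
def tangentEndModel (j : ∀ x : M, TangentSpace I x →L[ℝ] TangentSpace I x) (x₀ : M) (u : E) :
    E →L[ℝ] E :=
  (tangentTo I x₀ ((extChartAt I x₀).symm u)).comp
    ((j ((extChartAt I x₀).symm u)).comp (tangentFrom I x₀ ((extChartAt I x₀).symm u)))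

variable {j : ∀ x : M, TangentSpace I x →L[ℝ] TangentSpace I x} {x₀ : M} {u : E}

theorem tangentEndModel_sq (hj : ∀ x v, j x (j x v) = -v) (hu : u ∈ (extChartAt I x₀).target)
    (v : E) : tangentEndModel I j x₀ u (tangentEndModel I j x₀ u v) = -v := by
  simp only [tangentEndModel, ContinuousLinearMap.comp_apply]
  rw [tangentFrom_to (symm_mem_source hu), hj, map_neg, tangentTo_from (symm_mem_source hu)]

omit [IsManifold I 1 M] in
theorem genOfTangentEnd_sq {x : M} {j : TangentSpace I x →L[ℝ] TangentSpace I x}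
    (hj : ∀ v, j (j v) = -v) : genOfTangentEnd I j * genOfTangentEnd I j = -1 := by
  refine LinearMap.ext fun a => Prod.ext (hj a.1) ?_
  ext v
  change -(-(a.2 (j (j v)))) = -(a.2 v)
  rw [hj, map_neg, neg_neg]

omit [IsManifold I 1 M] in
theorem genOfTangentEnd_orth {x : M} {j : TangentSpace I x →L[ℝ] TangentSpace I x}
    (hj : ∀ v, j (j v) = -v) (a b : GenTangent I x) :
    genPairing I (genOfTangentEnd I j a) (genOfTangentEnd I j b) = genPairing I a b := by
  change (1 / 2 : ℝ) * (-(a.2 (j (j b.1))) + -(b.2 (j (j a.1)))) = _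
  rw [hj, hj, map_neg, map_neg, neg_neg, neg_neg]
  rfl

variable [FiniteDimensional ℝ E]

theorem endModel_genOfTangentEnd (a : E × (E →L[ℝ] ℝ)) :
    endModel I (fun x => genOfTangentEnd I (j x)) x₀ u a
      = (tangentEndModel I j x₀ u a.1, -(a.2.comp (tangentEndModel I j x₀ u))) := rfl

theorem contDiffAt_endModel_genOfTangentEnd {n : ℕ∞ω}
    (hj : ContDiffAt ℝ n (tangentEndModel I j x₀) u) :
    ContDiffAt ℝ n (endModel I (fun x => genOfTangentEnd I (j x)) x₀) u := by
  refine contDiffAt_clm_of_apply fun a => ?_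
  simp only [endModel_genOfTangentEnd]
  exact (hj.clm_apply contDiffAt_const).prodMk (contDiffAt_const.clm_comp hj).neg

/-- On a surface, the structure induced by a smooth almost complex structure is integrable. -/
theorem nijenhuis_genOfTangentEnd [I.Boundaryless] (hE : Module.finrank ℝ E = 2)
    (hsq : ∀ x v, j x (j x v) = -v)
    (hj : ContDiffAt ℝ ∞ (tangentEndModel I j x₀) (extChartAt I x₀ x₀)) (a b : E × (E →L[ℝ] ℝ)) :
    (genFibre E).nijenhuis
      (endModel I (fun x => genOfTangentEnd I (j x)) x₀ (extChartAt I x₀ x₀))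
      (fderiv ℝ (endModel I (fun x => genOfTangentEnd I (j x)) x₀) (extChartAt I x₀ x₀)) a b
      = 0 := by
  have ht := extChartAt_target_mem_nhds (I := I) x₀
  refine nijenhuis_surface hE (ContinuousLinearMap.snd ℝ E (E →L[ℝ] ℝ)) (fun a b => rfl)
    (hj.differentiableAt (by simp))
    ((contDiffAt_endModel_genOfTangentEnd hj).differentiableAt (by simp)) ?_ ?_ ?_
    (fun w x => rfl) (fun w x v => rfl) a b
  · filter_upwards [ht] with w hw using tangentEndModel_sq hsq hw
  · filter_upwards [ht] with w hw using endModel_sq (fun x => genOfTangentEnd_sq (hsq x)) hw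
  · filter_upwards [ht] with w hw a b
      using endModel_orth (fun x => genOfTangentEnd_orth (hsq x)) hw a b

end TangentEnd

/-! ### The sphere -/

section Sphere

/-- `crossLeft` as a linear map in both arguments. -/
def crossL : EuclideanSpace ℝ (Fin 3) →L[ℝ] EuclideanSpace ℝ (Fin 3) →L[ℝ]
    EuclideanSpace ℝ (Fin 3) :=
  LinearMap.toContinuousLinearMap
    { toFun := crossLeft
      map_add' := fun a b => by ext v i; simp [crossLeft]
      map_smul' := fun r a => by ext v i; simp [crossLeft] }

theorem inner_sphereIncl (n : S2) (v : TangentSpace (𝓡 2) n) :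
    inner ℝ (n : EuclideanSpace ℝ (Fin 3)) (sphereIncl n v) = 0 := by
  have hmem : sphereIncl n v ∈ (sphereIncl n).range := ⟨v, rfl⟩
  rwa [range_sphereIncl, Submodule.mem_orthogonal_singleton_iff_inner_right] at hmem

theorem S2.sq_sum (n : S2) : (n : EuclideanSpace ℝ (Fin 3)) 0 ^ 2
    + (n : EuclideanSpace ℝ (Fin 3)) 1 ^ 2 + (n : EuclideanSpace ℝ (Fin 3)) 2 ^ 2 = 1 := by
  have h := n.2
  rw [mem_sphere_zero_iff_norm, EuclideanSpace.norm_eq, Real.sqrt_eq_one] at h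
  simpa [Fin.sum_univ_three] using h

theorem sphereIncl_dot (n : S2) (v : TangentSpace (𝓡 2) n) :
    (n : EuclideanSpace ℝ (Fin 3)) 0 * sphereIncl n v 0
      + (n : EuclideanSpace ℝ (Fin 3)) 1 * sphereIncl n v 1
      + (n : EuclideanSpace ℝ (Fin 3)) 2 * sphereIncl n v 2 = 0 := by
  have h := inner_sphereIncl n v
  rw [PiLp.inner_apply, Fin.sum_univ_three] at h
  simp at h
  linarith

/-- In ℝ³, n × (n × w) = (n·w) n − |n|² w, with |n| = 1 and n·w = 0. -/
theorem sphereComplexStructure_sq (n : S2) (v : TangentSpace (𝓡 2) n) :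
    sphereComplexStructure n (sphereComplexStructure n v) = -v := by
  apply sphereIncl_injective
  rw [sphereComplexStructure_spec, sphereComplexStructure_spec, map_neg]
  have h1 := S2.sq_sum n
  have h2 := sphereIncl_dot n v
  generalize sphereIncl n v = w at *
  generalize (n : EuclideanSpace ℝ (Fin 3)) = m at *
  ext i
  fin_cases i <;> simp [crossLeft, cross_apply]
  · linear_combination m 0 * h2 - w 0 * h1
  · linear_combination m 1 * h2 - w 1 * h1
  · linear_combination m 2 * h2 - w 2 * h1

/-- The inclusion of the sphere read in a chart. -/
def sphereModel (s : S2) (u : EuclideanSpace ℝ (Fin 2)) : EuclideanSpace ℝ (Fin 3) :=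
  ((extChartAt (𝓡 2) s).symm u : S2)

theorem contDiffAt_sphereModel (s : S2) :
    ContDiffAt ℝ ∞ (sphereModel s) (extChartAt (𝓡 2) s s) :=
  haveI := Fact.mk (@finrank_euclideanSpace_fin ℝ _ (2 + 1))
  contMDiffAt_iff_model.1 (contMDiff_coe_sphere (E := EuclideanSpace ℝ (Fin 3)) (m := ∞) s)

theorem fderiv_sphereModel {s : S2} {u : EuclideanSpace ℝ (Fin 2)}
    (hu : u ∈ (extChartAt (𝓡 2) s).target) (v : EuclideanSpace ℝ (Fin 2)) :
    fderiv ℝ (sphereModel s) u v = sphereIncl ((extChartAt (𝓡 2) s).symm u)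
      (tangentFrom (𝓡 2) s ((extChartAt (𝓡 2) s).symm u) v) := by
  have := Fact.mk (@finrank_euclideanSpace_fin ℝ _ (2 + 1))
  have h1 : MDifferentiableAt (𝓡 2) 𝓘(ℝ, EuclideanSpace ℝ (Fin 3))
      (fun m : S2 => (m : EuclideanSpace ℝ (Fin 3))) ((extChartAt (𝓡 2) s).symm u) :=
    (contMDiff_coe_sphere (m := 1) _).mdifferentiableAt one_ne_zero
  have h2 : MDifferentiableWithinAt 𝓘(ℝ, EuclideanSpace ℝ (Fin 2)) (𝓡 2)
      (extChartAt (𝓡 2) s).symm (Set.range (𝓡 2)) u := mdifferentiableWithinAt_extChartAt_symm hu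
  rw [(𝓡 2).range_eq_univ, mdifferentiableWithinAt_univ] at h2
  have h3 := mfderiv_comp u h1 h2
  have h4 : mfderiv 𝓘(ℝ, EuclideanSpace ℝ (Fin 2)) 𝓘(ℝ, EuclideanSpace ℝ (Fin 3))
      (sphereModel s) u = fderiv ℝ (sphereModel s) u := mfderiv_eq_fderiv
  rw [tangentFrom_eq (symm_mem_source hu), (extChartAt (𝓡 2) s).right_inv hu,
    (𝓡 2).range_eq_univ, mfderivWithin_univ]
  exact DFunLike.congr_fun (h4.symm.trans h3) v

/-- The coordinate form of v ↦ n × v. It gives both the smoothness of the complex structure and the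
holomorphy of the family K. -/
theorem fderiv_sphereModel_complexStructure {s : S2} {u : EuclideanSpace ℝ (Fin 2)}
    (hu : u ∈ (extChartAt (𝓡 2) s).target) (v : EuclideanSpace ℝ (Fin 2)) :
    fderiv ℝ (sphereModel s) u (tangentEndModel (𝓡 2) sphereComplexStructure s u v)
      = crossLeft (sphereModel s u) (fderiv ℝ (sphereModel s) u v) := by
  rw [fderiv_sphereModel hu, fderiv_sphereModel hu, tangentEndModel, ContinuousLinearMap.comp_apply,
    tangentFrom_to (symm_mem_source hu), ContinuousLinearMap.comp_apply,
    sphereComplexStructure_spec]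
  rfl

/-- The structure j is only chosen pointwise, so its smoothness has to come from the equation that
it solves. With ι the inclusion and G a fixed left inverse of Dι at the centre, (G Dι_u) j_u = G(n ×
Dι_u), where the first factor is the identity at the centre. -/
theorem contDiffAt_sphereComplexStructure (s : S2) :
    ContDiffAt ℝ ∞ (tangentEndModel (𝓡 2) sphereComplexStructure s) (extChartAt (𝓡 2) s s) := by
  set u₀ := extChartAt (𝓡 2) s s with hu₀
  have ht := extChartAt_target_mem_nhds (I := 𝓡 2) s
  have ht0 : u₀ ∈ (extChartAt (𝓡 2) s).target := mem_extChartAt_target s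
  have hn := contDiffAt_sphereModel s
  have hd : ContDiffAt ℝ ∞ (fderiv ℝ (sphereModel s)) u₀ := hn.fderiv_right (by simp)
  have inj : Function.Injective (fderiv ℝ (sphereModel s) u₀) := by
    intro v w h
    rw [fderiv_sphereModel ht0, fderiv_sphereModel ht0] at h
    have h2 := congrArg (tangentTo (𝓡 2) s ((extChartAt (𝓡 2) s).symm u₀))
      (sphereIncl_injective _ h)
    rwa [tangentTo_from (symm_mem_source ht0), tangentTo_from (symm_mem_source ht0)] at h2
  obtain ⟨g, hg⟩ := LinearMap.exists_leftInverse_of_injective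
    (fderiv ℝ (sphereModel s) u₀ : EuclideanSpace ℝ (Fin 2) →ₗ[ℝ] EuclideanSpace ℝ (Fin 3))
    (LinearMap.ker_eq_bot.2 inj)
  let G : EuclideanSpace ℝ (Fin 3) →L[ℝ] EuclideanSpace ℝ (Fin 2) := g.toContinuousLinearMap
  have hP : ContDiffAt ℝ ∞ (fun u => G.comp (fderiv ℝ (sphereModel s) u)) u₀ :=
    contDiffAt_const.clm_comp hd
  have hP0 : G.comp (fderiv ℝ (sphereModel s) u₀) = 1 :=
    ContinuousLinearMap.ext fun v => LinearMap.congr_fun hg v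
  have hC : ContDiffAt ℝ ∞ (fun u => crossL (sphereModel s u)) u₀ :=
    crossL.contDiff.contDiffAt.comp u₀ hn
  have hQ : ContDiffAt ℝ ∞ (fun u => G.comp ((crossL (sphereModel s u)).comp
      (fderiv ℝ (sphereModel s) u))) u₀ := contDiffAt_const.clm_comp (hC.clm_comp hd)
  refine contDiffAt_of_mul_eq hP hP0 hQ ?_
  filter_upwards [ht] with u hu
  refine ContinuousLinearMap.ext fun v => ?_
  exact congrArg G (fderiv_sphereModel_complexStructure hu v)

end Sphere

/-! ### The generalized tangent bundle of a product in a chart -/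

section GenSum

variable (V₁ V₂ : Type*) [NormedAddCommGroup V₁] [NormedSpace ℝ V₁]
  [NormedAddCommGroup V₂] [NormedSpace ℝ V₂]

/-- The map `V ⊕ V^* → V' ⊕ V'^*` induced by `f : V → V'` and `g : V' → V`. -/
def genMap {V V' : Type*} [NormedAddCommGroup V] [NormedSpace ℝ V] [NormedAddCommGroup V']
    [NormedSpace ℝ V'] (f : V →L[ℝ] V') (g : V' →L[ℝ] V) :
    V × (V →L[ℝ] ℝ) →L[ℝ] V' × (V' →L[ℝ] ℝ) :=
  f.prodMap (ContinuousLinearMap.precomp ℝ g)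

theorem genMap_apply {V V' : Type*} [NormedAddCommGroup V] [NormedSpace ℝ V]
    [NormedAddCommGroup V'] [NormedSpace ℝ V'] (f : V →L[ℝ] V') (g : V' →L[ℝ] V)
    (a : V × (V →L[ℝ] ℝ)) : genMap f g a = (f a.1, a.2.comp g) := rfl

/-- `(V₁ × V₂) ⊕ (V₁ × V₂)^* = (V₁ ⊕ V₁^*) ⊕ (V₂ ⊕ V₂^*)`. -/
def genSum : CourantSum (genFibre (V₁ × V₂)) (genFibre V₁) (genFibre V₂) where
  inl := genMap (ContinuousLinearMap.inl ℝ V₁ V₂) (ContinuousLinearMap.fst ℝ V₁ V₂)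
  inr := genMap (ContinuousLinearMap.inr ℝ V₁ V₂) (ContinuousLinearMap.snd ℝ V₁ V₂)
  fst := genMap (ContinuousLinearMap.fst ℝ V₁ V₂) (ContinuousLinearMap.inl ℝ V₁ V₂)
  snd := genMap (ContinuousLinearMap.snd ℝ V₁ V₂) (ContinuousLinearMap.inr ℝ V₁ V₂)
  pair_inl a x := by
    simp only [genFibre_pair, genMap_apply]
    rfl
  pair_inr a x := by
    simp only [genFibre_pair, genMap_apply]
    rfl
  anchor_fst a := rfl
  anchor_snd a := rfl
  fst_inl x := rfl
  snd_inr x := rfl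
  fst_inr x := by
    refine Prod.ext rfl ?_
    ext v
    exact map_zero x.2
  snd_inl x := by
    refine Prod.ext rfl ?_
    ext v
    exact map_zero x.2
  inl_fst_add a := by
    refine Prod.ext (by simp [genMap_apply]) ?_
    refine ContinuousLinearMap.ext fun v => ?_
    change a.2 (v.1, 0) + a.2 (0, v.2) = a.2 v
    rw [← map_add, Prod.mk_add_mk, add_zero, zero_add]

end GenSum

/-! ### Product charts and direct sums of endomorphisms -/

section ProductChart

variable {E : Type*} [NormedAddCommGroup E] [NormedSpace ℝ E]
  {H : Type*} [TopologicalSpace H] {I : ModelWithCorners ℝ E H}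
  {M : Type*} [TopologicalSpace M] [ChartedSpace H M] [IsManifold I 1 M]
  {E' : Type*} [NormedAddCommGroup E'] [NormedSpace ℝ E']
  {H' : Type*} [TopologicalSpace H'] {I' : ModelWithCorners ℝ E' H'}
  {N : Type*} [TopologicalSpace N] [ChartedSpace H' N] [IsManifold I' 1 N]

theorem tangentTo_prod {z₀ z : M × N} (hz : z ∈ (chartAt (ModelProd H H') z₀).source)
    (v : TangentSpace (I.prod I') z) :
    tangentTo (I.prod I') z₀ z v = (tangentTo I z₀.1 z.1 (prodTangentEquiv I I' z v).1,
      tangentTo I' z₀.2 z.2 (prodTangentEquiv I I' z v).2) := by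
  have hz' : z.1 ∈ (chartAt H z₀.1).source ∧ z.2 ∈ (chartAt H' z₀.2).source := by
    simpa [prodChartedSpace_chartAt] using hz
  have h1 : MDifferentiableAt I 𝓘(ℝ, E) (extChartAt I z₀.1) z.1 :=
    mdifferentiableAt_extChartAt hz'.1
  have h2 : MDifferentiableAt I' 𝓘(ℝ, E') (extChartAt I' z₀.2) z.2 :=
    mdifferentiableAt_extChartAt hz'.2
  rw [tangentTo_eq hz, tangentTo_eq hz'.1, tangentTo_eq hz'.2, extChartAt_prod]
  have h3 := (h1.hasMFDerivAt.prodMap h2.hasMFDerivAt).mfderiv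
  -- The target `E × E'` must be viewed with the product model and product charted structure for the
  -- derivative of the product map to apply.
  rw [modelWithCornersSelf_prod, ← chartedSpaceSelf_prod] 
  exact DFunLike.congr_fun h3 v

theorem tangentFrom_prod {z₀ z : M × N} (hz : z ∈ (chartAt (ModelProd H H') z₀).source)
    (v : E × E') :
    prodTangentEquiv I I' z (tangentFrom (I.prod I') z₀ z v)
      = (tangentFrom I z₀.1 z.1 v.1, tangentFrom I' z₀.2 z.2 v.2) := by
  have hz' : z.1 ∈ (chartAt H z₀.1).source ∧ z.2 ∈ (chartAt H' z₀.2).source := by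
    simpa [prodChartedSpace_chartAt] using hz
  have h := tangentTo_prod hz ((prodTangentEquiv I I' z).symm
    (tangentFrom I z₀.1 z.1 v.1, tangentFrom I' z₀.2 z.2 v.2))
  rw [ContinuousLinearEquiv.apply_symm_apply, tangentTo_from hz'.1, tangentTo_from hz'.2] at h
  have h' := congrArg (tangentFrom (I.prod I') z₀ z) h
  rw [tangentFrom_to hz] at h'
  exact (congrArg (prodTangentEquiv I I' z) h'.symm).trans
    (ContinuousLinearEquiv.apply_symm_apply _ _)

theorem genTo_genDirectSum {z₀ z : M × N} (hz : z ∈ (chartAt (ModelProd H H') z₀).source)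
    (P : Module.End ℝ (GenTangent I z.1)) (Q : Module.End ℝ (GenTangent I' z.2))
    (a : (E × E') × (E × E' →L[ℝ] ℝ)) :
    genTo (I.prod I') z₀ z (genDirectSum I I' z P Q (genFrom (I.prod I') z₀ z a))
      = (genSum E E').inl (genTo I z₀.1 z.1 (P (genFrom I z₀.1 z.1 ((genSum E E').fst a))))
        + (genSum E E').inr (genTo I' z₀.2 z.2
          (Q (genFrom I' z₀.2 z.2 ((genSum E E').snd a)))) := by
  set p := P (genFrom I z₀.1 z.1 ((genSum E E').fst a)) with hp
  set q := Q (genFrom I' z₀.2 z.2 ((genSum E E').snd a)) with hq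
  have hP : p = P ((prodTangentEquiv I I' z (tangentFrom (I.prod I') z₀ z a.1)).1,
      (a.2.comp (tangentTo (I.prod I') z₀ z)).comp
        ((prodTangentEquiv I I' z).symm.toContinuousLinearMap.comp
          (ContinuousLinearMap.inl ℝ _ _))) := by
    rw [hp]
    refine congrArg P (Prod.ext ?_ (ContinuousLinearMap.ext fun v => ?_))
    · rw [tangentFrom_prod hz]
      rfl
    · refine congrArg a.2 (Eq.trans ?_ (tangentTo_prod hz ((prodTangentEquiv I I' z).symm
        (ContinuousLinearMap.inl ℝ _ _ v))).symm)
      rw [ContinuousLinearEquiv.apply_symm_apply]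
      exact Prod.ext rfl (map_zero _).symm
  have hQ : q = Q ((prodTangentEquiv I I' z (tangentFrom (I.prod I') z₀ z a.1)).2,
      (a.2.comp (tangentTo (I.prod I') z₀ z)).comp
        ((prodTangentEquiv I I' z).symm.toContinuousLinearMap.comp
          (ContinuousLinearMap.inr ℝ _ _))) := by
    rw [hq]
    refine congrArg Q (Prod.ext ?_ (ContinuousLinearMap.ext fun v => ?_))
    · rw [tangentFrom_prod hz]
      rfl
    · refine congrArg a.2 (Eq.trans ?_ (tangentTo_prod hz ((prodTangentEquiv I I' z).symm
        (ContinuousLinearMap.inr ℝ _ _ v))).symm)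
      rw [ContinuousLinearEquiv.apply_symm_apply]
      exact Prod.ext (map_zero _).symm rfl
  have hD : genDirectSum I I' z P Q (genFrom (I.prod I') z₀ z a)
      = ((prodTangentEquiv I I' z).symm (p.1, 0) + (prodTangentEquiv I I' z).symm (0, q.1),
        p.2.comp ((ContinuousLinearMap.fst ℝ _ _).comp
            (prodTangentEquiv I I' z).toContinuousLinearMap)
          + q.2.comp ((ContinuousLinearMap.snd ℝ _ _).comp
            (prodTangentEquiv I I' z).toContinuousLinearMap)) := by
    rw [hP, hQ]
    rfl
  rw [hD]
  refine Prod.ext ?_ (ContinuousLinearMap.ext fun v => ?_)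
  · refine (tangentTo_prod hz _).trans ?_
    rw [← map_add, ContinuousLinearEquiv.apply_symm_apply, Prod.mk_add_mk, add_zero, zero_add]
    refine Prod.ext ?_ ?_
    · exact (add_zero _).symm
    · exact (zero_add _).symm
  · have h := tangentFrom_prod (I := I) (I' := I') hz v
    change p.2 (prodTangentEquiv I I' z (tangentFrom (I.prod I') z₀ z v)).1
      + q.2 (prodTangentEquiv I I' z (tangentFrom (I.prod I') z₀ z v)).2 = _
    rw [h]
    rfl

variable [FiniteDimensional ℝ E] [FiniteDimensional ℝ E']

/-- `P` may vary along `N` as well, as K does along the spheres, so it is read in the chart of `M`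
with the point of `N` frozen. -/
theorem endModel_genDirectSum {P : ∀ z : M × N, Module.End ℝ (GenTangent I z.1)}
    {Q : ∀ y : N, Module.End ℝ (GenTangent I' y)} {z₀ : M × N} {u : E × E'}
    (hu : u ∈ (extChartAt (I.prod I') z₀).target) :
    endModel (I.prod I') (fun z => genDirectSum I I' z (P z) (Q z.2)) z₀ u
      = (genSum E E').dsum
        (endModel I (fun x => P (x, (extChartAt I' z₀.2).symm u.2)) z₀.1 u.1)
        (endModel I' Q z₀.2 u.2) := by
  have hs := symm_mem_source hu
  refine ContinuousLinearMap.ext fun a => ?_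
  exact genTo_genDirectSum hs _ _ a

omit [IsManifold I 1 M] [IsManifold I' 1 N] [FiniteDimensional ℝ E] [FiniteDimensional ℝ E']

theorem genDirectSum_sq {z : M × N} {P : Module.End ℝ (GenTangent I z.1)}
    {Q : Module.End ℝ (GenTangent I' z.2)} (hP : P * P = -1) (hQ : Q * Q = -1) :
    genDirectSum I I' z P Q * genDirectSum I I' z P Q = -1 := by
  refine LinearMap.ext fun a => ?_
  exact (genSum E E').sum_sq (P := P) (Q := Q) (fun x => LinearMap.congr_fun hP x)
    (fun x => LinearMap.congr_fun hQ x) a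

theorem genPairing_eq {x : M} (a b : GenTangent I x) :
    genPairing I a b = (1 / 2) * (genFibre E).pair a b :=
  congrArg ((1 / 2 : ℝ) * ·) (genFibre_pair (V := E) a b).symm

theorem genPairing_eq_iff {x : M} (a b a' b' : GenTangent I x) :
    genPairing I a b = genPairing I a' b' ↔ (genFibre E).pair a b = (genFibre E).pair a' b' := by
  rw [genPairing_eq, genPairing_eq]
  exact mul_right_inj' (by norm_num)

theorem genDirectSum_orth {z : M × N} {P : Module.End ℝ (GenTangent I z.1)}
    {Q : Module.End ℝ (GenTangent I' z.2)}
    (hP : ∀ a b, genPairing I (P a) (P b) = genPairing I a b)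
    (hQ : ∀ a b, genPairing I' (Q a) (Q b) = genPairing I' a b)
    (a b : GenTangent (I.prod I') z) :
    genPairing (I.prod I') (genDirectSum I I' z P Q a) (genDirectSum I I' z P Q b)
      = genPairing (I.prod I') a b := by
  rw [genPairing_eq_iff]
  exact (genSum E E').sum_orth (P := P) (Q := Q)
    (fun x y => (genPairing_eq_iff (P y) (P x) y x).1 (hP y x))
    (fun x y => (genPairing_eq_iff (Q y) (Q x) y x).1 (hQ y x)) b a

end ProductChart

/-! ### Integrability over a product manifold -/

theorem fderiv_comp_fst_apply {V V' W : Type*} [NormedAddCommGroup V] [NormedSpace ℝ V]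
    [NormedAddCommGroup V'] [NormedSpace ℝ V'] [NormedAddCommGroup W] [NormedSpace ℝ W]
    {f : V → W} {u : V × V'} (hf : DifferentiableAt ℝ f u.1) (w : V') :
    fderiv ℝ (fun v : V × V' => f v.1) u (0, w) = 0 := by
  have h := (HasFDerivAt.comp (g := f) (f := Prod.fst) u hf.hasFDerivAt
    (hasFDerivAt_fst (𝕜 := ℝ))).fderiv
  exact (DFunLike.congr_fun h (0, w)).trans (map_zero (fderiv ℝ f u.1))

/-- A family independent of the parameter is trivially holomorphic: both sides vanish, whatever `w`
and `w'` are. -/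
theorem fderiv_comp_fst_twist {V V' W : Type*} [NormedAddCommGroup V] [NormedSpace ℝ V]
    [NormedAddCommGroup V'] [NormedSpace ℝ V'] [NormedAddCommGroup W] [NormedSpace ℝ W]
    {f : V → W →L[ℝ] W} {u : V × V'} (hf : DifferentiableAt ℝ f u.1) (w w' : V') (y : W) :
    fderiv ℝ (fun v : V × V' => f v.1) u (0, w) y
      = f u.1 (fderiv ℝ (fun v : V × V' => f v.1) u (0, w') y) := by
  rw [fderiv_comp_fst_apply hf, fderiv_comp_fst_apply hf, zero_apply, map_zero]

theorem fderiv_prodMk_apply {V V' W : Type*} [NormedAddCommGroup V] [NormedSpace ℝ V]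
    [NormedAddCommGroup V'] [NormedSpace ℝ V'] [NormedAddCommGroup W] [NormedSpace ℝ W]
    {f : V × V' → W} {u : V × V'} (hf : DifferentiableAt ℝ f u) (w : V') :
    fderiv ℝ f u (0, w) = fderiv ℝ (fun v => f (u.1, v)) u.2 w := by
  have h := (HasFDerivAt.comp (g := f) (f := fun v => (u.1, v)) u.2 hf.hasFDerivAt
    ((hasFDerivAt_const u.1 u.2).prodMk (hasFDerivAt_id u.2))).fderiv
  exact (DFunLike.congr_fun h w).symm

section ProductIntegrability

variable {E : Type*} [NormedAddCommGroup E] [NormedSpace ℝ E] [FiniteDimensional ℝ E]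
  {H : Type*} [TopologicalSpace H] {I : ModelWithCorners ℝ E H} [I.Boundaryless]
  {M : Type*} [TopologicalSpace M] [ChartedSpace H M] [IsManifold I 1 M]
  {E' : Type*} [NormedAddCommGroup E'] [NormedSpace ℝ E'] [FiniteDimensional ℝ E']
  {H' : Type*} [TopologicalSpace H'] {I' : ModelWithCorners ℝ E' H'} [I'.Boundaryless]
  {N : Type*} [TopologicalSpace N] [ChartedSpace H' N] [IsManifold I' 1 N]

/-- The global form of `nijenhuis_dsum`: a family of structures on `M` parametrised by `N` combines
with a structure on `N` when it is smooth, integrable on each slice (`int`) and holomorphic in the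
parameter (`twist`). `F` is any formula for the family in product coordinates; it needs to agree
with the family only over the chart targets. -/
theorem isGenComplex_genDirectSum [T2Space N] [IsManifold I' ∞ N]
    {P : ∀ z : M × N, Module.End ℝ (GenTangent I z.1)}
    {Q : ∀ y : N, Module.End ℝ (GenTangent I' y)} (Psq : ∀ z, P z * P z = -1)
    (Porth : ∀ (z : M × N) (a b : GenTangent I z.1),
      genPairing I (P z a) (P z b) = genPairing I a b)
    (hQ : IsGenComplex I' Q)
    (F : M × N → E × E' → E × (E →L[ℝ] ℝ) →L[ℝ] E × (E →L[ℝ] ℝ))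
    (hF : ∀ z₀ u, u.1 ∈ (extChartAt I z₀.1).target → u.2 ∈ (extChartAt I' z₀.2).target →
      endModel I (fun x => P (x, (extChartAt I' z₀.2).symm u.2)) z₀.1 u.1 = F z₀ u)
    (smooth : ∀ z₀, ContDiffAt ℝ ∞ (F z₀) (extChartAt I z₀.1 z₀.1, extChartAt I' z₀.2 z₀.2))
    (int : ∀ z₀ x y, (genFibre E).nijenhuis
      (F z₀ (extChartAt I z₀.1 z₀.1, extChartAt I' z₀.2 z₀.2))
      (fderiv ℝ (fun v => F z₀ (v, extChartAt I' z₀.2 z₀.2)) (extChartAt I z₀.1 z₀.1)) x y = 0)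
    (twist : ∀ z₀ x y,
      fderiv ℝ (F z₀) (extChartAt I z₀.1 z₀.1, extChartAt I' z₀.2 z₀.2)
          (0, (endModel I' Q z₀.2 (extChartAt I' z₀.2 z₀.2) x).1) y
        = F z₀ (extChartAt I z₀.1 z₀.1, extChartAt I' z₀.2 z₀.2)
          (fderiv ℝ (F z₀) (extChartAt I z₀.1 z₀.1, extChartAt I' z₀.2 z₀.2) (0, x.1) y)) :
    IsGenComplex (I.prod I') (fun z : M × N => genDirectSum I I' z (P z) (Q z.2)) := by
  have sq : ∀ z, genDirectSum I I' z (P z) (Q z.2) * genDirectSum I I' z (P z) (Q z.2) = -1 :=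
    fun z => genDirectSum_sq (Psq z) (hQ.almost.sq z.2)
  have orth : ∀ z a b, genPairing (I.prod I') (genDirectSum I I' z (P z) (Q z.2) a)
      (genDirectSum I I' z (P z) (Q z.2) b) = genPairing (I.prod I') a b :=
    fun z => genDirectSum_orth (Porth z) (hQ.almost.orthogonal z.2)
  have t1 : ∀ z₀ : M × N, ∀ᶠ u in nhds (extChartAt I z₀.1 z₀.1, extChartAt I' z₀.2 z₀.2),
      u.1 ∈ (extChartAt I z₀.1).target := fun z₀ =>
    continuous_fst.continuousAt.eventually (extChartAt_target_mem_nhds (I := I) z₀.1)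
  have t2 : ∀ z₀ : M × N, ∀ᶠ u in nhds (extChartAt I z₀.1 z₀.1, extChartAt I' z₀.2 z₀.2),
      u.2 ∈ (extChartAt I' z₀.2).target := fun z₀ =>
    continuous_snd.continuousAt.eventually (extChartAt_target_mem_nhds (I := I') z₀.2)
  have chart : ∀ z₀ : M × N, extChartAt (I.prod I') z₀ z₀
      = (extChartAt I z₀.1 z₀.1, extChartAt I' z₀.2 z₀.2) := fun z₀ => by
    rw [extChartAt_prod]; rfl
  have model : ∀ z₀ : M × N,
      endModel (I.prod I') (fun z : M × N => genDirectSum I I' z (P z) (Q z.2)) z₀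
      =ᶠ[nhds (extChartAt I z₀.1 z₀.1, extChartAt I' z₀.2 z₀.2)]
        fun u => (genSum E E').dsum (F z₀ u) (endModel I' Q z₀.2 u.2) := by
    intro z₀
    filter_upwards [t1 z₀, t2 z₀] with u h1 h2
    rw [endModel_genDirectSum (by rw [extChartAt_prod]; exact ⟨h1, h2⟩), hF z₀ u h1 h2]
  have hQd : ∀ y₀, ContDiffAt ℝ ∞ (endModel I' Q y₀) (extChartAt I' y₀ y₀) :=
    contDiffAt_endModel hQ.almost.smooth
  have hdiff : ∀ z₀ : M × N, ContDiffAt ℝ ∞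
      (endModel (I.prod I') (fun z : M × N => genDirectSum I I' z (P z) (Q z.2)) z₀)
      (extChartAt (I.prod I') z₀ z₀) := by
    intro z₀
    rw [chart]
    refine ContDiffAt.congr_of_eventuallyEq ?_ (model z₀)
    refine CourantSum.contDiffAt_dsum _ (smooth z₀) ?_
    exact ContDiffAt.comp (g := endModel I' Q z₀.2) (f := Prod.snd) _ (hQd z₀.2) contDiffAt_snd
  refine ⟨⟨fun A hA => smooth_of_endModel hdiff hA, orth, sq⟩,
    integrable_of_endModel sq orth (fun z₀ => (hdiff z₀).differentiableAt (by simp)) ?_⟩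
  intro z₀ a b
  rw [chart, (model z₀).fderiv_eq, (model z₀).self_of_nhds]
  refine (genSum E E').nijenhuis_dsum ((smooth z₀).differentiableAt (by simp))
    ((hQd z₀.2).differentiableAt (by simp)) ?_ ?_ ?_ ?_ (int z₀)
    (nijenhuis_endModel hQ.almost hQ.integrable z₀.2) (twist z₀) a b
  · filter_upwards [t1 z₀, t2 z₀] with u h1 h2
    rw [← hF z₀ u h1 h2]
    exact endModel_sq (fun x => Psq _) h1
  · filter_upwards [t1 z₀, t2 z₀] with u h1 h2
    rw [← hF z₀ u h1 h2]
    exact endModel_orth (J := fun x => P (x, (extChartAt I' z₀.2).symm u.2)) (fun x => Porth _) h1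
  · filter_upwards [extChartAt_target_mem_nhds (I := I') z₀.2] with u hu
      using endModel_sq hQ.almost.sq hu
  · filter_upwards [extChartAt_target_mem_nhds (I := I') z₀.2] with u hu
      using endModel_orth hQ.almost.orthogonal hu

/-- A direct sum of generalized complex structures is a generalized complex structure. -/
theorem IsGenComplex.prod [T2Space M] [IsManifold I ∞ M] [T2Space N] [IsManifold I' ∞ N]
    {P : ∀ x : M, Module.End ℝ (GenTangent I x)} {Q : ∀ y : N, Module.End ℝ (GenTangent I' y)}
    (hP : IsGenComplex I P) (hQ : IsGenComplex I' Q) :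
    IsGenComplex (I.prod I') (fun z : M × N => genDirectSum I I' z (P z.1) (Q z.2)) := by
  have hPd : ∀ x₀, ContDiffAt ℝ ∞ (endModel I P x₀) (extChartAt I x₀ x₀) :=
    contDiffAt_endModel hP.almost.smooth
  have hF : ∀ z₀ : M × N, ContDiffAt ℝ ∞ (fun u : E × E' => endModel I P z₀.1 u.1)
      (extChartAt I z₀.1 z₀.1, extChartAt I' z₀.2 z₀.2) := fun z₀ =>
    ContDiffAt.comp (g := endModel I P z₀.1) (f := Prod.fst) _ (hPd z₀.1) contDiffAt_fst
  refine isGenComplex_genDirectSum (P := fun z => P z.1) (fun z => hP.almost.sq z.1)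
    (fun z => hP.almost.orthogonal z.1) hQ (fun z₀ u => endModel I P z₀.1 u.1)
    (fun z₀ u _ _ => rfl) hF (fun z₀ => nijenhuis_endModel hP.almost hP.integrable z₀.1) ?_
  intro z₀ x y
  exact fderiv_comp_fst_twist (u := (extChartAt I z₀.1 z₀.1, extChartAt I' z₀.2 z₀.2))
    ((hPd z₀.1).differentiableAt (by simp)) _ _ y

end ProductIntegrability

/-! ### The family of square roots of `-1` and its derivatives -/

section QuatFamily

variable {A : Type*} [NormedRing A] [NormedAlgebra ℝ A]

theorem map_quatComb {A B : Type*} [Ring A] [Algebra ℝ A] [Ring B] [Algebra ℝ B] (ρ : A →ₐ[ℝ] B)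
    (P : Fin 3 → A) (a b : Fin 3 → ℝ) :
    ρ (quatComb P a b) = quatComb (fun i => ρ (P i)) a b := by
  simp [quatComb]

theorem IsCliffordTriple.map_end {G W : Type*} [AddCommGroup G] [Module ℝ G]
    [NormedAddCommGroup W] [NormedSpace ℝ W] {P : Fin 3 → Module.End ℝ G}
    (h : IsCliffordTriple P) (ρ : Module.End ℝ G →ₐ[ℝ] (W →L[ℝ] W)) :
    IsCliffordTriple fun i => ρ (P i) := by
  intro i j
  rw [← map_mul, ← map_mul, ← map_add, h i j, map_smul, map_one]

/-- `quatComb` as a linear map of its coefficients. -/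
def quatCombL (P : Fin 3 → A) :
    EuclideanSpace ℝ (Fin 3) × EuclideanSpace ℝ (Fin 3) →L[ℝ] A :=
  LinearMap.toContinuousLinearMap
    { toFun := fun a => quatComb P a.1 a.2
      map_add' := fun a b => by
        simp only [quatComb_eq, Prod.fst_add, Prod.snd_add, PiLp.add_apply]
        module
      map_smul' := fun r a => by
        simp only [quatComb_eq, Prod.smul_fst, Prod.smul_snd, PiLp.smul_apply, smul_eq_mul,
          RingHom.id_apply]
        module }

variable {U : Type*} [NormedAddCommGroup U] [NormedSpace ℝ U]

theorem contDiffAt_quatComb {P : Fin 3 → U → A} {a b : U → Fin 3 → ℝ} {u : U} {n : ℕ∞ω}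
    (hP : ∀ i, ContDiffAt ℝ n (P i) u) (ha : ∀ i, ContDiffAt ℝ n (fun w => a w i) u)
    (hb : ∀ i, ContDiffAt ℝ n (fun w => b w i) u) :
    ContDiffAt ℝ n (fun w => quatComb (fun i => P i w) (a w) (b w)) u := by
  simp only [quatComb_eq]
  fun_prop

/-- The family is holomorphic: its derivative along `J w` is the product of the family with its
derivative along `w`. -/
theorem fderiv_quatComb_cross {V₁ V₂ : Type*} [NormedAddCommGroup V₁] [NormedSpace ℝ V₁]
    [NormedAddCommGroup V₂] [NormedSpace ℝ V₂] {P : Fin 3 → A} (hP : IsCliffordTriple P)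
    {n : V₁ → EuclideanSpace ℝ (Fin 3)} {m : V₂ → EuclideanSpace ℝ (Fin 3)} {u : V₁ × V₂}
    (hn : DifferentiableAt ℝ n u.1) (hm : DifferentiableAt ℝ m u.2)
    (n_orth : ∀ v, n u.1 0 * fderiv ℝ n u.1 v 0 + n u.1 1 * fderiv ℝ n u.1 v 1
      + n u.1 2 * fderiv ℝ n u.1 v 2 = 0)
    (m_orth : ∀ v, m u.2 0 * fderiv ℝ m u.2 v 0 + m u.2 1 * fderiv ℝ m u.2 v 1
      + m u.2 2 * fderiv ℝ m u.2 v 2 = 0)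
    {v w : V₁ × V₂} (h1 : fderiv ℝ n u.1 w.1 = crossLeft (n u.1) (fderiv ℝ n u.1 v.1))
    (h2 : fderiv ℝ m u.2 w.2 = crossLeft (m u.2) (fderiv ℝ m u.2 v.2)) :
    fderiv ℝ (fun s : V₁ × V₂ => quatComb P (n s.1) (m s.2)) u w
      = quatComb P (n u.1) (m u.2)
        * fderiv ℝ (fun s : V₁ × V₂ => quatComb P (n s.1) (m s.2)) u v := by
  have hd : HasFDerivAt (fun s : V₁ × V₂ => (n s.1, m s.2))
      (((fderiv ℝ n u.1).comp (ContinuousLinearMap.fst ℝ V₁ V₂)).prod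
        ((fderiv ℝ m u.2).comp (ContinuousLinearMap.snd ℝ V₁ V₂))) u :=
    (HasFDerivAt.comp (g := n) (f := Prod.fst) u hn.hasFDerivAt (hasFDerivAt_fst (𝕜 := ℝ))).prodMk
      (HasFDerivAt.comp (g := m) (f := Prod.snd) u hm.hasFDerivAt (hasFDerivAt_snd (𝕜 := ℝ)))
  have h := ((quatCombL P).hasFDerivAt.comp u hd).fderiv
  have h' : ∀ x, fderiv ℝ (fun s : V₁ × V₂ => quatComb P (n s.1) (m s.2)) u x
      = quatComb P (fderiv ℝ n u.1 x.1) (fderiv ℝ m u.2 x.2) := fun x => DFunLike.congr_fun h x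
  -- K is linear in (n, m), so its derivative is K at the tangent vectors; rotating these by the
  -- cross product is multiplying by K(n, m).
  rw [h', h', h1, h2, hP.quatComb_mul_of_orth (n_orth _) (m_orth _)]
  rfl

theorem contDiffAt_quatComb_prod {V V₁ V₂ : Type*} [NormedAddCommGroup V] [NormedSpace ℝ V]
    [NormedAddCommGroup V₁] [NormedSpace ℝ V₁] [NormedAddCommGroup V₂] [NormedSpace ℝ V₂]
    {P : Fin 3 → V → A} {n : V₁ → EuclideanSpace ℝ (Fin 3)} {m : V₂ → EuclideanSpace ℝ (Fin 3)}
    {u : V × (V₁ × V₂)} {k : ℕ∞ω} (hP : ∀ i, ContDiffAt ℝ k (P i) u.1)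
    (hn : ContDiffAt ℝ k n u.2.1) (hm : ContDiffAt ℝ k m u.2.2) :
    ContDiffAt ℝ k (fun w : V × (V₁ × V₂) =>
      quatComb (fun i => P i w.1) (n w.2.1) (m w.2.2)) u := by
  refine contDiffAt_quatComb (P := fun i (w : V × (V₁ × V₂)) => P i w.1) (fun i => ?_) ?_ ?_
  · exact ContDiffAt.comp (g := P i) (f := Prod.fst) u (hP i) contDiffAt_fst
  · exact contDiffAt_euclidean.1 (ContDiffAt.comp (g := n)
      (f := fun w : V × (V₁ × V₂) => w.2.1) u hn contDiffAt_snd.fst)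
  · exact contDiffAt_euclidean.1 (ContDiffAt.comp (g := m)
      (f := fun w : V × (V₁ × V₂) => w.2.2) u hm contDiffAt_snd.snd)

theorem fderiv_quatComb_prod_twist {V V₁ V₂ W : Type*} [NormedAddCommGroup V] [NormedSpace ℝ V]
    [NormedAddCommGroup V₁] [NormedSpace ℝ V₁] [NormedAddCommGroup V₂] [NormedSpace ℝ V₂]
    [NormedAddCommGroup W] [NormedSpace ℝ W]
    {P : Fin 3 → V → W →L[ℝ] W} {n : V₁ → EuclideanSpace ℝ (Fin 3)}
    {m : V₂ → EuclideanSpace ℝ (Fin 3)}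
    {u : V × (V₁ × V₂)} (hP : ∀ i, ContDiffAt ℝ 1 (P i) u.1)
    (hc : IsCliffordTriple fun i => P i u.1)
    (hn : ContDiffAt ℝ 1 n u.2.1) (hm : ContDiffAt ℝ 1 m u.2.2)
    (n_orth : ∀ v, n u.2.1 0 * fderiv ℝ n u.2.1 v 0 + n u.2.1 1 * fderiv ℝ n u.2.1 v 1
      + n u.2.1 2 * fderiv ℝ n u.2.1 v 2 = 0)
    (m_orth : ∀ v, m u.2.2 0 * fderiv ℝ m u.2.2 v 0 + m u.2.2 1 * fderiv ℝ m u.2.2 v 1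
      + m u.2.2 2 * fderiv ℝ m u.2.2 v 2 = 0)
    {v w : V₁ × V₂} (h1 : fderiv ℝ n u.2.1 w.1 = crossLeft (n u.2.1) (fderiv ℝ n u.2.1 v.1))
    (h2 : fderiv ℝ m u.2.2 w.2 = crossLeft (m u.2.2) (fderiv ℝ m u.2.2 v.2)) (y : W) :
    fderiv ℝ (fun s : V × (V₁ × V₂) => quatComb (fun i => P i s.1) (n s.2.1) (m s.2.2)) u (0, w) y
      = quatComb (fun i => P i u.1) (n u.2.1) (m u.2.2)
        (fderiv ℝ (fun s : V × (V₁ × V₂) =>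
          quatComb (fun i => P i s.1) (n s.2.1) (m s.2.2)) u (0, v) y) := by
  have hd := (contDiffAt_quatComb_prod hP hn hm).differentiableAt one_ne_zero
  rw [fderiv_prodMk_apply hd, fderiv_prodMk_apply hd]
  exact DFunLike.congr_fun (fderiv_quatComb_cross hc (hn.differentiableAt one_ne_zero)
    (hm.differentiableAt one_ne_zero) n_orth m_orth h1 h2) y

end QuatFamily

/-! ### The generalized complex structure on the twistor space -/

section EndHom

variable {E : Type*} [NormedAddCommGroup E] [NormedSpace ℝ E] [FiniteDimensional ℝ E]
  {H : Type*} [TopologicalSpace H] {I : ModelWithCorners ℝ E H}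
  {M : Type*} [TopologicalSpace M] [ChartedSpace H M] [IsManifold I 1 M]

/-- Endomorphisms of the fibre at `y`, read in the chart at `x₀`. -/
def endHom {x₀ y : M} (hy : y ∈ (chartAt H x₀).source) :
    Module.End ℝ (GenTangent I y) →ₐ[ℝ] (E × (E →L[ℝ] ℝ) →L[ℝ] E × (E →L[ℝ] ℝ)) :=
  AlgHom.ofLinearMap
    { toFun := fun P => LinearMap.toContinuousLinearMap (genTo I x₀ y ∘ₗ P ∘ₗ genFrom I x₀ y)
      map_add' := fun _ _ => ContinuousLinearMap.ext fun _ => map_add (genTo I x₀ y) _ _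
      map_smul' := fun _ _ => ContinuousLinearMap.ext fun _ => map_smul (genTo I x₀ y) _ _ }
    (ContinuousLinearMap.ext fun a => genTo_from hy a)
    (fun P _ => ContinuousLinearMap.ext fun _ =>
      congrArg (fun b => genTo I x₀ y (P b)) (genFrom_to hy _).symm)

theorem endHom_quatComb {x₀ y : M} (hy : y ∈ (chartAt H x₀).source)
    (P : Fin 3 → Module.End ℝ (GenTangent I y)) (a b : Fin 3 → ℝ) :
    endHom hy (quatComb P a b) = quatComb (fun i => endHom hy (P i)) a b :=
  map_quatComb (A := Module.End ℝ (GenTangent I y))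
    (B := E × (E →L[ℝ] ℝ) →L[ℝ] E × (E →L[ℝ] ℝ)) (endHom (I := I) hy) P a b

theorem isCliffordTriple_endHom {x₀ y : M} (hy : y ∈ (chartAt H x₀).source)
    {P : Fin 3 → Module.End ℝ (GenTangent I y)} (hP : IsCliffordTriple P) :
    IsCliffordTriple fun i => endHom hy (P i) := by
  have h := hP.map_end (endHom (I := I) hy)
  exact h

end EndHom

/-! ### The spherical factor and the assembly -/

section Twistor

theorem isGenComplex_sphere :
    IsGenComplex (𝓡 2) (fun n : S2 => genOfTangentEnd (𝓡 2) (sphereComplexStructure n)) := by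
  have sq := fun n : S2 => genOfTangentEnd_sq (sphereComplexStructure_sq n)
  have orth := fun n : S2 => genOfTangentEnd_orth (sphereComplexStructure_sq n)
  have hd := fun n : S2 => contDiffAt_endModel_genOfTangentEnd (contDiffAt_sphereComplexStructure n)
  exact ⟨⟨fun A hA => smooth_of_endModel hd hA, orth, sq⟩,
    integrable_of_endModel sq orth (fun n => (hd n).differentiableAt (by simp)) fun n =>
      nijenhuis_genOfTangentEnd (by simp) sphereComplexStructure_sq
        (contDiffAt_sphereComplexStructure n)⟩

end Twistor

section Twistor

theorem isGenComplex_sphereProdStructure :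
    IsGenComplex ((𝓡 2).prod (𝓡 2)) sphereProdStructure := by
  have h := isGenComplex_sphere.prod isGenComplex_sphere
  have e : sphereProdStructure = fun z : S2 × S2 => genDirectSum (𝓡 2) (𝓡 2) z
      (genOfTangentEnd (𝓡 2) (sphereComplexStructure z.1))
      (genOfTangentEnd (𝓡 2) (sphereComplexStructure z.2)) := rfl
  rw [e]
  exact h

theorem endModel_sphereProdStructure_fst {z₀ : S2 × S2}
    {u : EuclideanSpace ℝ (Fin 2) × EuclideanSpace ℝ (Fin 2)}
    (h1 : u.1 ∈ (extChartAt (𝓡 2) z₀.1).target) (h2 : u.2 ∈ (extChartAt (𝓡 2) z₀.2).target)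
    (x : (EuclideanSpace ℝ (Fin 2) × EuclideanSpace ℝ (Fin 2)) ×
      (EuclideanSpace ℝ (Fin 2) × EuclideanSpace ℝ (Fin 2) →L[ℝ] ℝ)) :
    (endModel ((𝓡 2).prod (𝓡 2)) sphereProdStructure z₀ u x).1
      = (tangentEndModel (𝓡 2) sphereComplexStructure z₀.1 u.1 x.1.1,
        tangentEndModel (𝓡 2) sphereComplexStructure z₀.2 u.2 x.1.2) := by
  have h := endModel_genDirectSum (I := 𝓡 2) (I' := 𝓡 2) (z₀ := z₀) (u := u)
    (P := fun z : S2 × S2 => genOfTangentEnd (𝓡 2) (sphereComplexStructure z.1))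
    (Q := fun n : S2 => genOfTangentEnd (𝓡 2) (sphereComplexStructure n))
    (by rw [extChartAt_prod]; exact ⟨h1, h2⟩)
  refine (congrArg (fun L => (L x).1) h).trans ?_
  exact Prod.ext (add_zero _) (zero_add _)

theorem sphereModel_sq_sum (s : S2) (u : EuclideanSpace ℝ (Fin 2)) :
    sphereModel s u 0 ^ 2 + sphereModel s u 1 ^ 2 + sphereModel s u 2 ^ 2 = 1 :=
  S2.sq_sum _

theorem sphereModel_dot {s : S2} {u : EuclideanSpace ℝ (Fin 2)}
    (hu : u ∈ (extChartAt (𝓡 2) s).target) (v : EuclideanSpace ℝ (Fin 2)) :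
    sphereModel s u 0 * fderiv ℝ (sphereModel s) u v 0
      + sphereModel s u 1 * fderiv ℝ (sphereModel s) u v 1
      + sphereModel s u 2 * fderiv ℝ (sphereModel s) u v 2 = 0 := by
  rw [fderiv_sphereModel hu]
  exact sphereIncl_dot _ _

variable {E : Type*} [NormedAddCommGroup E] [NormedSpace ℝ E]
  {H : Type*} [TopologicalSpace H] {I : ModelWithCorners ℝ E H}
  {M : Type*} [TopologicalSpace M] [ChartedSpace H M] [IsManifold I 1 M]
  {J : Fin 3 → ∀ x : M, Module.End ℝ (GenTangent I x)}

theorem cliffordComb_sq (hJ : IsGenClifford I J) {a b : Fin 3 → ℝ}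
    (ha : a 0 ^ 2 + a 1 ^ 2 + a 2 ^ 2 = 1) (hb : b 0 ^ 2 + b 1 ^ 2 + b 2 ^ 2 = 1) (x : M) :
    cliffordComb I J a b x * cliffordComb I J a b x = -1 :=
  IsCliffordTriple.quatComb_sq (P := fun i => J i x) (fun i j => hJ.clifford i j x) ha hb

variable (I) in
/-- The pairing as a bilinear form. -/
def genPairingForm (x : M) : GenTangent I x →ₗ[ℝ] GenTangent I x →ₗ[ℝ] ℝ :=
  LinearMap.mk₂ ℝ (genPairing I)
    (fun a b c => by simp [genPairing]; ring)
    (fun r a b => by simp [genPairing]; ring)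
    (fun a b c => by simp [genPairing]; ring)
    (fun r a b => by simp [genPairing]; ring)

theorem cliffordComb_orth (hJ : IsGenClifford I J) {a b : Fin 3 → ℝ}
    (ha : a 0 ^ 2 + a 1 ^ 2 + a 2 ^ 2 = 1) (hb : b 0 ^ 2 + b 1 ^ 2 + b 2 ^ 2 = 1) (x : M)
    (v w : GenTangent I x) :
    genPairing I (cliffordComb I J a b x v) (cliffordComb I J a b x w) = genPairing I v w := by
  have skew : ∀ i v w, genPairingForm I x (J i x v) w = -genPairingForm I x v (J i x w) := by
    intro i v w
    have h : J i x (J i x v) = -v := LinearMap.congr_fun ((hJ.almost i).sq x) v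
    have h2 : genPairingForm I x (J i x (J i x v)) (J i x w) = genPairingForm I x (J i x v) w :=
      (hJ.almost i).orthogonal x _ _
    rw [← h2, h, map_neg, LinearMap.neg_apply]
  have key := quatComb_skew (P := fun i => J i x) (fun i j => hJ.clifford i j x)
    (AlgHom.id ℝ _) (genPairingForm I x) skew a b v (cliffordComb I J a b x w)
  have h : cliffordComb I J a b x (cliffordComb I J a b x w) = -w :=
    LinearMap.congr_fun (cliffordComb_sq hJ ha hb x) w
  -- ⟨Kv, Kw⟩ = −⟨v, K²w⟩ = ⟨v, w⟩, from skewness and K² = −1.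
  refine key.trans ?_
  refine (congrArg (fun y => -genPairingForm I x v y) h).trans ?_
  rw [map_neg, neg_neg]
  rfl

variable [FiniteDimensional ℝ E]

theorem endModel_cliffordComb {a b : Fin 3 → ℝ} {x₀ : M} {u : E}
    (hu : u ∈ (extChartAt I x₀).target) :
    endModel I (cliffordComb I J a b) x₀ u
      = quatComb (fun i => endModel I (J i) x₀ u) a b := by
  exact endHom_quatComb (symm_mem_source hu) (fun i => J i ((extChartAt I x₀).symm u)) a b

theorem isCliffordTriple_endModel (hJ : IsGenClifford I J) {x₀ : M} {u : E}
    (hu : u ∈ (extChartAt I x₀).target) :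
    IsCliffordTriple (fun i => endModel I (J i) x₀ u) := by
  have h : IsCliffordTriple fun i => J i ((extChartAt I x₀).symm u) :=
    fun i j => hJ.clifford i j _
  exact isCliffordTriple_endHom (symm_mem_source hu) h

variable [I.Boundaryless] [T2Space M] [IsManifold I ∞ M]

/-- The twistor structure of a rank 3 generalized Clifford structure is a generalized complex
structure. -/
theorem isGenComplex_twistorStructure (hJ : IsGenClifford I J) :
    IsGenComplex (I.prod ((𝓡 2).prod (𝓡 2))) (M := M × (S2 × S2)) (twistorStructure I J) := by
  have hJd : ∀ x₀ i, ContDiffAt ℝ ∞ (endModel I (J i) x₀) (extChartAt I x₀ x₀) := fun x₀ i =>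
    contDiffAt_endModel (hJ.almost i).smooth x₀
  have chart : ∀ z₀ : S2 × S2, extChartAt ((𝓡 2).prod (𝓡 2)) z₀ z₀
      = (extChartAt (𝓡 2) z₀.1 z₀.1, extChartAt (𝓡 2) z₀.2 z₀.2) := fun z₀ => by
    rw [extChartAt_prod]; rfl
  have hsm : ∀ z₀ : M × (S2 × S2), ContDiffAt ℝ ∞
      (fun u : E × (EuclideanSpace ℝ (Fin 2) × EuclideanSpace ℝ (Fin 2)) =>
        quatComb (fun i => endModel I (J i) z₀.1 u.1) (sphereModel z₀.2.1 u.2.1)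
          (sphereModel z₀.2.2 u.2.2))
      (extChartAt I z₀.1 z₀.1, extChartAt ((𝓡 2).prod (𝓡 2)) z₀.2 z₀.2) := by
    intro z₀
    rw [chart]
    exact contDiffAt_quatComb_prod (P := fun i => endModel I (J i) z₀.1) (hJd z₀.1)
      (contDiffAt_sphereModel z₀.2.1) (contDiffAt_sphereModel z₀.2.2)
  have h := isGenComplex_genDirectSum (I := I) (I' := (𝓡 2).prod (𝓡 2))
    (P := fun z : M × (S2 × S2) =>
      cliffordComb I J (fun l => (z.2.1 : EuclideanSpace ℝ (Fin 3)) l)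
        (fun l => (z.2.2 : EuclideanSpace ℝ (Fin 3)) l) z.1)
    (Q := sphereProdStructure)
    (fun z => cliffordComb_sq hJ (S2.sq_sum z.2.1) (S2.sq_sum z.2.2) z.1)
    (fun z => cliffordComb_orth hJ (S2.sq_sum z.2.1) (S2.sq_sum z.2.2) z.1)
    isGenComplex_sphereProdStructure
    (fun z₀ u => quatComb (fun i => endModel I (J i) z₀.1 u.1) (sphereModel z₀.2.1 u.2.1)
      (sphereModel z₀.2.2 u.2.2))
    (fun z₀ u h1 h2 => endModel_cliffordComb h1) hsm ?_ ?_
  · exact h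
  · intro z₀ x y
    have ht := extChartAt_target_mem_nhds (I := I) z₀.1
    -- On a slice both sphere points are fixed, so this is the integrability of one combination with
    -- constant unit coefficients.
    refine nijenhuis_quatComb (P := fun i => endModel I (J i) z₀.1)
      (fun i => (hJd z₀.1 i).differentiableAt (by simp)) ?_ ?_ ?_
      (sphereModel_sq_sum _ _) (sphereModel_sq_sum _ _) x y
    · filter_upwards [ht] with u hu using isCliffordTriple_endModel hJ hu
    · exact fun i x y => endModel_orth (hJ.almost i).orthogonal (mem_extChartAt_target z₀.1) x y
    · exact fun i => nijenhuis_endModel (hJ.almost i) (hJ.integrable i) z₀.1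
  · intro z₀ x y
    have m1 := mem_extChartAt_target (I := 𝓡 2) z₀.2.1
    have m2 := mem_extChartAt_target (I := 𝓡 2) z₀.2.2
    have e := endModel_sphereProdStructure_fst (z₀ := z₀.2)
      (u := (extChartAt (𝓡 2) z₀.2.1 z₀.2.1, extChartAt (𝓡 2) z₀.2.2 z₀.2.2)) m1 m2 x
    rw [chart, e]
    -- Holomorphy in both sphere variables: the vector part of 𝒥x is (j x₁, j x₂), and j acts on
    -- each sphere as n × ·.
    have key := fderiv_quatComb_prod_twist (P := fun i => endModel I (J i) z₀.1)
      (u := (extChartAt I z₀.1 z₀.1,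
        extChartAt (𝓡 2) z₀.2.1 z₀.2.1, extChartAt (𝓡 2) z₀.2.2 z₀.2.2))
      (fun i => (hJd z₀.1 i).of_le (by simp))
      (isCliffordTriple_endModel hJ (mem_extChartAt_target (I := I) z₀.1))
      ((contDiffAt_sphereModel z₀.2.1).of_le (by simp))
      ((contDiffAt_sphereModel z₀.2.2).of_le (by simp))
      (sphereModel_dot m1) (sphereModel_dot m2) (v := x.1)
      (w := (tangentEndModel (𝓡 2) sphereComplexStructure z₀.2.1 _ x.1.1,
        tangentEndModel (𝓡 2) sphereComplexStructure z₀.2.2 _ x.1.2))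
      (fderiv_sphereModel_complexStructure m1 x.1.1)
      (fderiv_sphereModel_complexStructure m2 x.1.2) y
    exact key

end Twistor

theorem theorem1p3 {E : Type*} [NormedAddCommGroup E] [NormedSpace ℝ E] [FiniteDimensional ℝ E]
    {M : Type*} [TopologicalSpace M] [T2Space M] [ChartedSpace E M] [IsManifold 𝓘(ℝ, E) ∞ M]
    (J : Fin 3 → ∀ x : M, Module.End ℝ (GenTangent 𝓘(ℝ, E) x))
    (hJ : IsGenClifford 𝓘(ℝ, E) J) :
    IsGenComplex (𝓘(ℝ, E).prod ((𝓡 2).prod (𝓡 2))) (M := M × (S2 × S2))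
      (twistorStructure 𝓘(ℝ, E) J) :=
  isGenComplex_twistorStructure hJ

end
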